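/- **Setting.** Let $\{0,1\}^{\mathbb N}$ carry Type-2 (Turing) computability. A represented space is a set $X$ with a partial surjection $\delta_X:\subseteq\{0,1\}^{\mathbb N}\to X$; if $\delta_X(p)=x$, then $p$ is a name of $x$. A real number is represented by sequences of rationals whose $i$-th term has distance less than $2^{-i}$ from it; subspaces, finite products and countable disjoint unions are represented in the usual way, and a real $n\times m$ matrix is given by $n$, $m$ and its entries. For multivalued functions $f:\subseteq X\rightrightarrows Y$ and $g:\subseteq U\rightrightarrows V$ between represented spaces, a realizer of $f$ is a partial function on $\{0,1\}^{\mathbb N}$ that maps every name of every $x\in\operatorname{dom}(f)$ to a name of some $y\in f(x)$. Write $f\leq_{\mathrm W}g$ if there are computable partial functions $K,H$ such that $p\mapsto K(p,G(H(p)))$ is a realizer of $f$ whenever $G$ is a realizer of $g$, and $f\equiv_{\mathrm W}g$ if $f\leq_{\mathrm W}g$ and $g\leq_{\mathrm W}f$. The multivalued function $f^*$ maps $(n,(x_1,\dots,x_n))$, with $n\in\mathbb N$, to all $(n,(y_1,\dots,y_n))$ with $y_i\in f(x_i)$ for all $i$. Finally, $f\star g$ is the maximum, with respect to $\leq_{\mathrm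 W}$, of all compositions $f'\circ g'$ of multivalued functions between represented spaces with $f'\leq_{\mathrm W}f$ and $g'\leq_{\mathrm W}g$. **Robust division** $\operatorname{rDiv}:\mathbb R\times\mathbb R\rightrightarrows[0,1]$ is defined by $\operatorname{rDiv}(x,y)=\{\min\{|x|,|y|\}/|y|\}$ if $y\neq0$, and $\operatorname{rDiv}(x,0)=[0,1]$. **LU-decomposition.** $\mathrm{LU\text{-}Decomp}_{P,Q}$ takes as input a real $n\times m$ matrix $A$ (with $n,m$ arbitrary) and outputs permutation matrices $P$ and $Q$, an upper triangular $n\times m$ matrix $U$ (that is, $U_{ij}=0$ for $j<i$) and a lower triangular $n\times n$ matrix $L$ with all diagonal elements equal to $1$, such that $PAQ=LU$. $\mathrm{LU\text{-}Decomp}_{P}$ is the variant in which $Q$ is required to be the identity matrix, so that only rows are permuted: $PA=LU$. **Theorem.** $$\mathrm{LU\text{-}Decomp}_{P,Q}\equiv_{\mathrm W}\operatorname{rDiv}^*\qquad\text{and}\qquad \operatorname{rDiv}^*\leq_{\mathrm W}\mathrm{LU\text{-}Decomp}_{P}\leq_{\mathrm W}\operatorname{rDiv}^*\star\operatorname{rDiv}^*.$$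 -/

import Mathlib

namespace WeihrauchLU

/-! ### Computability on Cantor space -/

/-- Cantor space `{0,1}^ℕ`, with `true` for the symbol `1`. -/
abbrev Cantor : Type := ℕ → Bool

/-- The prefix of length `k` of an infinite sequence. -/
def prefixOf (p : Cantor) (k : ℕ) : List Bool := (List.range k).map p

/-- The `i`-th component of `p` read as a tuple `⟨p₀, …, pₙ₋₁⟩` of `n` interleaved sequences. -/
def component (n : ℕ) (p : Cantor) (i : ℕ) : Cantor := fun k => p (n * k + i)

/-- With the word function `φ` describing the output written after reading a finite part of the
input, `q` is the infinite output produced on the infinite input `p`. -/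
def Produces (φ : List Bool → List Bool) (p q : Cantor) : Prop :=
  ∀ n, ∃ k, prefixOf q n <+: φ (prefixOf p k)

/-- Computable partial functions on Cantor space: the output is the limit of the finite words that
a computable function, monotone for the prefix order, assigns to the finite prefixes of the input.
This is computability by Type-2 machines (Turing machines with a one-way output tape). -/
def TypeTwoComputable (F : Cantor →. Cantor) : Prop :=
  ∃ φ : List Bool → List Bool, Computable φ ∧ (∀ u v, u <+: v → φ u <+: φ v) ∧
    ∀ p q, q ∈ F p → Produces φ p q

/-- Computability of a partial function of two arguments, through the pairing. -/
def TypeTwoComputable₂ (K : Cantor → Cantor → Part Cantor) : Prop :=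
  TypeTwoComputable (fun r => K (component 2 r 0) (component 2 r 1))

/-! ### Represented spaces -/

/-- A represented space: `IsName p x` says that the partial surjection `δ` from Cantor space onto
`X` maps `p` to `x`. -/
class Represented (X : Type) where
  IsName : Cantor → X → Prop
  unique : ∀ p x y, IsName p x → IsName p y → x = y
  exists_name : ∀ x, ∃ p, IsName p x

/-- A standard enumeration of the rational numbers (with repetitions). -/
def nuQ (n : ℕ) : ℚ :=
  (((n.unpair.1.unpair.1 : ℤ) - (n.unpair.1.unpair.2 : ℤ) : ℤ) : ℚ) / ((n.unpair.2 : ℚ) + 1)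

theorem nuQ_surjective : Function.Surjective nuQ := by
  intro q
  refine ⟨Nat.pair (Nat.pair q.num.toNat (-q.num).toNat) (q.den - 1), ?_⟩
  have hd : ((q.den - 1 : ℕ) : ℚ) + 1 = q.den := by
    have := q.den_pos
    rw [Nat.cast_sub (by omega)]
    simp
  have hn : ((q.num.toNat : ℤ) - ((-q.num).toNat : ℤ)) = q.num := by omega
  simp only [nuQ, Nat.unpair_pair, hd, hn]
  exact Rat.num_div_den q

/-- `p = 0^(a 0) 1 0^(a 1) 1 0^(a 2) 1 …`: the symbols `1` are at the places `a 0 + … + a k + k`. -/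
def IsBlockCode (p : Cantor) (a : ℕ → ℕ) : Prop :=
  ∀ j, p j = true ↔ ∃ k, (∑ i ∈ Finset.range (k + 1), a i) + k = j

theorem IsBlockCode.unique {p : Cantor} {a b : ℕ → ℕ} (ha : IsBlockCode p a)
    (hb : IsBlockCode p b) : a = b := by
  have mono : ∀ c : ℕ → ℕ, StrictMono fun k => (∑ i ∈ Finset.range (k + 1), c i) + k := by
    intro c
    refine strictMono_nat_of_lt_succ fun k => ?_
    rw [Finset.sum_range_succ _ (k + 1)]
    omega
  have hr : (fun k => (∑ i ∈ Finset.range (k + 1), a i) + k)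
      = fun k => (∑ i ∈ Finset.range (k + 1), b i) + k := by
    refine ((mono a).range_inj (mono b)).1 ?_
    ext j
    exact (ha j).symm.trans (hb j)
  have hs : ∀ k, ∑ i ∈ Finset.range k, a i = ∑ i ∈ Finset.range k, b i := by
    intro k
    cases k with
    | zero => simp
    | succ k => simpa using congrFun hr k
  funext k
  have h1 := hs (k + 1)
  rw [Finset.sum_range_succ, Finset.sum_range_succ, hs k] at h1
  omega

/-- The representation of the real numbers: `0^(a 0) 1 0^(a 1) 1 …` is a name of `x` iff
`|nuQ (a i) - x| < 2^(-i)` for all `i`. -/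
instance instRepresentedReal : Represented ℝ where
  IsName p x := ∃ a : ℕ → ℕ, IsBlockCode p a ∧ ∀ i, |(nuQ (a i) : ℝ) - x| < (1 / 2 : ℝ) ^ i
  unique := by
    rintro p x y ⟨a, ha, hx⟩ ⟨b, hb, hy⟩
    obtain rfl := ha.unique hb
    have lim : ∀ z : ℝ, (∀ i, |(nuQ (a i) : ℝ) - z| < (1 / 2 : ℝ) ^ i) →
        Filter.Tendsto (fun i => (nuQ (a i) : ℝ)) Filter.atTop (nhds z) := by
      intro z hz
      rw [tendsto_iff_dist_tendsto_zero]
      refine squeeze_zero (fun _ => dist_nonneg) (fun i => (hz i).le)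
        (tendsto_pow_atTop_nhds_zero_of_lt_one (by norm_num) (by norm_num))
    exact tendsto_nhds_unique (lim x hx) (lim y hy)
  exists_name := by
    classical
    intro x
    have h : ∀ i : ℕ, ∃ n : ℕ, |(nuQ n : ℝ) - x| < (1 / 2 : ℝ) ^ i := by
      intro i
      obtain ⟨q, h1, h2⟩ := exists_rat_btwn (show x < x + (1 / 2 : ℝ) ^ i by simp)
      obtain ⟨n, rfl⟩ := nuQ_surjective q
      exact ⟨n, by rw [abs_lt]; constructor <;> linarith [show (0 : ℝ) < (1 / 2 : ℝ) ^ i by simp]⟩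
    choose a ha using h
    exact ⟨fun j => decide (∃ k, (∑ i ∈ Finset.range (k + 1), a i) + k = j), a,
      fun j => by simp, ha⟩

/-- Subspaces. -/
instance instRepresentedSubspace {X : Type} [Represented X] (S : Set X) : Represented S where
  IsName p x := Represented.IsName p (x : X)
  unique p _ _ hx hy := Subtype.ext (Represented.unique p _ _ hx hy)
  exists_name x := Represented.exists_name (x : X)

/-- Binary products. -/
instance instRepresentedProd {X Y : Type} [Represented X] [Represented Y] :
    Represented (X × Y) where
  IsName p z := Represented.IsName (component 2 p 0) z.1 ∧ Represented.IsName (component 2 p 1) z.2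
  unique p _ _ hx hy :=
    Prod.ext (Represented.unique _ _ _ hx.1 hy.1) (Represented.unique _ _ _ hx.2 hy.2)
  exists_name z := by
    obtain ⟨p, hp⟩ := Represented.exists_name z.1
    obtain ⟨q, hq⟩ := Represented.exists_name z.2
    refine ⟨fun k => if k % 2 = 0 then p (k / 2) else q (k / 2), ?_, ?_⟩
    · convert hp using 1
      funext k
      simp [component]
    · convert hq using 1
      funext k
      simp only [component]
      rw [if_neg (by omega)]
      congr 1
      omega

/-- Finite powers `X^n`. -/
instance instRepresentedPow {X : Type} [Represented X] (n : ℕ) : Represented (Fin n → X) where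
  IsName p x := ∀ i : Fin n, Represented.IsName (component n p i) (x i)
  unique p _ _ hx hy := funext fun i => Represented.unique _ _ _ (hx i) (hy i)
  exists_name x := by
    choose p hp using fun i : Fin n => Represented.exists_name (x i)
    refine ⟨fun k => if h : k % n < n then p ⟨k % n, h⟩ (k / n) else false, fun i => ?_⟩
    convert hp i using 1
    funext k
    have hi := i.2
    have h1 : (n * k + i) % n = i := by rw [Nat.mul_add_mod, Nat.mod_eq_of_lt hi]
    have h2 : (n * k + i) / n = k := by
      rw [Nat.mul_add_div (by omega), Nat.div_eq_of_lt hi, Nat.add_zero]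
    simp [component, h1, h2]

/-- Countable disjoint unions: `0^n 1 p` is a name of `(n, x)` iff `p` is a name of `x`. -/
instance instRepresentedSigma {X : ℕ → Type} [∀ n, Represented (X n)] :
    Represented (Σ n, X n) where
  IsName p z := (∀ k < z.1, p k = false) ∧ p z.1 = true ∧
    Represented.IsName (fun k => p (z.1 + 1 + k)) z.2
  unique := by
    rintro p ⟨n, x⟩ ⟨m, y⟩ ⟨h1, h2, h3⟩ ⟨h4, h5, h6⟩
    obtain rfl : n = m := by
      rcases lt_trichotomy n m with h | h | h
      · have := h4 n h
        simp_all
      · exact h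
      · have := h1 m h
        simp_all
    obtain rfl := Represented.unique _ _ _ h3 h6
    rfl
  exists_name := by
    rintro ⟨n, x⟩
    obtain ⟨p, hp⟩ := Represented.exists_name x
    refine ⟨fun k => if k < n then false else if k = n then true else p (k - (n + 1)), ?_, ?_, ?_⟩
    · intro k hk
      simp only at hk
      simp [hk]
    · simp
    · convert hp using 1
      funext k
      simp only
      rw [if_neg (by omega), if_neg (by omega)]
      congr 1
      omega

instance instRepresentedMatrix (n m : ℕ) : Represented (Matrix (Fin n) (Fin m) ℝ) :=
  inferInstanceAs (Represented (Fin n → Fin m → ℝ))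

/-- The represented space of real matrices of arbitrary finite format. -/
abbrev RealMatrix : Type := Σ n : ℕ, Σ m : ℕ, Matrix (Fin n) (Fin m) ℝ

/-! ### Multivalued functions and Weihrauch reducibility

A partial multivalued function from `X` to `Y` is a map `f : X → Set Y`; its domain is the set of
all `x` with `f x` nonempty. -/

/-- `F` is a realizer of `f`. -/
def Realizes {X Y : Type} [Represented X] [Represented Y] (F : Cantor →. Cantor)
    (f : X → Set Y) : Prop :=
  ∀ p x, Represented.IsName p x → (f x).Nonempty → ∃ q ∈ F p, ∃ y ∈ f x, Represented.IsName q y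

/-- Weihrauch reducibility `f ≤_W g`: for computable `K` and `H`, the function
`p ↦ K (p, G (H p))` is a realizer of `f` whenever `G` is a realizer of `g`. -/
def WLE {X Y U V : Type} [Represented X] [Represented Y] [Represented U] [Represented V]
    (f : X → Set Y) (g : U → Set V) : Prop :=
  ∃ (K : Cantor → Cantor → Part Cantor) (H : Cantor →. Cantor),
    TypeTwoComputable₂ K ∧ TypeTwoComputable H ∧
    ∀ G : Cantor →. Cantor, Realizes G g →
      Realizes (fun p => (H p).bind fun h => (G h).bind fun q => K p q) f

/-- Weihrauch equivalence. -/
def WEquiv {X Y U V : Type} [Represented X] [Represented Y] [Represented U] [Represented V]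
    (f : X → Set Y) (g : U → Set V) : Prop :=
  WLE f g ∧ WLE g f

/-- `f^*`: for a number `n` and `n` instances of `f`, solve all of them. -/
def finStar {X Y : Type} (f : X → Set Y) : (Σ n : ℕ, (Fin n → X)) → Set (Σ n : ℕ, (Fin n → Y)) :=
  fun x => {z | ∃ y : Fin x.1 → Y, (∀ i, y i ∈ f (x.2 i)) ∧ z = ⟨x.1, y⟩}

/-- Composition of multivalued functions; `x` is in the domain of `f ∘ g` iff it is in the domain
of `g` and `g x` is contained in the domain of `f`. -/
def mcomp {X Y Z : Type} (f : Y → Set Z) (g : X → Set Y) : X → Set Z :=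
  fun x => {z | (∀ y ∈ g x, (f y).Nonempty) ∧ ∃ y ∈ g x, z ∈ f y}

/-- `h ≤_W f ⋆ g`. Since `f ⋆ g` is the maximum, for `≤_W`, of the compositions `f' ∘ g'` with
`f' ≤_W f` and `g' ≤_W g`, this says that `h` is reducible to one of these compositions. -/
def WLECompProduct {A B X Y U V : Type} [Represented A] [Represented B] [Represented X]
    [Represented Y] [Represented U] [Represented V]
    (h : A → Set B) (f : X → Set Y) (g : U → Set V) : Prop :=
  ∃ (R S T : Type) (_ : Represented R) (_ : Represented S) (_ : Represented T)
    (f' : S → Set T) (g' : R → Set S), WLE f' f ∧ WLE g' g ∧ WLE h (mcomp f' g')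

/-! ### Robust division and LU-decomposition -/

/-- Robust division `ℝ × ℝ ⇉ [0, 1]`. -/
def rDiv : ℝ × ℝ → Set (Set.Icc (0 : ℝ) 1) :=
  fun x => {z | x.2 ≠ 0 → (z : ℝ) = min |x.1| |x.2| / |x.2|}

/-- `P A Q = L U` for permutation matrices `P` and `Q`, a lower triangular matrix `L` with all
diagonal elements being `1`, and an upper triangular (upper trapezoidal) matrix `U`. -/
structure IsLUDecomp {n m : ℕ} (A : Matrix (Fin n) (Fin m) ℝ) (P : Matrix (Fin n) (Fin n) ℝ)
    (Q : Matrix (Fin m) (Fin m) ℝ) (U : Matrix (Fin n) (Fin m) ℝ)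
    (L : Matrix (Fin n) (Fin n) ℝ) : Prop where
  perm_left : ∃ σ : Equiv.Perm (Fin n), P = σ.permMatrix ℝ
  perm_right : ∃ τ : Equiv.Perm (Fin m), Q = τ.permMatrix ℝ
  upper : ∀ (i : Fin n) (j : Fin m), (j : ℕ) < (i : ℕ) → U i j = 0
  lower : ∀ i j : Fin n, i < j → L i j = 0
  diag : ∀ i : Fin n, L i i = 1
  eq : P * A * Q = L * U

/-- LU-decomposition with row and column permutations: on input `A`, output `(P, Q, U, L)`. -/
def luDecompPQ (A : RealMatrix) : Set (RealMatrix × RealMatrix × RealMatrix × RealMatrix) :=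
  {z | ∃ P Q U L, IsLUDecomp A.2.2 P Q U L ∧
    z = (⟨A.1, A.1, P⟩, ⟨A.2.1, A.2.1, Q⟩, ⟨A.1, A.2.1, U⟩, ⟨A.1, A.1, L⟩)}

/-- LU-decomposition with permutations on one side only: the rows may be permuted, and the matrix
`Q` permuting the columns is required to be the identity matrix. -/
def luDecompRow (A : RealMatrix) :
    Set (RealMatrix × RealMatrix × RealMatrix × RealMatrix) :=
  {z | ∃ P U L, IsLUDecomp A.2.2 P 1 U L ∧
    z = (⟨A.1, A.1, P⟩, ⟨A.2.1, A.2.1, 1⟩, ⟨A.1, A.2.1, U⟩, ⟨A.1, A.1, L⟩)}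

end WeihrauchLU

open WeihrauchLU

namespace WeihrauchLU

open Filter Topology

/-! ### Primitive recursive functions -/

attribute [fun_prop] Primrec

section Primitive

variable {α β γ : Type} [Primcodable α] [Primcodable β] [Primcodable γ]

@[fun_prop] theorem primrec_id' : Primrec (fun x : α => x) := Primrec.id

@[fun_prop] theorem primrec_const' (c : β) : Primrec (fun _ : α => c) := Primrec.const c

@[fun_prop] theorem primrec_comp' {f : β → γ} {g : α → β} (hf : Primrec f) (hg : Primrec g) :
    Primrec (fun x => f (g x)) := hf.comp hg

@[fun_prop] theorem primrec_fst' {f : α → β × γ} (hf : Primrec f) :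
    Primrec (fun x => (f x).1) := Primrec.fst.comp hf

@[fun_prop] theorem primrec_snd' {f : α → β × γ} (hf : Primrec f) :
    Primrec (fun x => (f x).2) := Primrec.snd.comp hf

@[fun_prop] theorem primrec_mk' {f : α → β} {g : α → γ} (hf : Primrec f) (hg : Primrec g) :
    Primrec (fun x => (f x, g x)) := hf.pair hg

@[fun_prop] theorem primrec_add' {f g : α → ℕ} (hf : Primrec f) (hg : Primrec g) :
    Primrec (fun x => f x + g x) := Primrec.nat_add.comp hf hg

@[fun_prop] theorem primrec_sub' {f g : α → ℕ} (hf : Primrec f) (hg : Primrec g) :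
    Primrec (fun x => f x - g x) := Primrec.nat_sub.comp hf hg

@[fun_prop] theorem primrec_mul' {f g : α → ℕ} (hf : Primrec f) (hg : Primrec g) :
    Primrec (fun x => f x * g x) := Primrec.nat_mul.comp hf hg

@[fun_prop] theorem primrec_div' {f g : α → ℕ} (hf : Primrec f) (hg : Primrec g) :
    Primrec (fun x => f x / g x) := Primrec.nat_div.comp hf hg

@[fun_prop] theorem primrec_mod' {f g : α → ℕ} (hf : Primrec f) (hg : Primrec g) :
    Primrec (fun x => f x % g x) := Primrec.nat_mod.comp hf hg

@[fun_prop] theorem primrec_pow' {f g : α → ℕ} (hf : Primrec f) (hg : Primrec g) :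
    Primrec (fun x => f x ^ g x) :=
  (Primrec₂.unpaired'.1 Nat.Primrec.pow).comp hf hg

@[fun_prop] theorem primrec_natPair' {f g : α → ℕ} (hf : Primrec f) (hg : Primrec g) :
    Primrec (fun x => Nat.pair (f x) (g x)) := Primrec₂.natPair.comp hf hg

@[fun_prop] theorem primrec_unpair' {f : α → ℕ} (hf : Primrec f) :
    Primrec (fun x => (f x).unpair) := Primrec.unpair.comp hf

@[fun_prop] theorem primrec_decide_lt {f g : α → ℕ} (hf : Primrec f) (hg : Primrec g) :
    Primrec (fun x => decide (f x < g x)) := (Primrec.nat_lt.comp hf hg).decide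

@[fun_prop] theorem primrec_decide_le {f g : α → ℕ} (hf : Primrec f) (hg : Primrec g) :
    Primrec (fun x => decide (f x ≤ g x)) := (Primrec.nat_le.comp hf hg).decide

@[fun_prop] theorem primrec_decide_eq {f g : α → ℕ} (hf : Primrec f) (hg : Primrec g) :
    Primrec (fun x => decide (f x = g x)) := (Primrec.eq.comp hf hg).decide

@[fun_prop] theorem primrec_decide_eq_true {f : α → Bool} (hf : Primrec f) :
    Primrec (fun x => decide (f x = true)) := hf.of_eq fun x => by simp

@[fun_prop] theorem primrec_and' {f g : α → Bool} (hf : Primrec f) (hg : Primrec g) :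
    Primrec (fun x => f x && g x) := Primrec.and.comp hf hg

@[fun_prop] theorem primrec_or' {f g : α → Bool} (hf : Primrec f) (hg : Primrec g) :
    Primrec (fun x => f x || g x) := Primrec.or.comp hf hg

@[fun_prop] theorem primrec_not' {f : α → Bool} (hf : Primrec f) :
    Primrec (fun x => !f x) := Primrec.not.comp hf

@[fun_prop] theorem primrec_ite' {c : α → Prop} [∀ x, Decidable (c x)] {f g : α → β}
    (hc : Primrec fun x => decide (c x)) (hf : Primrec f) (hg : Primrec g) :
    Primrec (fun x => if c x then f x else g x) := by
  refine (Primrec.cond hc hf hg).of_eq fun x => ?_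
  by_cases h : c x <;> simp [h]

@[fun_prop] theorem primrec_length' {f : α → List β} (hf : Primrec f) :
    Primrec (fun x => (f x).length) := Primrec.list_length.comp hf

@[fun_prop] theorem primrec_getD' {f : α → List β} {g : α → ℕ} (hf : Primrec f) (hg : Primrec g)
    (d : β) : Primrec (fun x => (f x).getD (g x) d) := (Primrec.list_getD d).comp hf hg

@[fun_prop] theorem primrec_take' {f : α → ℕ} {g : α → List β} (hf : Primrec f) (hg : Primrec g) :
    Primrec (fun x => (g x).take (f x)) := Primrec.list_take.comp hf hg

@[fun_prop] theorem primrec_map_range {n : α → ℕ} {f : α → ℕ → β} (hn : Primrec n)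
    (hf : Primrec fun y : α × ℕ => f y.1 y.2) : Primrec (fun x => (List.range (n x)).map (f x)) :=
  Primrec.list_map (Primrec.list_range.comp hn) hf

@[fun_prop] theorem primrec_nat_rec {n : α → ℕ} {f : α → β} {g : α → ℕ → β → β} (hn : Primrec n)
    (hf : Primrec f) (hg : Primrec fun y : α × ℕ × β => g y.1 y.2.1 y.2.2) :
    Primrec (fun x => Nat.rec (motive := fun _ => β) (f x) (g x) (n x)) :=
  (Primrec.nat_rec' (h := fun a p => g a p.1 p.2) hn hf hg)

/-- The first `i < n` with `c i`, and `n` if there is none. -/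
def firstIdx (n : ℕ) (c : ℕ → Bool) : ℕ := (List.range n).findIdx c

@[fun_prop] theorem primrec_firstIdx {n : α → ℕ} {c : α → ℕ → Bool} (hn : Primrec n)
    (hc : Primrec fun y : α × ℕ => c y.1 y.2) : Primrec (fun x => firstIdx (n x) (c x)) :=
  Primrec.list_findIdx (Primrec.list_range.comp hn) hc

/-- Bounded universal quantification, as a Boolean. -/
def allBelow (n : ℕ) (c : ℕ → Bool) : Bool :=
  Nat.rec (motive := fun _ => Bool) true (fun i b => b && c i) n

@[simp] theorem allBelow_eq_true {n : ℕ} {c : ℕ → Bool} :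
    allBelow n c = true ↔ ∀ i < n, c i = true := by
  unfold allBelow
  induction n with
  | zero => simp
  | succ n ih =>
    simp only [Bool.and_eq_true, ih, Nat.lt_succ_iff_lt_or_eq]
    constructor
    · rintro ⟨h1, h2⟩ i (hi | rfl)
      exacts [h1 i hi, h2]
    · exact fun h => ⟨fun i hi => h i (Or.inl hi), h n (Or.inr rfl)⟩

@[fun_prop] theorem primrec_allBelow {n : α → ℕ} {c : α → ℕ → Bool} (hn : Primrec n)
    (hc : Primrec fun y : α × ℕ => c y.1 y.2) : Primrec (fun x => allBelow (n x) (c x)) := by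
  unfold allBelow
  fun_prop

theorem firstIdx_le (n : ℕ) (c : ℕ → Bool) : firstIdx n c ≤ n := by
  simpa [firstIdx] using List.findIdx_le_length (p := c) (xs := List.range n)

theorem firstIdx_spec {n : ℕ} {c : ℕ → Bool} (h : firstIdx n c < n) : c (firstIdx n c) = true := by
  have := List.findIdx_getElem (p := c) (xs := List.range n) (w := by simpa [firstIdx] using h)
  simpa [firstIdx] using this

theorem firstIdx_min {n : ℕ} {c : ℕ → Bool} {i : ℕ} (h : i < firstIdx n c) : c i = false := by
  have h' : i < (List.range n).length := by simpa using h.trans_le (firstIdx_le n c)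
  have := List.not_of_lt_findIdx (p := c) (xs := List.range n) (i := i) h
  simpa using this

theorem firstIdx_eq {n : ℕ} {c : ℕ → Bool} {i : ℕ} (hi : i < n) (h : c i = true)
    (hmin : ∀ j < i, c j = false) : firstIdx n c = i := by
  have h1 : firstIdx n c ≤ i := by
    by_contra hlt
    have := firstIdx_min (not_le.1 hlt)
    simp_all
  rcases h1.lt_or_eq with h2 | h2
  · have := firstIdx_spec (h2.trans hi)
    simp_all
  · exact h2

theorem firstIdx_lt {n : ℕ} {c : ℕ → Bool} {i : ℕ} (hi : i < n) (h : c i = true) :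
    firstIdx n c < n := by
  refine lt_of_le_of_lt ?_ hi
  by_contra hlt
  have := firstIdx_min (not_le.1 hlt)
  simp_all

theorem firstIdx_mono {n n' : ℕ} {c : ℕ → Bool} (hn : n ≤ n') (h : firstIdx n c < n) :
    firstIdx n' c = firstIdx n c :=
  firstIdx_eq (h.trans_le hn) (firstIdx_spec h) fun _ hj => firstIdx_min hj

theorem firstIdx_congr {n : ℕ} {c c' : ℕ → Bool} (h : ∀ i < n, c i = c' i) :
    firstIdx n c = firstIdx n c' := by
  rcases (firstIdx_le n c).lt_or_eq with h1 | h1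
  · exact (firstIdx_eq h1 (by rw [← h _ h1]; exact firstIdx_spec h1)
      fun j hj => by rw [← h _ (hj.trans h1)]; exact firstIdx_min hj).symm
  · rcases (firstIdx_le n c').lt_or_eq with h2 | h2
    · exact firstIdx_eq h2 (by rw [h _ h2]; exact firstIdx_spec h2)
        fun j hj => by rw [h _ (hj.trans h2)]; exact firstIdx_min hj
    · rw [h1, h2]

/-- The entries of the list of numbers with code `d`. -/
def tbl (d i : ℕ) : ℕ := (Denumerable.ofNat (List ℕ) d).getD i 0

@[fun_prop] theorem primrec_tbl {f g : α → ℕ} (hf : Primrec f) (hg : Primrec g) :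
    Primrec (fun x => tbl (f x) (g x)) :=
  (Primrec.list_getD 0).comp ((Primrec.ofNat (List ℕ)).comp hf) hg

theorem exists_tbl (f : ℕ → ℕ) (N : ℕ) : ∃ d, ∀ i < N, tbl d i = f i := by
  refine ⟨Encodable.encode ((List.range N).map f), fun i hi => ?_⟩
  simp [tbl, hi]

/-- Iteration of a transformation of tables of length `N`. -/
def iterTab (N : ℕ) (init : ℕ → ℕ) (step : ℕ → (ℕ → ℕ) → ℕ → ℕ) (t : ℕ) : List ℕ :=
  Nat.rec (motive := fun _ => List ℕ) ((List.range N).map init)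
    (fun t l => (List.range N).map fun i => step t (fun r => l.getD r 0) i) t

/-- The entries of an iterated table. -/
def itab (N : ℕ) (init : ℕ → ℕ) (step : ℕ → (ℕ → ℕ) → ℕ → ℕ) (t i : ℕ) : ℕ :=
  (iterTab N init step t).getD i 0

theorem itab_zero {N : ℕ} {init : ℕ → ℕ} {step : ℕ → (ℕ → ℕ) → ℕ → ℕ} {i : ℕ} (hi : i < N) :
    itab N init step 0 i = init i := by
  simp [itab, iterTab, hi]

theorem itab_succ {N : ℕ} {init : ℕ → ℕ} {step : ℕ → (ℕ → ℕ) → ℕ → ℕ} {t i : ℕ} (hi : i < N) :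
    itab N init step (t + 1) i = step t (itab N init step t) i := by
  simp only [itab, iterTab, List.getD_eq_getElem?_getD, List.getElem?_map,
    List.getElem?_range hi, Option.map_some, Option.getD_some]
  rfl

@[fun_prop] theorem primrec_itab {N : α → ℕ} {init : α → ℕ → ℕ}
    {step : α → ℕ → (ℕ → ℕ) → ℕ → ℕ} {t i : α → ℕ} (hN : Primrec N)
    (hinit : Primrec fun y : α × ℕ => init y.1 y.2)
    (hstep : Primrec fun y : α × ℕ × List ℕ × ℕ =>
      step y.1 y.2.1 (fun r => y.2.2.1.getD r 0) y.2.2.2)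
    (ht : Primrec t) (hi : Primrec i) :
    Primrec (fun x => itab (N x) (init x) (step x) (t x) (i x)) := by
  unfold itab iterTab
  have h : Primrec fun y : α × ℕ × List ℕ =>
      (List.range (N y.1)).map fun i => step y.1 y.2.1 (fun r => y.2.2.getD r 0) i := by
    refine primrec_map_range (by fun_prop) ?_
    exact hstep.comp (g := fun z : (α × ℕ × List ℕ) × ℕ => (z.1.1, z.1.2.1, z.1.2.2, z.2))
      (by fun_prop)
  refine primrec_getD' ?_ hi 0
  exact primrec_nat_rec (g := fun x t l => (List.range (N x)).map fun i =>
    step x t (fun r => l.getD r 0) i) ht (by fun_prop) h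

end Primitive

/-! ### Arithmetic on codes of rational numbers -/

/-- The code of `(p - n) / d`. -/
def mkQ (p n d : ℕ) : ℕ := Nat.pair (Nat.pair p n) (d - 1)

theorem nuQ_mkQ (p n : ℕ) {d : ℕ} (hd : 0 < d) : nuQ (mkQ p n d) = ((p : ℚ) - n) / d := by
  have : ((d - 1 : ℕ) : ℚ) + 1 = d := by
    rw [Nat.cast_sub (by omega)]
    simp
  simp [nuQ, mkQ, this]

def posQ (a : ℕ) : ℕ := a.unpair.1.unpair.1
def negQ (a : ℕ) : ℕ := a.unpair.1.unpair.2
def denQ (a : ℕ) : ℕ := a.unpair.2 + 1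

theorem denQ_pos (a : ℕ) : 0 < denQ a := Nat.succ_pos _

theorem nuQ_eq (a : ℕ) : nuQ a = ((posQ a : ℚ) - negQ a) / denQ a := by
  simp [nuQ, posQ, negQ, denQ]

def qadd (a b : ℕ) : ℕ :=
  mkQ (posQ a * denQ b + posQ b * denQ a) (negQ a * denQ b + negQ b * denQ a) (denQ a * denQ b)

def qneg (a : ℕ) : ℕ := mkQ (negQ a) (posQ a) (denQ a)

def qmul (a b : ℕ) : ℕ :=
  mkQ (posQ a * posQ b + negQ a * negQ b) (posQ a * negQ b + negQ a * posQ b) (denQ a * denQ b)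

def qlt (a b : ℕ) : Bool :=
  decide (posQ a * denQ b + negQ b * denQ a < posQ b * denQ a + negQ a * denQ b)

def qmax (a b : ℕ) : ℕ := if qlt a b then b else a

def qmin (a b : ℕ) : ℕ := if qlt a b then a else b

def qabs (a : ℕ) : ℕ := qmax a (qneg a)

/-- The code of the inverse of a positive rational number. -/
def qinv (a : ℕ) : ℕ := mkQ (denQ a) 0 (posQ a - negQ a)

/-- The code of a natural number. -/
def qnat (k : ℕ) : ℕ := mkQ k 0 1

/-- The code of `2 ^ (-k)`. -/
def qhalf (k : ℕ) : ℕ := mkQ 1 0 (2 ^ k)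

theorem nuQ_qadd (a b : ℕ) : nuQ (qadd a b) = nuQ a + nuQ b := by
  have ha : (denQ a : ℚ) ≠ 0 := by exact_mod_cast (denQ_pos a).ne'
  have hb : (denQ b : ℚ) ≠ 0 := by exact_mod_cast (denQ_pos b).ne'
  rw [qadd, nuQ_mkQ _ _ (Nat.mul_pos (denQ_pos a) (denQ_pos b)), nuQ_eq a, nuQ_eq b]
  push_cast
  field_simp
  ring

theorem nuQ_qneg (a : ℕ) : nuQ (qneg a) = -nuQ a := by
  rw [qneg, nuQ_mkQ _ _ (denQ_pos a), nuQ_eq a]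
  ring

theorem nuQ_qmul (a b : ℕ) : nuQ (qmul a b) = nuQ a * nuQ b := by
  have ha : (denQ a : ℚ) ≠ 0 := by exact_mod_cast (denQ_pos a).ne'
  have hb : (denQ b : ℚ) ≠ 0 := by exact_mod_cast (denQ_pos b).ne'
  rw [qmul, nuQ_mkQ _ _ (Nat.mul_pos (denQ_pos a) (denQ_pos b)), nuQ_eq a, nuQ_eq b]
  push_cast
  field_simp
  ring

theorem qlt_iff (a b : ℕ) : qlt a b = true ↔ nuQ a < nuQ b := by
  have ha : (0 : ℚ) < denQ a := by exact_mod_cast denQ_pos a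
  have hb : (0 : ℚ) < denQ b := by exact_mod_cast denQ_pos b
  rw [qlt, decide_eq_true_iff, nuQ_eq a, nuQ_eq b, div_lt_div_iff₀ ha hb, ← Nat.cast_lt (α := ℚ)]
  push_cast
  constructor <;> intro h <;> linarith

theorem nuQ_qmax (a b : ℕ) : nuQ (qmax a b) = max (nuQ a) (nuQ b) := by
  unfold qmax
  split_ifs with h
  · rw [max_eq_right ((qlt_iff a b).1 h).le]
  · rw [max_eq_left (not_lt.1 fun h' => h ((qlt_iff a b).2 h'))]

theorem nuQ_qmin (a b : ℕ) : nuQ (qmin a b) = min (nuQ a) (nuQ b) := by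
  unfold qmin
  split_ifs with h
  · rw [min_eq_left ((qlt_iff a b).1 h).le]
  · rw [min_eq_right (not_lt.1 fun h' => h ((qlt_iff a b).2 h'))]

theorem nuQ_qabs (a : ℕ) : nuQ (qabs a) = |nuQ a| := by
  rw [qabs, nuQ_qmax, nuQ_qneg, abs]

theorem nuQ_qinv {a : ℕ} (ha : 0 < nuQ a) : nuQ (qinv a) = (nuQ a)⁻¹ := by
  have hd : (0 : ℚ) < denQ a := by exact_mod_cast denQ_pos a
  rw [nuQ_eq a] at ha ⊢
  have h1 : (negQ a : ℚ) < posQ a := by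
    by_contra h
    have := div_nonpos_of_nonpos_of_nonneg (sub_nonpos.2 (not_lt.1 h)) hd.le
    linarith
  have h2 : negQ a < posQ a := by exact_mod_cast h1
  rw [qinv, nuQ_mkQ _ _ (by omega), Nat.cast_sub h2.le, inv_div]
  simp

theorem nuQ_qnat (k : ℕ) : nuQ (qnat k) = k := by
  rw [qnat, nuQ_mkQ _ _ one_pos]
  simp

theorem nuQ_qhalf (k : ℕ) : nuQ (qhalf k) = (1 / 2) ^ k := by
  rw [qhalf, nuQ_mkQ _ _ (by positivity)]
  simp

section Primitive

variable {α : Type} [Primcodable α]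

@[fun_prop] theorem primrec_mkQ {f g h : α → ℕ} (hf : Primrec f) (hg : Primrec g)
    (hh : Primrec h) : Primrec (fun x => mkQ (f x) (g x) (h x)) := by
  unfold mkQ
  fun_prop

@[fun_prop] theorem primrec_posQ {f : α → ℕ} (hf : Primrec f) :
    Primrec (fun x => posQ (f x)) := by
  unfold posQ
  fun_prop

@[fun_prop] theorem primrec_negQ {f : α → ℕ} (hf : Primrec f) :
    Primrec (fun x => negQ (f x)) := by
  unfold negQ
  fun_prop

@[fun_prop] theorem primrec_denQ {f : α → ℕ} (hf : Primrec f) :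
    Primrec (fun x => denQ (f x)) := by
  unfold denQ
  fun_prop

@[fun_prop] theorem primrec_qadd {f g : α → ℕ} (hf : Primrec f) (hg : Primrec g) :
    Primrec (fun x => qadd (f x) (g x)) := by
  unfold qadd
  fun_prop

@[fun_prop] theorem primrec_qneg {f : α → ℕ} (hf : Primrec f) :
    Primrec (fun x => qneg (f x)) := by
  unfold qneg
  fun_prop

@[fun_prop] theorem primrec_qmul {f g : α → ℕ} (hf : Primrec f) (hg : Primrec g) :
    Primrec (fun x => qmul (f x) (g x)) := by
  unfold qmul
  fun_prop

@[fun_prop] theorem primrec_qlt {f g : α → ℕ} (hf : Primrec f) (hg : Primrec g) :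
    Primrec (fun x => qlt (f x) (g x)) := by
  unfold qlt
  fun_prop

@[fun_prop] theorem primrec_qmax {f g : α → ℕ} (hf : Primrec f) (hg : Primrec g) :
    Primrec (fun x => qmax (f x) (g x)) := by
  unfold qmax
  fun_prop

@[fun_prop] theorem primrec_qmin {f g : α → ℕ} (hf : Primrec f) (hg : Primrec g) :
    Primrec (fun x => qmin (f x) (g x)) := by
  unfold qmin
  fun_prop

@[fun_prop] theorem primrec_qabs {f : α → ℕ} (hf : Primrec f) :
    Primrec (fun x => qabs (f x)) := by
  unfold qabs
  fun_prop

@[fun_prop] theorem primrec_qinv {f : α → ℕ} (hf : Primrec f) :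
    Primrec (fun x => qinv (f x)) := by
  unfold qinv
  fun_prop

@[fun_prop] theorem primrec_qnat {f : α → ℕ} (hf : Primrec f) :
    Primrec (fun x => qnat (f x)) := by
  unfold qnat
  fun_prop

@[fun_prop] theorem primrec_qhalf {f : α → ℕ} (hf : Primrec f) :
    Primrec (fun x => qhalf (f x)) := by
  unfold qhalf
  fun_prop

end Primitive

/-! ### Ball arithmetic -/

/-- The centre of the ball with code `b`. -/
def cen (b : ℕ) : ℝ := (nuQ b.unpair.1 : ℝ)

/-- The radius of the ball with code `b`. -/
def rad (b : ℕ) : ℝ := (nuQ b.unpair.2 : ℝ)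

/-- The balls with codes `b 0, b 1, …` contain `x`, and their radii tend to zero. -/
structure Approx (b : ℕ → ℕ) (x : ℝ) : Prop where
  le : ∀ κ, |cen (b κ) - x| ≤ rad (b κ)
  lim : Tendsto (fun κ => rad (b κ)) atTop (𝓝 0)

theorem Approx.rad_nonneg {b : ℕ → ℕ} {x : ℝ} (h : Approx b x) (κ : ℕ) : 0 ≤ rad (b κ) :=
  (abs_nonneg _).trans (h.le κ)

theorem Approx.tendsto {b : ℕ → ℕ} {x : ℝ} (h : Approx b x) :
    Tendsto (fun κ => cen (b κ)) atTop (𝓝 x) := by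
  rw [tendsto_iff_dist_tendsto_zero]
  exact squeeze_zero (fun _ => dist_nonneg) h.le h.lim

def bconst (q : ℕ) : ℕ := Nat.pair q 0

def badd (a b : ℕ) : ℕ :=
  Nat.pair (qadd a.unpair.1 b.unpair.1) (qadd a.unpair.2 b.unpair.2)

def bneg (a : ℕ) : ℕ := Nat.pair (qneg a.unpair.1) a.unpair.2

def bsub (a b : ℕ) : ℕ := badd a (bneg b)

def bmul (a b : ℕ) : ℕ :=
  Nat.pair (qmul a.unpair.1 b.unpair.1)
    (qadd (qadd (qmul (qabs a.unpair.1) b.unpair.2) (qmul (qabs b.unpair.1) a.unpair.2))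
      (qmul a.unpair.2 b.unpair.2))

def babs (a : ℕ) : ℕ := Nat.pair (qabs a.unpair.1) a.unpair.2

def bmin (a b : ℕ) : ℕ :=
  Nat.pair (qmin a.unpair.1 b.unpair.1) (qmax a.unpair.2 b.unpair.2)

/-- The image of a ball under the projection onto the unit interval. -/
def bclamp (a : ℕ) : ℕ := Nat.pair (qmin (qmax a.unpair.1 0) (qnat 1)) a.unpair.2

/-- The image of a ball under `x ↦ 1 / max x 1`. -/
def binvMax (a : ℕ) : ℕ := Nat.pair (qinv (qmax a.unpair.1 (qnat 1))) a.unpair.2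

/-- The image of a ball under inversion of numbers of absolute value at least `2 ^ (-h)`. -/
def binv (h a : ℕ) : ℕ :=
  Nat.pair (qmul a.unpair.1 (qinv (qmax (qmul a.unpair.1 a.unpair.1) (qhalf (h + h)))))
    (qmul (qnat (2 ^ (h + h))) a.unpair.2)

def bsum (n : ℕ) (f : ℕ → ℕ) : ℕ :=
  Nat.rec (motive := fun _ => ℕ) 0 (fun i s => badd s (f i)) n

@[simp] theorem nuQ_zero : nuQ 0 = 0 := by simp [nuQ]

@[simp] theorem cen_zero : cen 0 = 0 := by simp [cen]

@[simp] theorem rad_zero : rad 0 = 0 := by simp [rad]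

theorem Approx.const {q : ℕ} : Approx (fun _ => bconst q) (nuQ q) :=
  ⟨fun κ => by simp [cen, rad, bconst], by simp [rad, bconst]⟩

theorem Approx.zero : Approx (fun _ => 0) 0 :=
  ⟨fun κ => by simp, by simp⟩

theorem Approx.nat (k : ℕ) : Approx (fun _ => bconst (qnat k)) k := by
  have := Approx.const (q := qnat k)
  rwa [nuQ_qnat, Rat.cast_natCast] at this

theorem Approx.of_lipschitz {b c : ℕ → ℕ} {x y K : ℝ} (h : Approx b x)
    (hle : ∀ κ, |cen (c κ) - y| ≤ K * |cen (b κ) - x|) (hK : 0 ≤ K)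
    (hr : ∀ κ, rad (c κ) = K * rad (b κ)) : Approx c y :=
  ⟨fun κ => by
    rw [hr]
    exact (hle κ).trans (mul_le_mul_of_nonneg_left (h.le κ) hK),
  by simpa [hr] using h.lim.const_mul K⟩

section

variable {a b : ℕ → ℕ} {x y : ℝ}

theorem Approx.add (ha : Approx a x) (hb : Approx b y) :
    Approx (fun κ => badd (a κ) (b κ)) (x + y) := by
  refine ⟨fun κ => ?_, ?_⟩
  · have h1 := abs_le.1 (ha.le κ)
    have h2 := abs_le.1 (hb.le κ)
    simp only [cen, rad, badd, Nat.unpair_pair, nuQ_qadd, Rat.cast_add] at *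
    rw [abs_le]
    constructor <;> linarith
  · simpa [rad, badd, nuQ_qadd] using ha.lim.add hb.lim

theorem Approx.neg (ha : Approx a x) : Approx (fun κ => bneg (a κ)) (-x) := by
  refine ha.of_lipschitz (K := 1) (fun κ => ?_) zero_le_one fun κ => by simp [rad, bneg]
  simp only [cen, bneg, Nat.unpair_pair, nuQ_qneg, Rat.cast_neg, one_mul]
  rw [← abs_neg]
  apply le_of_eq
  congr 1
  ring

theorem Approx.sub (ha : Approx a x) (hb : Approx b y) :
    Approx (fun κ => bsub (a κ) (b κ)) (x - y) := by
  rw [sub_eq_add_neg]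
  exact ha.add hb.neg

theorem Approx.mul (ha : Approx a x) (hb : Approx b y) :
    Approx (fun κ => bmul (a κ) (b κ)) (x * y) := by
  have hr : ∀ κ, rad (bmul (a κ) (b κ))
      = |cen (a κ)| * rad (b κ) + |cen (b κ)| * rad (a κ) + rad (a κ) * rad (b κ) := by
    intro κ
    simp [rad, cen, bmul, nuQ_qadd, nuQ_qmul, nuQ_qabs]
  have hc : ∀ κ, cen (bmul (a κ) (b κ)) = cen (a κ) * cen (b κ) := by
    intro κ
    simp [cen, bmul, nuQ_qmul]
  refine ⟨fun κ => ?_, ?_⟩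
  · rw [hr, hc]
    have e : cen (a κ) * cen (b κ) - x * y = cen (a κ) * (cen (b κ) - y)
        + cen (b κ) * (cen (a κ) - x) - (cen (a κ) - x) * (cen (b κ) - y) := by ring
    rw [e]
    refine (abs_sub _ _).trans (add_le_add ((abs_add_le _ _).trans (add_le_add ?_ ?_)) ?_)
    · rw [abs_mul]
      exact mul_le_mul_of_nonneg_left (hb.le κ) (abs_nonneg _)
    · rw [abs_mul]
      exact mul_le_mul_of_nonneg_left (ha.le κ) (abs_nonneg _)
    · rw [abs_mul]
      exact mul_le_mul (ha.le κ) (hb.le κ) (abs_nonneg _) (ha.rad_nonneg κ)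
  · simp only [hr]
    have := ((ha.tendsto.abs.mul hb.lim).add (hb.tendsto.abs.mul ha.lim)).add (ha.lim.mul hb.lim)
    simpa using this

theorem Approx.abs_ball (ha : Approx a x) : Approx (fun κ => babs (a κ)) |x| := by
  refine ha.of_lipschitz (K := 1) (fun κ => ?_) zero_le_one fun κ => by simp [rad, babs]
  simp only [cen, babs, Nat.unpair_pair, nuQ_qabs, Rat.cast_abs, one_mul]
  exact abs_abs_sub_abs_le_abs_sub _ _

theorem Approx.min_ball (ha : Approx a x) (hb : Approx b y) :
    Approx (fun κ => bmin (a κ) (b κ)) (min x y) := by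
  refine ⟨fun κ => ?_, ?_⟩
  · have h1 := ha.le κ
    have h2 := hb.le κ
    simp only [cen, rad, bmin, Nat.unpair_pair, nuQ_qmin, nuQ_qmax, Rat.cast_min,
      Rat.cast_max] at *
    exact (abs_min_sub_min_le_max _ _ _ _).trans (max_le_max h1 h2)
  · simpa [rad, bmin, nuQ_qmax] using ha.lim.max hb.lim

theorem Approx.clamp (ha : Approx a x) :
    Approx (fun κ => bclamp (a κ)) (min (max x 0) 1) := by
  refine ha.of_lipschitz (K := 1) (fun κ => ?_) zero_le_one fun κ => by
    simp [rad, bclamp]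
  simp only [cen, bclamp, Nat.unpair_pair, nuQ_qmin, nuQ_qmax, Rat.cast_min, Rat.cast_max,
    nuQ_zero, nuQ_qnat, one_mul]
  push_cast
  refine (abs_min_sub_min_le_max _ _ _ _).trans (max_le ?_ (by simp))
  exact (abs_max_sub_max_le_max _ _ _ _).trans (max_le le_rfl (by simp))

theorem Approx.invMax (ha : Approx a x) :
    Approx (fun κ => binvMax (a κ)) (max x 1)⁻¹ := by
  refine ha.of_lipschitz (K := 1) (fun κ => ?_) zero_le_one fun κ => by simp [rad, binvMax]
  have hp : ∀ c : ℕ, 0 < nuQ (qmax c (qnat 1)) := fun c => by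
    rw [nuQ_qmax, nuQ_qnat]
    exact lt_max_of_lt_right (by norm_num)
  simp only [cen, binvMax, Nat.unpair_pair, nuQ_qinv (hp _), one_mul]
  rw [nuQ_qmax, nuQ_qnat]
  push_cast
  set c : ℝ := (nuQ (a κ).unpair.1 : ℝ)
  have h1 : (1 : ℝ) ≤ max c 1 := le_max_right _ _
  have h2 : (1 : ℝ) ≤ max x 1 := le_max_right _ _
  rw [inv_sub_inv (by positivity) (by positivity), abs_div]
  refine (div_le_self (abs_nonneg _) ?_).trans ?_
  · rw [abs_of_pos (by positivity)]
    nlinarith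
  · rw [abs_sub_comm]
    exact (abs_max_sub_max_le_max _ _ _ _).trans (max_le le_rfl (by simp))

theorem abs_mul_inv_max_sub_inv_le {c y δ : ℝ} (hδ : 0 < δ) (hy : δ ≤ |y|) :
    |c * (max (c * c) (δ * δ))⁻¹ - y⁻¹| ≤ (δ * δ)⁻¹ * |c - y| := by
  have hy0 : y ≠ 0 := fun h => by
    rw [h, abs_zero] at hy
    linarith
  have hyp : 0 < |y| := abs_pos.2 hy0
  rcases le_or_gt (δ * δ) (c * c) with h | h
  · have hc : δ ≤ |c| := by
      rw [← abs_of_pos hδ]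
      exact sq_le_sq.1 (by simpa [sq] using h)
    have hc0 : c ≠ 0 := fun h => by
      rw [h, abs_zero] at hc
      linarith
    rw [max_eq_left h, show c * (c * c)⁻¹ - y⁻¹ = (c * y)⁻¹ * (y - c) by field_simp, abs_mul,
      abs_sub_comm y c, abs_inv, abs_mul]
    refine mul_le_mul_of_nonneg_right ?_ (abs_nonneg _)
    exact inv_anti₀ (by positivity) (mul_le_mul hc hy hδ.le (abs_nonneg _))
  · rw [max_eq_right h.le,
      show c * (δ * δ)⁻¹ - y⁻¹ = (δ * δ)⁻¹ * ((c * y - δ * δ) / y) by field_simp, abs_mul,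
      abs_of_pos (by positivity : (0 : ℝ) < (δ * δ)⁻¹)]
    refine mul_le_mul_of_nonneg_left ?_ (by positivity)
    rw [abs_div, div_le_iff₀ hyp, ← abs_mul]
    have h3 : δ * δ ≤ y * y := by
      have := mul_le_mul hy hy hδ.le (abs_nonneg _)
      rwa [abs_mul_abs_self] at this
    have h4 : c * y - y * y ≤ 0 := by nlinarith [sq_nonneg (c - y)]
    rw [sub_mul, abs_of_nonpos h4, abs_le]
    constructor
    · nlinarith
    · nlinarith [sq_nonneg (c - y)]

theorem Approx.inv (ha : Approx a x) {h : ℕ} (hx : (1 / 2 : ℝ) ^ h ≤ |x|) :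
    Approx (fun κ => binv h (a κ)) x⁻¹ := by
  have hK : (2 : ℝ) ^ (h + h) = ((1 / 2 : ℝ) ^ h * (1 / 2 : ℝ) ^ h)⁻¹ := by
    rw [← pow_add, one_div, inv_pow, inv_inv]
  refine ha.of_lipschitz (K := 2 ^ (h + h)) (fun κ => ?_) (by positivity) fun κ => by
    simp [rad, binv, nuQ_qmul, nuQ_qnat]
  have hp : ∀ c : ℕ, 0 < nuQ (qmax c (qhalf (h + h))) := fun c => by
    rw [nuQ_qmax, nuQ_qhalf]
    exact lt_max_of_lt_right (by positivity)
  simp only [cen, binv, Nat.unpair_pair, nuQ_qmul, nuQ_qinv (hp _)]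
  rw [nuQ_qmax, nuQ_qhalf, nuQ_qmul, pow_add]
  push_cast
  have := abs_mul_inv_max_sub_inv_le (c := (nuQ (a κ).unpair.1 : ℝ)) (y := x)
    (δ := (1 / 2 : ℝ) ^ h) (by positivity) hx
  rw [← hK] at this
  exact this

end

theorem Approx.sum {b : ℕ → ℕ → ℕ} {x : ℕ → ℝ} {n : ℕ}
    (h : ∀ i < n, Approx (fun κ => b κ i) (x i)) :
    Approx (fun κ => bsum n (b κ)) (∑ i ∈ Finset.range n, x i) := by
  induction n with
  | zero => simpa [bsum] using Approx.zero
  | succ n ih =>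
    rw [Finset.sum_range_succ]
    exact (ih fun i hi => h i (by omega)).add (h n (by omega))

section Primitive

variable {α : Type} [Primcodable α]

@[fun_prop] theorem primrec_bconst {f : α → ℕ} (hf : Primrec f) :
    Primrec (fun x => bconst (f x)) := by
  unfold bconst
  fun_prop

@[fun_prop] theorem primrec_badd {f g : α → ℕ} (hf : Primrec f) (hg : Primrec g) :
    Primrec (fun x => badd (f x) (g x)) := by
  unfold badd
  fun_prop

@[fun_prop] theorem primrec_bneg {f : α → ℕ} (hf : Primrec f) :
    Primrec (fun x => bneg (f x)) := by
  unfold bneg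
  fun_prop

@[fun_prop] theorem primrec_bsub {f g : α → ℕ} (hf : Primrec f) (hg : Primrec g) :
    Primrec (fun x => bsub (f x) (g x)) := by
  unfold bsub
  fun_prop

@[fun_prop] theorem primrec_bmul {f g : α → ℕ} (hf : Primrec f) (hg : Primrec g) :
    Primrec (fun x => bmul (f x) (g x)) := by
  unfold bmul
  fun_prop

@[fun_prop] theorem primrec_babs {f : α → ℕ} (hf : Primrec f) :
    Primrec (fun x => babs (f x)) := by
  unfold babs
  fun_prop

@[fun_prop] theorem primrec_bmin {f g : α → ℕ} (hf : Primrec f) (hg : Primrec g) :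
    Primrec (fun x => bmin (f x) (g x)) := by
  unfold bmin
  fun_prop

@[fun_prop] theorem primrec_bclamp {f : α → ℕ} (hf : Primrec f) :
    Primrec (fun x => bclamp (f x)) := by
  unfold bclamp
  fun_prop

@[fun_prop] theorem primrec_binvMax {f : α → ℕ} (hf : Primrec f) :
    Primrec (fun x => binvMax (f x)) := by
  unfold binvMax
  fun_prop

@[fun_prop] theorem primrec_binv {f g : α → ℕ} (hf : Primrec f) (hg : Primrec g) :
    Primrec (fun x => binv (f x) (g x)) := by
  unfold binv
  fun_prop

@[fun_prop] theorem primrec_bsum {n : α → ℕ} {f : α → ℕ → ℕ} (hn : Primrec n)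
    (hf : Primrec fun y : α × ℕ => f y.1 y.2) : Primrec (fun x => bsum (n x) (f x)) := by
  unfold bsum
  have : Primrec fun y : α × ℕ × ℕ => f y.1 y.2.1 :=
    hf.comp (g := fun y : α × ℕ × ℕ => (y.1, y.2.1)) (by fun_prop)
  fun_prop

end Primitive

/-! ### Reading names -/

theorem getD_prefixOf (p : Cantor) (T k : ℕ) :
    (prefixOf p T).getD k false = if k < T then p k else false := by
  split_ifs with h <;> simp [prefixOf, h]

@[simp] theorem length_prefixOf (p : Cantor) (T : ℕ) : (prefixOf p T).length = T := by
  simp [prefixOf]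

theorem take_prefixOf (p : Cantor) {t T : ℕ} (h : t ≤ T) :
    (prefixOf p T).take t = prefixOf p t := by
  simp [prefixOf, ← List.map_take, List.take_range, h]

theorem prefixOf_prefix (p : Cantor) {t T : ℕ} (h : t ≤ T) : prefixOf p t <+: prefixOf p T := by
  rw [← take_prefixOf p h]
  exact List.take_prefix _ _

/-- Along the places `s, s + t, s + 2 t, …` the sequence `p` starts with `0 ^ n 1`. -/
def StartsWith (p : Cantor) (s t n : ℕ) : Prop :=
  (∀ k < n, p (s + t * k) = false) ∧ p (s + t * n) = true

/-- The number of symbols `0` before the first `1`, at the places `s, s + t, …` of `u`. -/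
def nxt (u : List Bool) (s t : ℕ) : ℕ := firstIdx u.length fun k => u.getD (s + t * k) false

/-- Whether `nxt` has found a symbol `1`. -/
def okAt (u : List Bool) (s t : ℕ) : Bool := u.getD (s + t * nxt u s t) false

/-- The place at which the `i`-th block begins. -/
def blockStart (u : List Bool) (s t i : ℕ) : ℕ :=
  Nat.rec (motive := fun _ => ℕ) s (fun _ s' => s' + t * (nxt u s' t + 1)) i

def readVal (u : List Bool) (s t i : ℕ) : ℕ := nxt u (blockStart u s t i) t

def readOk (u : List Bool) (s t i : ℕ) : Bool :=
  allBelow (i + 1) fun j => okAt u (blockStart u s t j) t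

section Primitive

variable {α : Type} [Primcodable α]

@[fun_prop] theorem primrec_nxt {u : α → List Bool} {s t : α → ℕ} (hu : Primrec u)
    (hs : Primrec s) (ht : Primrec t) : Primrec (fun x => nxt (u x) (s x) (t x)) := by
  unfold nxt
  fun_prop

@[fun_prop] theorem primrec_okAt {u : α → List Bool} {s t : α → ℕ} (hu : Primrec u)
    (hs : Primrec s) (ht : Primrec t) : Primrec (fun x => okAt (u x) (s x) (t x)) := by
  unfold okAt
  fun_prop

@[fun_prop] theorem primrec_blockStart {u : α → List Bool} {s t i : α → ℕ} (hu : Primrec u)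
    (hs : Primrec s) (ht : Primrec t) (hi : Primrec i) :
    Primrec (fun x => blockStart (u x) (s x) (t x) (i x)) := by
  unfold blockStart
  fun_prop

@[fun_prop] theorem primrec_readVal {u : α → List Bool} {s t i : α → ℕ} (hu : Primrec u)
    (hs : Primrec s) (ht : Primrec t) (hi : Primrec i) :
    Primrec (fun x => readVal (u x) (s x) (t x) (i x)) := by
  unfold readVal
  fun_prop

@[fun_prop] theorem primrec_readOk {u : α → List Bool} {s t i : α → ℕ} (hu : Primrec u)
    (hs : Primrec s) (ht : Primrec t) (hi : Primrec i) :
    Primrec (fun x => readOk (u x) (s x) (t x) (i x)) := by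
  unfold readOk
  fun_prop

end Primitive

section Reading

variable {p : Cantor} {s t n T : ℕ}

theorem nxt_eq (h : StartsWith p s t n) (hok : okAt (prefixOf p T) s t = true) :
    nxt (prefixOf p T) s t = n := by
  rw [okAt, getD_prefixOf] at hok
  split_ifs at hok with hT
  rcases lt_trichotomy (nxt (prefixOf p T) s t) n with hlt | heq | hgt
  · rw [h.1 _ hlt] at hok
    cases hok
  · exact heq
  · have h1 := firstIdx_min hgt
    have : s + t * n < T := lt_of_le_of_lt (by gcongr) hT
    rw [getD_prefixOf, if_pos this, h.2] at h1
    cases h1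

theorem okAt_of_lt (h : StartsWith p s t n) (h1 : s + t * n < T) (h2 : n < T) :
    okAt (prefixOf p T) s t = true := by
  have : nxt (prefixOf p T) s t = n := by
    refine firstIdx_eq (by simpa using h2) ?_ fun j hj => ?_
    · rw [getD_prefixOf, if_pos h1, h.2]
    · rw [getD_prefixOf, h.1 j hj, ite_self]
  rw [okAt, this, getD_prefixOf, if_pos h1, h.2]

theorem IsBlockCode.startsWith {a : ℕ → ℕ} (h : IsBlockCode (fun k => p (s + t * k)) a) (i : ℕ) :
    StartsWith p (s + t * ((∑ j ∈ Finset.range i, a j) + i)) t (a i) := by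
  have hm : Monotone fun k => ∑ j ∈ Finset.range k, a j := fun k l hkl =>
    Finset.sum_le_sum_of_subset (Finset.range_mono hkl)
  constructor
  · intro k hk
    have h1 := h ((∑ j ∈ Finset.range i, a j) + i + k)
    rw [add_assoc, ← mul_add, ← Bool.not_eq_true, h1]
    rintro ⟨l, hl⟩
    rcases lt_or_ge l i with hli | hli
    · have := hm (show l + 1 ≤ i by omega)
      simp only at this
      omega
    · have := hm (show i + 1 ≤ l + 1 by omega)
      simp only at this
      rw [Finset.sum_range_succ _ i] at this
      omega
  · have h1 := h ((∑ j ∈ Finset.range i, a j) + i + a i)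
    rw [add_assoc, ← mul_add, h1]
    exact ⟨i, by rw [Finset.sum_range_succ]; omega⟩

theorem blockStart_eq {a : ℕ → ℕ} (h : IsBlockCode (fun k => p (s + t * k)) a) {i : ℕ}
    (hok : ∀ j < i, okAt (prefixOf p T) (blockStart (prefixOf p T) s t j) t = true) :
    blockStart (prefixOf p T) s t i = s + t * ((∑ j ∈ Finset.range i, a j) + i) := by
  induction i with
  | zero => simp [blockStart]
  | succ i ih =>
    have h1 := ih fun j hj => hok j (by omega)
    have h2 := nxt_eq (h.startsWith i) (h1 ▸ hok i (by omega))
    change blockStart (prefixOf p T) s t i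
      + t * (nxt (prefixOf p T) (blockStart (prefixOf p T) s t i) t + 1) = _
    rw [h1, h2, Finset.sum_range_succ]
    ring

theorem readVal_eq {a : ℕ → ℕ} (h : IsBlockCode (fun k => p (s + t * k)) a) {i : ℕ}
    (hok : readOk (prefixOf p T) s t i = true) : readVal (prefixOf p T) s t i = a i := by
  rw [readOk, allBelow_eq_true] at hok
  have h1 := blockStart_eq h (i := i) fun j hj => hok j (by omega)
  rw [readVal, h1]
  exact nxt_eq (h.startsWith i) (h1 ▸ hok i (by omega))

theorem exists_readOk {a : ℕ → ℕ} (h : IsBlockCode (fun k => p (s + t * k)) a) (i : ℕ) :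
    ∃ T₀, ∀ T ≥ T₀, readOk (prefixOf p T) s t i = true := by
  refine ⟨∑ j ∈ Finset.range (i + 1),
    (s + t * ((∑ l ∈ Finset.range j, a l) + j) + t * a j + a j + 1), fun T hT => ?_⟩
  rw [readOk, allBelow_eq_true]
  intro j
  induction j using Nat.strong_induction_on with
  | _ j ih =>
    intro hj
    rw [blockStart_eq h fun l hl => ih l hl (by omega)]
    have := Finset.single_le_sum (f := fun j =>
      (s + t * ((∑ l ∈ Finset.range j, a l) + j) + t * a j + a j + 1))
      (fun _ _ => Nat.zero_le _) (Finset.mem_range.2 hj)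
    exact okAt_of_lt (h.startsWith j) (by omega) (by omega)

end Reading

theorem cast_qhalf (i : ℕ) : (nuQ (qhalf i) : ℝ) = (1 / 2 : ℝ) ^ i := by
  rw [nuQ_qhalf]
  push_cast
  rfl

/-- The ball of radius `2 ^ (-κ)` around the `κ`-th term of a name. -/
def termBall (a : ℕ → ℕ) (κ : ℕ) : ℕ := Nat.pair (a κ) (qhalf κ)

theorem Approx.termBall {a : ℕ → ℕ} {x : ℝ} (h : ∀ i, |(nuQ (a i) : ℝ) - x| < (1 / 2 : ℝ) ^ i) :
    Approx (termBall a) x := by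
  refine ⟨fun κ => ?_, ?_⟩
  · simpa [cen, rad, WeihrauchLU.termBall, nuQ_qhalf] using (h κ).le
  · simp only [rad, WeihrauchLU.termBall, Nat.unpair_pair, nuQ_qhalf]
    push_cast
    exact tendsto_pow_atTop_nhds_zero_of_lt_one (by norm_num) (by norm_num)

/-! ### Machines that search for a certificate and then print approximations -/

/-- Summation of natural numbers, as a primitive recursion. -/
def nsum (n : ℕ) (f : ℕ → ℕ) : ℕ := Nat.rec (motive := fun _ => ℕ) 0 (fun i s => s + f i) n

theorem nsum_eq (n : ℕ) (f : ℕ → ℕ) : nsum n f = ∑ i ∈ Finset.range n, f i := by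
  induction n with
  | zero => rfl
  | succ n ih => rw [Finset.sum_range_succ, ← ih]; rfl

/-- The symbol at place `k` of `0 ^ (a 0) 1 0 ^ (a 1) 1 …`. -/
def blockBit (a : ℕ → ℕ) (k : ℕ) : Bool :=
  !allBelow (k + 1) fun i => !decide (nsum (i + 1) a + i = k)

theorem isBlockCode_blockBit (a : ℕ → ℕ) : IsBlockCode (blockBit a) a := by
  intro j
  simp only [blockBit, Bool.not_eq_true', ← Bool.not_eq_true, allBelow_eq_true, nsum_eq,
    decide_eq_true_eq, not_forall, not_not]
  constructor
  · rintro ⟨i, -, h⟩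
    exact ⟨i, h⟩
  · rintro ⟨i, h⟩
    exact ⟨i, by omega, h⟩

theorem blockBit_congr {a b : ℕ → ℕ} {k : ℕ} (h : ∀ i ≤ k, a i = b i) :
    blockBit a k = blockBit b k := by
  rw [Bool.eq_iff_iff]
  simp only [blockBit, Bool.not_eq_true', ← Bool.not_eq_true, allBelow_eq_true, nsum_eq]
  have : ∀ i < k + 1, ∑ j ∈ Finset.range (i + 1), a j = ∑ j ∈ Finset.range (i + 1), b j :=
    fun i hi => Finset.sum_congr rfl fun j hj => h j (by
      have := Finset.mem_range.1 hj
      omega)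
  refine not_congr (forall₂_congr fun i hi => ?_)
  rw [this i hi]

/-- The data of a machine: a test for certificates, a test telling whether the input has been read
to a given precision, balls for the real numbers to be printed, and the layout of the output. -/
structure Program where
  hd : List Bool → ℕ → Bool
  dn : List Bool → ℕ → ℕ → Bool
  bl : List Bool → ℕ → ℕ → ℕ → ℕ
  lay : ℕ → ℕ → ℕ
  primrec_hd : Primrec fun y : List Bool × ℕ => hd y.1 y.2
  primrec_dn : Primrec fun y : List Bool × ℕ × ℕ => dn y.1 y.2.1 y.2.2
  primrec_bl : Primrec fun y : List Bool × ℕ × ℕ × ℕ => bl y.1 y.2.1 y.2.2.1 y.2.2.2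
  primrec_lay : Primrec fun y : ℕ × ℕ => lay y.1 y.2

/-- The output symbol described by the layout code `c`: `0` and `1` are literal symbols, and
`c + 2` stands for a symbol of the name of one of the real numbers. -/
def outBit (c : ℕ) (r : ℕ → Cantor) : Bool :=
  if c < 2 then decide (c = 1) else r (c - 2).unpair.1 (c - 2).unpair.2

namespace Program

variable (M : Program)

def hdIdx (u : List Bool) : ℕ :=
  firstIdx u.length fun s => M.hd (u.take s.unpair.1) s.unpair.2

def apxIdx (u : List Bool) (d j i : ℕ) : ℕ :=
  firstIdx u.length fun s => M.dn (u.take s.unpair.1) d s.unpair.2 &&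
    qlt (M.bl (u.take s.unpair.1) d s.unpair.2 j).unpair.2 (qhalf i)

def apx (u : List Bool) (d j i : ℕ) : ℕ :=
  (M.bl (u.take (M.apxIdx u d j i).unpair.1) d (M.apxIdx u d j i).unpair.2 j).unpair.1

def known (u : List Bool) (d pos : ℕ) : Bool :=
  decide (M.lay d pos < 2) || allBelow ((M.lay d pos - 2).unpair.2 + 1) fun i =>
    decide (M.apxIdx u d (M.lay d pos - 2).unpair.1 i < u.length)

def bitAt (u : List Bool) (d pos : ℕ) : Bool :=
  outBit (M.lay d pos) fun j => blockBit fun i => M.apx u d j i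

/-- The word function of the machine. -/
def run (u : List Bool) : List Bool :=
  if M.hdIdx u < u.length then
    (List.range (firstIdx u.length fun pos => !M.known u (M.hdIdx u).unpair.2 pos)).map
      (M.bitAt u (M.hdIdx u).unpair.2)
  else []

end Program

section Primitive

variable {α : Type} [Primcodable α]

@[fun_prop] theorem primrec_nsum {n : α → ℕ} {f : α → ℕ → ℕ} (hn : Primrec n)
    (hf : Primrec fun y : α × ℕ => f y.1 y.2) : Primrec (fun x => nsum (n x) (f x)) := by
  unfold nsum
  have : Primrec fun y : α × ℕ × ℕ => f y.1 y.2.1 :=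
    hf.comp (g := fun y : α × ℕ × ℕ => (y.1, y.2.1)) (by fun_prop)
  fun_prop

@[fun_prop] theorem primrec_blockBit {a : α → ℕ → ℕ} {k : α → ℕ}
    (ha : Primrec fun y : α × ℕ => a y.1 y.2) (hk : Primrec k) :
    Primrec (fun x => blockBit (a x) (k x)) := by
  unfold blockBit
  have : Primrec fun y : (α × ℕ) × ℕ => a y.1.1 y.2 :=
    ha.comp (g := fun y : (α × ℕ) × ℕ => (y.1.1, y.2)) (by fun_prop)
  fun_prop

variable (M : Program)

@[fun_prop] theorem Program.primrec_hd' {u : α → List Bool} {d : α → ℕ} (hu : Primrec u)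
    (hd : Primrec d) : Primrec (fun x => M.hd (u x) (d x)) :=
  M.primrec_hd.comp (hu.pair hd)

@[fun_prop] theorem Program.primrec_dn' {u : α → List Bool} {d κ : α → ℕ} (hu : Primrec u)
    (hd : Primrec d) (hκ : Primrec κ) : Primrec (fun x => M.dn (u x) (d x) (κ x)) :=
  M.primrec_dn.comp (hu.pair (hd.pair hκ))

@[fun_prop] theorem Program.primrec_bl' {u : α → List Bool} {d κ j : α → ℕ} (hu : Primrec u)
    (hd : Primrec d) (hκ : Primrec κ) (hj : Primrec j) :
    Primrec (fun x => M.bl (u x) (d x) (κ x) (j x)) :=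
  M.primrec_bl.comp (hu.pair (hd.pair (hκ.pair hj)))

@[fun_prop] theorem Program.primrec_lay' {d pos : α → ℕ} (hd : Primrec d) (hpos : Primrec pos) :
    Primrec (fun x => M.lay (d x) (pos x)) :=
  M.primrec_lay.comp (hd.pair hpos)

@[fun_prop] theorem Program.primrec_hdIdx {u : α → List Bool} (hu : Primrec u) :
    Primrec (fun x => M.hdIdx (u x)) := by
  unfold Program.hdIdx
  fun_prop

@[fun_prop] theorem Program.primrec_apxIdx {u : α → List Bool} {d j i : α → ℕ} (hu : Primrec u)
    (hd : Primrec d) (hj : Primrec j) (hi : Primrec i) :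
    Primrec (fun x => M.apxIdx (u x) (d x) (j x) (i x)) := by
  unfold Program.apxIdx
  fun_prop

@[fun_prop] theorem Program.primrec_apx {u : α → List Bool} {d j i : α → ℕ} (hu : Primrec u)
    (hd : Primrec d) (hj : Primrec j) (hi : Primrec i) :
    Primrec (fun x => M.apx (u x) (d x) (j x) (i x)) := by
  unfold Program.apx
  fun_prop

@[fun_prop] theorem Program.primrec_known {u : α → List Bool} {d pos : α → ℕ} (hu : Primrec u)
    (hd : Primrec d) (hpos : Primrec pos) :
    Primrec (fun x => M.known (u x) (d x) (pos x)) := by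
  unfold Program.known
  fun_prop

@[fun_prop] theorem Program.primrec_bitAt {u : α → List Bool} {d pos : α → ℕ} (hu : Primrec u)
    (hd : Primrec d) (hpos : Primrec pos) :
    Primrec (fun x => M.bitAt (u x) (d x) (pos x)) := by
  unfold Program.bitAt outBit
  fun_prop

theorem Program.primrec_run : Primrec M.run := by
  unfold Program.run
  fun_prop

end Primitive

namespace Program

variable (M : Program)

theorem take_eq_of_prefix {u v : List Bool} (h : u <+: v) {t : ℕ} (ht : t ≤ u.length) :
    v.take t = u.take t := by
  obtain ⟨w, rfl⟩ := h
  exact List.take_append_of_le_length ht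

theorem firstIdx_of_prefix {u v : List Bool} (h : u <+: v) (c : List Bool → ℕ → Bool)
    (hlt : firstIdx u.length (fun s => c (u.take s.unpair.1) s) < u.length) :
    firstIdx v.length (fun s => c (v.take s.unpair.1) s)
      = firstIdx u.length (fun s => c (u.take s.unpair.1) s) := by
  have h1 : firstIdx u.length (fun s => c (v.take s.unpair.1) s)
      = firstIdx u.length (fun s => c (u.take s.unpair.1) s) :=
    firstIdx_congr fun s hs => by
      rw [take_eq_of_prefix h ((Nat.unpair_left_le s).trans hs.le)]
  rw [← h1] at hlt ⊢
  exact firstIdx_mono h.length_le hlt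

theorem hdIdx_of_prefix {u v : List Bool} (h : u <+: v) (hlt : M.hdIdx u < u.length) :
    M.hdIdx v = M.hdIdx u :=
  firstIdx_of_prefix h (fun w s => M.hd w s.unpair.2) hlt

theorem apxIdx_of_prefix {u v : List Bool} (h : u <+: v) {d j i : ℕ}
    (hlt : M.apxIdx u d j i < u.length) : M.apxIdx v d j i = M.apxIdx u d j i :=
  firstIdx_of_prefix h (fun w s => M.dn w d s.unpair.2 &&
    qlt (M.bl w d s.unpair.2 j).unpair.2 (qhalf i)) hlt

theorem apx_of_prefix {u v : List Bool} (h : u <+: v) {d j i : ℕ}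
    (hlt : M.apxIdx u d j i < u.length) : M.apx v d j i = M.apx u d j i := by
  unfold apx
  rw [M.apxIdx_of_prefix h hlt, take_eq_of_prefix h ((Nat.unpair_left_le _).trans hlt.le)]

theorem known_iff {u : List Bool} {d pos : ℕ} : M.known u d pos = true ↔
    (2 ≤ M.lay d pos → ∀ i ≤ (M.lay d pos - 2).unpair.2,
      M.apxIdx u d (M.lay d pos - 2).unpair.1 i < u.length) := by
  simp only [known, Bool.or_eq_true, decide_eq_true_eq, allBelow_eq_true]
  constructor
  · rintro (h | h) h2 i hi
    · omega
    · exact h i (by omega)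
  · intro h
    by_cases h2 : M.lay d pos < 2
    · exact Or.inl h2
    · exact Or.inr fun i hi => h (by omega) i (by omega)

theorem known_of_prefix {u v : List Bool} (h : u <+: v) {d pos : ℕ}
    (hk : M.known u d pos = true) : M.known v d pos = true := by
  rw [known_iff] at hk ⊢
  intro h2 i hi
  rw [M.apxIdx_of_prefix h (hk h2 i hi)]
  exact (hk h2 i hi).trans_le h.length_le

theorem bitAt_of_prefix {u v : List Bool} (h : u <+: v) {d pos : ℕ}
    (hk : M.known u d pos = true) : M.bitAt v d pos = M.bitAt u d pos := by
  rw [known_iff] at hk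
  unfold bitAt outBit
  split_ifs with h2
  · rfl
  · exact blockBit_congr fun i hi => M.apx_of_prefix h (hk (not_lt.1 h2) i hi)

theorem run_mono {u v : List Bool} (h : u <+: v) : M.run u <+: M.run v := by
  unfold run
  split_ifs with h1 h2
  · have h3 := M.hdIdx_of_prefix h h1
    rw [h3]
    set d := (M.hdIdx u).unpair.2
    set n := firstIdx u.length fun pos => !M.known u d pos with hn
    have hkn : ∀ pos < n, M.known u d pos = true := fun pos hpos => by
      simpa using firstIdx_min hpos
    have hle : n ≤ firstIdx v.length fun pos => !M.known v d pos := by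
      by_contra hlt
      push Not at hlt
      have h4 := firstIdx_spec (hlt.trans_le ((firstIdx_le _ _).trans h.length_le))
      rw [M.known_of_prefix h (hkn _ hlt)] at h4
      cases h4
    have e : (List.range n).map (M.bitAt u d) = (List.range n).map (M.bitAt v d) :=
      List.map_congr_left fun pos hpos =>
        (M.bitAt_of_prefix h (hkn pos (List.mem_range.1 hpos))).symm
    rw [e]
    refine List.IsPrefix.map _ ?_
    rw [← Nat.add_sub_cancel' hle, List.range_add]
    exact List.prefix_append _ _
  · rw [M.hdIdx_of_prefix h h1] at h2
    exact absurd (h1.trans_le h.length_le) h2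
  · exact List.nil_prefix
  · exact List.nil_prefix

/-- On the input `p`, the machine finds a certificate `d` and prints names of the numbers
`x d j`. -/
theorem run_spec {p : Cantor} (x : ℕ → ℕ → ℝ) (hhd : ∃ t d, M.hd (prefixOf p t) d = true)
    (hbl : ∀ t d, M.hd (prefixOf p t) d = true → ∃ ball : ℕ → ℕ → ℕ,
      (∀ T κ j, M.dn (prefixOf p T) d κ = true → M.bl (prefixOf p T) d κ j = ball κ j) ∧
      (∀ κ, ∃ T, M.dn (prefixOf p T) d κ = true) ∧ ∀ j, Approx (fun κ => ball κ j) (x d j)) :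
    ∃ q t d, M.hd (prefixOf p t) d = true ∧ Produces M.run p q ∧
      ∃ r : ℕ → Cantor, (∀ j, Represented.IsName (r j) (x d j)) ∧
        ∀ pos, q pos = outBit (M.lay d pos) r := by
  obtain ⟨t₀, d₀, h₀⟩ := hhd
  set T₀ := Nat.pair t₀ d₀ + 1 with hT₀
  have hlt : M.hdIdx (prefixOf p T₀) < (prefixOf p T₀).length := by
    refine firstIdx_lt (i := Nat.pair t₀ d₀) (by simp [hT₀]) ?_
    simp only [Nat.unpair_pair]
    rwa [take_prefixOf p ((Nat.left_le_pair t₀ d₀).trans (Nat.le_succ _))]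
  set s := M.hdIdx (prefixOf p T₀) with hs
  set d := s.unpair.2 with hd
  have hsT : s < T₀ := by simpa using hlt
  have hhd : M.hd (prefixOf p s.unpair.1) d = true := by
    have : M.hd ((prefixOf p T₀).take s.unpair.1) s.unpair.2 = true := firstIdx_spec hlt
    rwa [take_prefixOf p ((Nat.unpair_left_le _).trans hsT.le)] at this
  have hsv : ∀ T ≥ T₀, M.hdIdx (prefixOf p T) = s := fun T hT =>
    M.hdIdx_of_prefix (prefixOf_prefix p hT) hlt
  obtain ⟨ball, hball, hdn, happ⟩ := hbl _ d hhd
  have hex : ∀ j i, ∃ T, M.apxIdx (prefixOf p T) d j i < T := by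
    intro j i
    have h1 : ∀ᶠ κ in atTop, rad (ball κ j) < (1 / 2 : ℝ) ^ i :=
      (happ j).lim.eventually (gt_mem_nhds (by positivity))
    obtain ⟨κ, hκ⟩ := h1.exists
    obtain ⟨T, hT⟩ := hdn κ
    refine ⟨Nat.pair T κ + 1, ?_⟩
    have := firstIdx_lt (n := (prefixOf p (Nat.pair T κ + 1)).length) (i := Nat.pair T κ)
      (c := fun s => M.dn ((prefixOf p (Nat.pair T κ + 1)).take s.unpair.1) d s.unpair.2 &&
        qlt (M.bl ((prefixOf p (Nat.pair T κ + 1)).take s.unpair.1) d s.unpair.2 j).unpair.2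
          (qhalf i)) (by simp) ?_
    · exact this.trans_eq (length_prefixOf _ _)
    · simp only [Nat.unpair_pair]
      rw [take_prefixOf p ((Nat.left_le_pair T κ).trans (Nat.le_succ _)), hT, hball T κ j hT,
        Bool.true_and, qlt_iff, ← Rat.cast_lt (K := ℝ), cast_qhalf]
      exact hκ
  choose T hT using hex
  set a : ℕ → ℕ → ℕ := fun j i => M.apx (prefixOf p (T j i)) d j i with ha
  have hidx : ∀ j i T', T j i ≤ T' → M.apxIdx (prefixOf p T') d j i < (prefixOf p T').length := by
    intro j i T' hT'
    rw [M.apxIdx_of_prefix (prefixOf_prefix p hT') (by simpa using hT j i)]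
    simpa using (hT j i).trans_le hT'
  have hav : ∀ j i T', T j i ≤ T' → M.apx (prefixOf p T') d j i = a j i := by
    intro j i T' hT'
    exact M.apx_of_prefix (prefixOf_prefix p hT') (by simpa using hT j i)
  have hname : ∀ j, Represented.IsName (blockBit (a j)) (x d j) := by
    intro j
    refine ⟨a j, isBlockCode_blockBit _, fun i => ?_⟩
    have hl := hT j i
    have h1 := firstIdx_spec (n := (prefixOf p (T j i)).length) (c := fun s =>
      M.dn ((prefixOf p (T j i)).take s.unpair.1) d s.unpair.2 &&
        qlt (M.bl ((prefixOf p (T j i)).take s.unpair.1) d s.unpair.2 j).unpair.2 (qhalf i))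
      (hl.trans_eq (length_prefixOf _ _).symm)
    change (M.dn ((prefixOf p (T j i)).take (M.apxIdx (prefixOf p (T j i)) d j i).unpair.1) d
      (M.apxIdx (prefixOf p (T j i)) d j i).unpair.2 && _) = true at h1
    rw [Bool.and_eq_true] at h1
    obtain ⟨h1, h2⟩ := h1
    change qlt (M.bl _ d (M.apxIdx (prefixOf p (T j i)) d j i).unpair.2 j).unpair.2 _ = true at h2
    change |(nuQ (M.bl _ d (M.apxIdx (prefixOf p (T j i)) d j i).unpair.2 j).unpair.1 : ℝ) - _| < _
    set s' := M.apxIdx (prefixOf p (T j i)) d j i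
    change M.dn ((prefixOf p (T j i)).take s'.unpair.1) d s'.unpair.2 = true at h1
    change qlt (M.bl ((prefixOf p (T j i)).take s'.unpair.1) d s'.unpair.2 j).unpair.2 _ = true at h2
    rw [take_prefixOf p ((Nat.unpair_left_le _).trans hl.le)] at h1 h2 ⊢
    rw [hball _ _ j h1] at h2 ⊢
    rw [qlt_iff, ← Rat.cast_lt (K := ℝ), cast_qhalf] at h2
    exact ((happ j).le s'.unpair.2).trans_lt h2
  refine ⟨fun pos => outBit (M.lay d pos) fun j => blockBit (a j), _, d, hhd, ?_,
    fun j => blockBit (a j), hname, fun pos => rfl⟩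
  intro n
  set K := T₀ + n + ∑ pos ∈ Finset.range n, ∑ i ∈ Finset.range ((M.lay d pos - 2).unpair.2 + 1),
    T (M.lay d pos - 2).unpair.1 i with hK
  have hTK : ∀ pos < n, ∀ i ≤ (M.lay d pos - 2).unpair.2,
      T (M.lay d pos - 2).unpair.1 i ≤ K := by
    intro pos hpos i hi
    have h1 := Finset.single_le_sum (f := fun i => T (M.lay d pos - 2).unpair.1 i)
      (fun _ _ => Nat.zero_le _) (Finset.mem_range.2 (Nat.lt_succ_of_le hi))
    have h2 := Finset.single_le_sum (f := fun pos =>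
      ∑ i ∈ Finset.range ((M.lay d pos - 2).unpair.2 + 1), T (M.lay d pos - 2).unpair.1 i)
      (fun _ _ => Nat.zero_le _) (Finset.mem_range.2 hpos)
    exact h1.trans (h2.trans (Nat.le_add_left _ _))
  have hkn : ∀ pos < n, M.known (prefixOf p K) d pos = true := by
    intro pos hpos
    rw [known_iff]
    exact fun _ i hi => hidx _ i K (hTK pos hpos i hi)
  refine ⟨K, ?_⟩
  rw [run, hsv K (by omega), if_pos (by rw [length_prefixOf]; omega), ← hd]
  have hle : n ≤ firstIdx (prefixOf p K).length fun pos => !M.known (prefixOf p K) d pos := by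
    by_contra hc
    push Not at hc
    have h4 := firstIdx_spec (hc.trans_le (by rw [length_prefixOf]; omega))
    rw [hkn _ hc] at h4
    cases h4
  have e : prefixOf (fun pos => outBit (M.lay d pos) fun j => blockBit (a j)) n
      = (List.range n).map (M.bitAt (prefixOf p K) d) := by
    refine List.map_congr_left fun pos hpos => ?_
    have hpos := List.mem_range.1 hpos
    unfold bitAt outBit
    split_ifs
    · rfl
    · exact blockBit_congr fun i hi => (hav _ i K (hTK pos hpos i hi)).symm
  rw [e]
  refine List.IsPrefix.map _ ?_
  rw [← Nat.add_sub_cancel' hle, List.range_add]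
  exact List.prefix_append _ _

end Program

/-! ### Reductions given by word functions -/

theorem Produces.unique {φ : List Bool → List Bool} (hφ : ∀ u v, u <+: v → φ u <+: φ v)
    {p q q' : Cantor} (h : Produces φ p q) (h' : Produces φ p q') : q = q' := by
  funext n
  obtain ⟨k, hk⟩ := h (n + 1)
  obtain ⟨k', hk'⟩ := h' (n + 1)
  have h1 := hk.trans (hφ _ _ (prefixOf_prefix p (le_max_left k k')))
  have h2 := hk'.trans (hφ _ _ (prefixOf_prefix p (le_max_right k k')))
  have h3 : prefixOf q (n + 1) = prefixOf q' (n + 1) := by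
    rcases List.prefix_or_prefix_of_prefix h1 h2 with h | h
    · exact h.eq_of_length (by simp)
    · exact (h.eq_of_length (by simp)).symm
  have h4 := congrArg (fun l => l.getD n false) h3
  simp only [getD_prefixOf] at h4
  simpa using h4

/-- The partial function computed by a word function. -/
noncomputable def limitFun (φ : List Bool → List Bool) : Cantor →. Cantor :=
  fun p => ⟨∃ q, Produces φ p q, fun h => h.choose⟩

theorem mem_limitFun {φ : List Bool → List Bool} (hφ : ∀ u v, u <+: v → φ u <+: φ v)
    {p q : Cantor} (h : Produces φ p q) : q ∈ limitFun φ p := by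
  have hex : ∃ q, Produces φ p q := ⟨q, h⟩
  exact ⟨hex, hex.choose_spec.unique hφ h⟩

theorem typeTwoComputable_limitFun {φ : List Bool → List Bool} (hc : Computable φ)
    (hφ : ∀ u v, u <+: v → φ u <+: φ v) : TypeTwoComputable (limitFun φ) := by
  refine ⟨φ, hc, hφ, fun p q hq => ?_⟩
  obtain ⟨hex, rfl⟩ := hq
  exact hex.choose_spec

/-- The pairing of sequences. -/
def join (p q : Cantor) : Cantor := fun k => if k % 2 = 0 then p (k / 2) else q (k / 2)

theorem join_even (p q : Cantor) (k : ℕ) : join p q (2 * k) = p k := by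
  simp [join]

theorem join_odd (p q : Cantor) (k : ℕ) : join p q (2 * k + 1) = q k := by
  rw [join, if_neg (by omega)]
  congr 1
  omega

theorem join_component (r : Cantor) : join (component 2 r 0) (component 2 r 1) = r := by
  funext k
  unfold join component
  split_ifs with h <;> congr 1 <;> omega

theorem WLE.of_wordFunctions {X Y U V : Type} [Represented X] [Represented Y] [Represented U]
    [Represented V] {f : X → Set Y} {g : U → Set V} (φ ψ : List Bool → List Bool)
    (hφ : Computable φ) (hφm : ∀ u v, u <+: v → φ u <+: φ v)
    (hψ : Computable ψ) (hψm : ∀ u v, u <+: v → ψ u <+: ψ v)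
    (h : ∀ p x, Represented.IsName p x → (f x).Nonempty → ∃ o u, Produces φ p o ∧
      Represented.IsName o u ∧ (g u).Nonempty ∧ ∀ q v, v ∈ g u → Represented.IsName q v →
        ∃ o' y, Produces ψ (join p q) o' ∧ y ∈ f x ∧ Represented.IsName o' y) :
    WLE f g := by
  refine ⟨fun p q => limitFun ψ (join p q), limitFun φ, ?_, typeTwoComputable_limitFun hφ hφm, ?_⟩
  · have := typeTwoComputable_limitFun hψ hψm
    unfold TypeTwoComputable₂
    simpa only [join_component] using this
  · intro G hG p x hp hx
    obtain ⟨o, u, ho, hu, hne, hrest⟩ := h p x hp hx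
    obtain ⟨q, hq, v, hv, hqv⟩ := hG o u hu hne
    obtain ⟨o', y, ho', hy, hoy⟩ := hrest q v hv hqv
    exact ⟨o', Part.mem_bind (mem_limitFun hφm ho)
      (Part.mem_bind hq (mem_limitFun hψm ho')), y, hy, hoy⟩

/-- Reductions given by machines. -/
theorem WLE.of_programs {X Y U V : Type} [Represented X] [Represented Y] [Represented U]
    [Represented V] {f : X → Set Y} {g : U → Set V} (M M' : Program)
    (h : ∀ p x, Represented.IsName p x → (f x).Nonempty → ∃ o u, Produces M.run p o ∧
      Represented.IsName o u ∧ (g u).Nonempty ∧ ∀ q v, v ∈ g u → Represented.IsName q v →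
        ∃ o' y, Produces M'.run (join p q) o' ∧ y ∈ f x ∧ Represented.IsName o' y) :
    WLE f g :=
  WLE.of_wordFunctions M.run M'.run M.primrec_run.to_comp (fun _ _ => M.run_mono)
    M'.primrec_run.to_comp (fun _ _ => M'.run_mono) h

/-! ### Recovering ratios from an LU-decomposition -/

/-- Any `n` rows of a Cauchy matrix with `n` columns are linearly independent. -/
theorem eq_zero_of_cauchy {n : ℕ} {v : Fin n → ℝ} {c : Fin n → ℕ} (hc : Function.Injective c)
    {Z : Finset ℕ} (hZ : n ≤ Z.card)
    (h : ∀ b ∈ Z, ∑ j, v j * ((b : ℝ) + c j + 1)⁻¹ = 0) : v = 0 := by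
  classical
  set p : Polynomial ℝ := ∑ j, Polynomial.C (v j) *
    ∏ l ∈ Finset.univ.erase j, (Polynomial.X + Polynomial.C ((c l : ℝ) + 1)) with hp
  have hp0 : p = 0 := by
    rcases Nat.eq_zero_or_pos n with rfl | hn
    · simp [hp]
    refine Polynomial.eq_zero_of_natDegree_lt_card_of_eval_eq_zero' p
      (Z.image fun b : ℕ => (b : ℝ)) ?_ ?_
    · intro x hx
      obtain ⟨b, hb, rfl⟩ := Finset.mem_image.1 hx
      have hpos : ∀ l, (b : ℝ) + c l + 1 ≠ 0 := fun l => by positivity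
      have : ∀ j, v j * ∏ l ∈ Finset.univ.erase j, ((b : ℝ) + c l + 1)
          = (v j * ((b : ℝ) + c j + 1)⁻¹) * ∏ l, ((b : ℝ) + c l + 1) := by
        intro j
        rw [← Finset.mul_prod_erase _ _ (Finset.mem_univ j)]
        field_simp [hpos j]
      simp only [hp, Polynomial.eval_finsetSum, Polynomial.eval_mul, Polynomial.eval_C,
        Polynomial.eval_prod, Polynomial.eval_add, Polynomial.eval_X, ← add_assoc]
      rw [Finset.sum_congr rfl fun j _ => this j, ← Finset.sum_mul, h b hb, zero_mul]
    · rw [Finset.card_image_of_injective _ Nat.cast_injective]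
      refine lt_of_lt_of_le (Nat.lt_of_le_pred hn ?_) hZ
      refine Polynomial.natDegree_sum_le_of_forall_le _ _ fun j _ => ?_
      refine (Polynomial.natDegree_C_mul_le _ _).trans ((Polynomial.natDegree_prod_le _ _).trans ?_)
      refine (Finset.sum_le_card_nsmul _ _ 1 fun l _ => ?_).trans ?_
      · rw [Polynomial.natDegree_X_add_C]
      · simp [Finset.card_erase_of_mem]
  funext j
  have h1 : p.eval (-((c j : ℝ) + 1)) = 0 := by rw [hp0, Polynomial.eval_zero]
  simp only [hp, Polynomial.eval_finsetSum, Polynomial.eval_mul, Polynomial.eval_C,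
    Polynomial.eval_prod, Polynomial.eval_add, Polynomial.eval_X] at h1
  rw [Finset.sum_eq_single j] at h1
  · refine (mul_eq_zero.1 h1).resolve_right (Finset.prod_ne_zero_iff.2 fun l hl => ?_)
    have : c l ≠ c j := fun h => Finset.ne_of_mem_erase hl (hc h)
    intro h0
    apply this
    have : (c l : ℝ) = c j := by linarith
    exact_mod_cast this
  · intro l _ hlj
    rw [Finset.prod_eq_zero (Finset.mem_erase.2 ⟨hlj.symm, Finset.mem_univ j⟩), mul_zero]
    ring
  · simp

/-- If a matrix `(β k / (blk k + c j + 1))` with exactly two rows `r < s` in each block is written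
as `L U`, then `L s r` is the quotient of `β s` and `β r`, provided they do not both vanish. -/
theorem ratio_of_LU {N R : ℕ} {β : Fin R → ℝ} {blk : Fin R → ℕ} {c : Fin N → ℕ}
    (hc : Function.Injective c) (hblk : ∀ k, blk k < N) {L : Matrix (Fin R) (Fin R) ℝ}
    {U : Matrix (Fin R) (Fin N) ℝ}
    (hU : ∀ (i : Fin R) (j : Fin N), (j : ℕ) < (i : ℕ) → U i j = 0)
    (hL : ∀ i j : Fin R, i < j → L i j = 0) (hL1 : ∀ i, L i i = 1)
    (hB : ∀ k j, (L * U) k j = β k * ((blk k : ℝ) + c j + 1)⁻¹) {r s : Fin R} (hrs : r < s)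
    (hsame : blk s = blk r) (htwo : ∀ k, blk k = blk r → k = r ∨ k = s)
    (hne : β r ≠ 0 ∨ β s ≠ 0) : β r ≠ 0 ∧ β s = L s r * β r := by
  classical
  set Z : Finset ℕ := (Finset.univ.filter fun k => β k ≠ 0).image blk with hZdef
  have hZ : ∀ b ∈ Z, ∃ k, β k ≠ 0 ∧ blk k = b := fun b hb => by simpa [hZdef] using hb
  have hZN : Z.card ≤ N := by
    have : Z ⊆ Finset.range N := fun b hb => by
      obtain ⟨k, -, rfl⟩ := hZ b hb
      exact Finset.mem_range.2 (hblk k)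
    simpa using Finset.card_le_card this
  have hZR : Z.card ≤ R := by
    refine Finset.card_image_le.trans ((Finset.card_filter_le _ _).trans ?_)
    simp
  -- the pivots do not vanish
  have hpiv : ∀ (k : Fin R) (j : Fin N), (k : ℕ) = j → (k : ℕ) < Z.card → U k j ≠ 0 := by
    intro k j hkj hk h0
    have hkR : (k : ℕ) + 1 ≤ R := k.2
    have hkN : (k : ℕ) + 1 ≤ N := hkj ▸ j.2
    set S : Matrix (Fin (k + 1)) (Fin (k + 1)) ℝ :=
      U.submatrix (Fin.castLE hkR) (Fin.castLE hkN) with hS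
    have hdet : S.det = 0 := by
      rw [Matrix.det_of_isUpperTriangular]
      · refine Finset.prod_eq_zero (Finset.mem_univ (Fin.last k)) ?_
        rw [hS, Matrix.submatrix_apply]
        have e1 : Fin.castLE hkR (Fin.last k) = k := Fin.ext rfl
        have e2 : Fin.castLE hkN (Fin.last k) = j := Fin.ext hkj
        rw [e1, e2, h0]
      · intro a b hab
        exact hU _ _ hab
    obtain ⟨v, hv0, hv⟩ := Matrix.exists_mulVec_eq_zero_iff.2 hdet
    have hUv : ∀ t : Fin R, ∑ l, U t (Fin.castLE hkN l) * v l = 0 := by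
      intro t
      rcases lt_or_ge (t : ℕ) (k + 1) with ht | ht
      · exact congrFun hv ⟨t, ht⟩
      · refine Finset.sum_eq_zero fun l _ => ?_
        rw [hU t _ (lt_of_lt_of_le l.2 ht), zero_mul]
    refine hv0 (eq_zero_of_cauchy (c := fun l => c (Fin.castLE hkN l)) (Z := Z)
      (hc.comp (Fin.castLE_injective hkN)) hk fun b hb => ?_)
    obtain ⟨t, ht, rfl⟩ := hZ b hb
    have h1 : ∑ l, (L * U) t (Fin.castLE hkN l) * v l = 0 := by
      simp only [Matrix.mul_apply, Finset.sum_mul]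
      rw [Finset.sum_comm]
      refine Finset.sum_eq_zero fun a _ => ?_
      simp only [mul_assoc]
      rw [← Finset.mul_sum, hUv a, mul_zero]
    simp only [hB] at h1
    have h2 : β t * ∑ l, v l * (((blk t : ℕ) : ℝ) + c (Fin.castLE hkN l) + 1)⁻¹ = 0 := by
      rw [Finset.mul_sum, ← h1]
      exact Finset.sum_congr rfl fun l _ => by ring
    exact (mul_eq_zero.1 h2).resolve_left ht
  have hker : ∀ w : Fin R → ℝ, (∀ j, ∑ t, w t * U t j = 0) → ∀ k : Fin R, (k : ℕ) < Z.card →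
      w k = 0 := by
    intro w hw k
    induction k using WellFoundedLT.induction with
    | ind k ih =>
      intro hk
      have h1 := hw ⟨k, hk.trans_le hZN⟩
      rw [Finset.sum_eq_single k] at h1
      · exact (mul_eq_zero.1 h1).resolve_right (hpiv k _ rfl hk)
      · intro t _ htk
        rcases lt_or_gt_of_ne htk with hlt | hgt
        · rw [ih t hlt (lt_trans hlt hk), zero_mul]
        · rw [hU t _ hgt, mul_zero]
      · simp
  have hcomb : ∀ a b, blk a = blk b → ∀ k : Fin R, (k : ℕ) < Z.card →
      β a * L b k - β b * L a k = 0 := by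
    intro a b hab
    refine hker _ fun j => ?_
    have h1 := hB a j
    have h2 := hB b j
    rw [Matrix.mul_apply] at h1 h2
    have : ∑ t, (β a * L b t - β b * L a t) * U t j
        = β a * (∑ t, L b t * U t j) - β b * ∑ t, L a t * U t j := by
      rw [Finset.mul_sum, Finset.mul_sum, ← Finset.sum_sub_distrib]
      exact Finset.sum_congr rfl fun t _ => by ring
    rw [this, h1, h2, hab]
    ring
  have hβ : ∀ k : Fin R, (k : ℕ) < Z.card → β k ≠ 0 := by
    intro k hk h0
    have := hker (L k) (fun j => by
      have := hB k j
      rwa [Matrix.mul_apply, h0, zero_mul] at this) k hk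
    rw [hL1] at this
    exact one_ne_zero this
  have hr : (r : ℕ) < Z.card := by
    by_contra hr
    push Not at hr
    have hi : blk r ∈ Z := by
      rcases hne with h | h
      · exact Finset.mem_image.2 ⟨r, by simpa using h, rfl⟩
      · exact Finset.mem_image.2 ⟨s, by simpa using h, hsame⟩
    have hinj : Set.InjOn blk (Finset.univ.filter fun k : Fin R => (k : ℕ) < Z.card) := by
      have key : ∀ a b : Fin R, (b : ℕ) < Z.card → a < b → blk a ≠ blk b := by
        intro a b hb hab h
        have := hcomb a b h b hb
        rw [hL1, hL a b hab, mul_one, mul_zero, sub_zero] at this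
        exact hβ a (lt_trans hab hb) this
      intro a ha b hb hab
      simp only [Finset.coe_filter, Finset.mem_univ, true_and, Set.mem_ofPred_eq] at ha hb
      rcases lt_trichotomy a b with h | h | h
      · exact absurd hab (key a b hb h)
      · exact h
      · exact absurd hab.symm (key b a ha h)
    have hsub : (Finset.univ.filter fun k : Fin R => (k : ℕ) < Z.card).image blk
        ⊆ Z.erase (blk r) := by
      intro b hb
      obtain ⟨k, hk, rfl⟩ := Finset.mem_image.1 hb
      have hk : (k : ℕ) < Z.card := by simpa using hk
      refine Finset.mem_erase.2 ⟨fun h => ?_, Finset.mem_image.2 ⟨k, by simpa using hβ k hk, rfl⟩⟩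
      rcases htwo k h with rfl | rfl
      · omega
      · have : (r : ℕ) < k := hrs
        omega
    have h1 := Finset.card_le_card hsub
    rw [Finset.card_image_of_injOn hinj, Finset.card_erase_of_mem hi] at h1
    have h2 : (Finset.univ.filter fun k : Fin R => (k : ℕ) < Z.card).card = Z.card := by
      calc _ = (Finset.univ.map (Fin.castLEEmb hZR)).card := by
            congr 1
            ext k
            simp only [Finset.mem_filter, Finset.mem_univ, true_and, Finset.mem_map,
              Fin.castLEEmb_apply]
            constructor
            · exact fun h => ⟨⟨k, h⟩, rfl⟩
            · rintro ⟨a, rfl⟩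
              exact a.2
        _ = Z.card := by simp
    have : 0 < Z.card := Finset.card_pos.2 ⟨_, hi⟩
    omega
  refine ⟨hβ r hr, ?_⟩
  have := hcomb r s hsame.symm r hr
  rw [hL1] at this
  linarith

/-! ### Kernel vectors by elimination with prescribed pivots -/

/-- Fraction free Gaussian elimination with the pivots `(I 0, J 0), (I 1, J 1), …`. -/
def elim (A : ℕ → ℕ → ℝ) (I J : ℕ → ℕ) : ℕ → ℕ → ℕ → ℝ
  | 0 => A
  | l + 1 => fun i j =>
      elim A I J l (I l) (J l) * elim A I J l i j - elim A I J l i (J l) * elim A I J l (I l) j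

/-- The sum of the absolute values of the entries. -/
def mass (n k : ℕ) (B : ℕ → ℕ → ℝ) : ℝ :=
  ∑ i ∈ Finset.range n, ∑ j ∈ Finset.range k, |B i j|

/-- Whether the value `i` is taken by `I` below `len`. -/
def usedBelow (I : ℕ → ℕ) (len i : ℕ) : Bool := !allBelow len fun l => !decide (I l = i)

theorem usedBelow_iff {I : ℕ → ℕ} {len i : ℕ} :
    usedBelow I len i = true ↔ ∃ l < len, I l = i := by
  simp only [usedBelow, Bool.not_eq_true', ← Bool.not_eq_true, allBelow_eq_true,
    decide_eq_true_eq]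
  push Not
  rfl

/-- The sum of the absolute values of the entries outside the rows and columns of the pivots. -/
def freeMass (n k : ℕ) (I J : ℕ → ℕ) (len : ℕ) (ν : ℕ → ℕ → ℝ) : ℝ :=
  ∑ i ∈ Finset.range n, ∑ j ∈ Finset.range k,
    if usedBelow I len i || usedBelow J len j then 0 else |ν i j|

/-- Back substitution, starting from the unit vector at `i₀`. -/
def backSub (n : ℕ) (ν : ℕ → ℕ → ℕ → ℝ) (I J : ℕ → ℕ) (len i₀ : ℕ) : ℕ → ℕ → ℝ
  | 0 => fun i => if i = i₀ then 1 else 0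
  | t + 1 => fun i =>
      ν (len - 1 - t) (I (len - 1 - t)) (J (len - 1 - t)) * backSub n ν I J len i₀ t i -
        if i = I (len - 1 - t) then
          ∑ a ∈ Finset.range n, backSub n ν I J len i₀ t a * ν (len - 1 - t) a (J (len - 1 - t))
        else 0

theorem elim_eq_zero {A : ℕ → ℕ → ℝ} {I J : ℕ → ℕ} {len i j : ℕ}
    (h : usedBelow I len i = true ∨ usedBelow J len j = true) : elim A I J len i j = 0 := by
  induction len generalizing i j with
  | zero => simp [usedBelow_iff] at h
  | succ l ih =>
    simp only [usedBelow_iff] at h ih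
    have hrow : ∀ j', (∃ l' < l, I l' = i) → elim A I J l i j' = 0 := fun j' h => ih (Or.inl h)
    have hcol : ∀ i', (∃ l' < l, J l' = j) → elim A I J l i' j = 0 := fun i' h => ih (Or.inr h)
    rcases h with ⟨l', hl', e⟩ | ⟨l', hl', e⟩
    · rcases Nat.lt_succ_iff_lt_or_eq.1 hl' with hlt | rfl
      · simp only [elim]
        rw [hrow _ ⟨l', hlt, e⟩, hrow _ ⟨l', hlt, e⟩]
        ring
      · simp only [elim, e]
        ring
    · rcases Nat.lt_succ_iff_lt_or_eq.1 hl' with hlt | rfl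
      · simp only [elim]
        rw [hcol _ ⟨l', hlt, e⟩, hcol _ ⟨l', hlt, e⟩]
        ring
      · simp only [elim, e]
        ring

theorem eq_zero_of_mass {n k : ℕ} {B : ℕ → ℕ → ℝ} (h : mass n k B = 0) {i j : ℕ} (hi : i < n)
    (hj : j < k) : B i j = 0 := by
  have h1 := (Finset.sum_eq_zero_iff_of_nonneg
    fun i _ => Finset.sum_nonneg fun j _ => abs_nonneg _).1 h i (Finset.mem_range.2 hi)
  have h2 := (Finset.sum_eq_zero_iff_of_nonneg fun j _ => abs_nonneg _).1 h1 j
    (Finset.mem_range.2 hj)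
  exact abs_eq_zero.1 h2

theorem mass_nonneg (n k : ℕ) (B : ℕ → ℕ → ℝ) : 0 ≤ mass n k B :=
  Finset.sum_nonneg fun _ _ => Finset.sum_nonneg fun _ _ => abs_nonneg _

section Kernel

variable {n k len i₀ : ℕ} {A : ℕ → ℕ → ℝ} {I J : ℕ → ℕ} {ν : ℕ → ℕ → ℕ → ℝ}

/-- Back substitution yields a vector in the left kernel, whatever the values of `ν` are where the
matrix has already been reduced to zero. -/
theorem backSub_kernel (hI : ∀ l < len, I l < n) (hJ : ∀ l < len, J l < k)
    (hν : ∀ l ≤ len, mass n k (elim A I J l) ≠ 0 → ∀ i < n, ∀ j < k,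
      ν l i j = elim A I J l i j / mass n k (elim A I J l))
    (hend : freeMass n k I J len (ν len) ≠ 1) {j : ℕ} (hj : j < k) :
    ∑ i ∈ Finset.range n, backSub n ν I J len i₀ len i * A i j = 0 := by
  have h0 : ∀ i < n, ∀ j < k, elim A I J len i j = 0 := by
    by_contra hc
    have hm : mass n k (elim A I J len) ≠ 0 := fun hm =>
      hc fun i hi j hj => eq_zero_of_mass hm hi hj
    refine hend ?_
    have : freeMass n k I J len (ν len) = mass n k (elim A I J len) / mass n k (elim A I J len) := by
      conv_rhs => rw [mass.eq_def n k]
      rw [Finset.sum_div]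
      refine Finset.sum_congr rfl fun i hi => ?_
      rw [Finset.sum_div]
      refine Finset.sum_congr rfl fun j hj => ?_
      rw [hν len le_rfl hm i (Finset.mem_range.1 hi) j (Finset.mem_range.1 hj)]
      split_ifs with hu
      · rw [elim_eq_zero (by simpa using hu)]
        simp
      · rw [abs_div, abs_of_nonneg (mass_nonneg _ _ _)]
        rfl
    rw [this, div_self hm]
  have key : ∀ t ≤ len, ∀ j < k,
      ∑ i ∈ Finset.range n, backSub n ν I J len i₀ t i * elim A I J (len - t) i j = 0 := by
    intro t
    induction t with
    | zero =>
      intro _ j hj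
      refine Finset.sum_eq_zero fun i hi => ?_
      rw [Nat.sub_zero, h0 i (Finset.mem_range.1 hi) j hj, mul_zero]
    | succ t ih =>
      intro ht j hj
      have ih := ih (by omega) j hj
      obtain ⟨l, hl⟩ : ∃ l, l = len - (t + 1) := ⟨_, rfl⟩
      have hl1 : len - 1 - t = l := by omega
      have hl2 : len - t = l + 1 := by omega
      have hlt : l < len := by omega
      rw [hl2] at ih
      simp only [backSub, hl1, ← hl]
      by_cases hm : mass n k (elim A I J l) = 0
      · exact Finset.sum_eq_zero fun i hi => by
          rw [eq_zero_of_mass hm (Finset.mem_range.1 hi) hj, mul_zero]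
      · have hv := hν l hlt.le hm
        simp only [elim] at ih
        simp only [sub_mul, ite_mul, zero_mul, Finset.sum_sub_distrib, Finset.sum_ite_eq',
          Finset.mem_range, hI l hlt, if_true]
        rw [hv _ (hI l hlt) _ (hJ l hlt), Finset.sum_mul, ← Finset.sum_sub_distrib]
        have e : ∀ i ∈ Finset.range n,
            elim A I J l (I l) (J l) / mass n k (elim A I J l) * backSub n ν I J len i₀ t i
                * elim A I J l i j
              - backSub n ν I J len i₀ t i * ν l i (J l) * elim A I J l (I l) j
            = (backSub n ν I J len i₀ t i * (elim A I J l (I l) (J l) * elim A I J l i j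
                - elim A I J l i (J l) * elim A I J l (I l) j)) / mass n k (elim A I J l) := by
          intro i hi
          rw [hv i (Finset.mem_range.1 hi) _ (hJ l hlt)]
          field_simp
        rw [Finset.sum_congr rfl e, ← Finset.sum_div, ih, zero_div]
  simpa [elim] using key len le_rfl j hj

theorem backSub_support {i : ℕ} (h0 : i ≠ i₀) (hI : ∀ l < len, I l ≠ i) :
    backSub n ν I J len i₀ len i = 0 := by
  have : ∀ t ≤ len, backSub n ν I J len i₀ t i = 0 := by
    intro t
    induction t with
    | zero => intro _; simp [backSub, h0]
    | succ t ih =>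
      intro ht
      simp only [backSub]
      rw [ih (by omega), if_neg (hI _ (by omega)).symm]
      ring
  exact this len le_rfl

theorem backSub_ne_zero (h0 : ∀ l < len, I l ≠ i₀) (hν : ∀ l < len, ν l (I l) (J l) ≠ 0) :
    backSub n ν I J len i₀ len i₀ ≠ 0 := by
  have : ∀ t ≤ len, backSub n ν I J len i₀ t i₀ ≠ 0 := by
    intro t
    induction t with
    | zero => intro _; simp [backSub]
    | succ t ih =>
      intro ht
      simp only [backSub]
      rw [if_neg (h0 (len - 1 - t) (by omega)).symm, sub_zero]
      exact mul_ne_zero (hν _ (by omega)) (ih (by omega))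
  exact this len le_rfl

end Kernel

/-- The code of a path of pivots. -/
def pathCode (b E₀ : ℕ) (I J : ℕ → ℕ) : ℕ → ℕ
  | 0 => E₀
  | l + 1 => (pathCode b E₀ I J l * b + I l) * b + J l

theorem pathCode_congr {b E₀ : ℕ} {I J I' J' : ℕ → ℕ} {l : ℕ} (hI : ∀ a < l, I a = I' a)
    (hJ : ∀ a < l, J a = J' a) : pathCode b E₀ I J l = pathCode b E₀ I' J' l := by
  induction l with
  | zero => rfl
  | succ l ih =>
    rw [pathCode, pathCode, ih (fun a ha => hI a (by omega)) (fun a ha => hJ a (by omega)),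
      hI l (by omega), hJ l (by omega)]

/-- A greedy choice of pivots with nonzero answers, continued until all remaining answers are
zero. -/
theorem exists_path (b E₀ n k : ℕ) (S : Finset ℕ) (ans : ℕ → ℕ → ℕ → ℕ → ℝ)
    (hS : ∀ i < n, ∀ E l j, ans E l i j ≠ 0 → i ∈ S) (hSk : k < S.card) :
    ∃ (len : ℕ) (I J : ℕ → ℕ) (i₀ : ℕ), len ≤ k ∧ (∀ l < len, I l ∈ S) ∧ (∀ l < len, J l < k) ∧
      (∀ l < len, ans (pathCode b E₀ I J l) l (I l) (J l) ≠ 0) ∧ i₀ ∈ S ∧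
      (∀ l < len, I l ≠ i₀) ∧
      freeMass n k I J len (ans (pathCode b E₀ I J len) len) = 0 := by
  classical
  let P : ℕ → Prop := fun len => ∃ I J : ℕ → ℕ, (∀ l < len, I l ∈ S) ∧ (∀ l < len, J l < k) ∧
    (∀ l < len, ans (pathCode b E₀ I J l) l (I l) (J l) ≠ 0) ∧
    Set.InjOn I (Set.Iio len) ∧ Set.InjOn J (Set.Iio len)
  have hbound : ∀ len, P len → len ≤ k := by
    rintro len ⟨I, J, -, hJ, -, -, hinj⟩
    have := Finset.card_le_card_of_injOn (s := Finset.range len) (t := Finset.range k) J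
      (fun l hl => by simpa using hJ l (by simpa using hl)) (by simpa using hinj)
    simpa using this
  have hP0 : P 0 := ⟨id, id, by simp, by simp, by simp, by simp, by simp⟩
  obtain ⟨len, hPlen, hmax⟩ : ∃ len, P len ∧ ¬ P (len + 1) := by
    by_contra hc
    push Not at hc
    have : ∀ len, P len := fun len => Nat.rec hP0 (fun l ih => hc l ih) len
    have := hbound _ (this (k + 1))
    omega
  have hlen := hbound len hPlen
  obtain ⟨I, J, hI, hJ, hν, hIinj, hJinj⟩ := hPlen
  have hcard : ((Finset.range len).image I).card < S.card :=
    lt_of_le_of_lt (Finset.card_image_le.trans (by simpa using hlen)) hSk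
  obtain ⟨i₀, hi₀, hi₀'⟩ := Finset.exists_mem_notMem_of_card_lt_card hcard
  refine ⟨len, I, J, i₀, hlen, hI, hJ, hν, hi₀, ?_, ?_⟩
  · rintro l hl rfl
    exact hi₀' (Finset.mem_image_of_mem _ (by simpa using hl))
  · refine Finset.sum_eq_zero fun i hi => Finset.sum_eq_zero fun j hj => ?_
    split_ifs with hu
    · rfl
    · rw [abs_eq_zero]
      by_contra hne
      rw [Bool.or_eq_true, not_or, usedBelow_iff, usedBelow_iff] at hu
      push Not at hu
      apply hmax
      have eI : ∀ a < len, Function.update I len i a = I a := fun a ha =>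
        Function.update_of_ne ha.ne _ _
      have eJ : ∀ a < len, Function.update J len j a = J a := fun a ha =>
        Function.update_of_ne ha.ne _ _
      have ec : ∀ a ≤ len, pathCode b E₀ (Function.update I len i) (Function.update J len j) a
          = pathCode b E₀ I J a := fun a ha =>
        pathCode_congr (fun c hc => eI c (by omega)) (fun c hc => eJ c (by omega))
      refine ⟨Function.update I len i, Function.update J len j, ?_, ?_, ?_, ?_, ?_⟩
      · intro l hl
        rcases Nat.lt_succ_iff_lt_or_eq.1 hl with h | rfl
        · rw [eI l h]
          exact hI l h
        · rw [Function.update_self]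
          exact hS i (Finset.mem_range.1 hi) _ _ _ hne
      · intro l hl
        rcases Nat.lt_succ_iff_lt_or_eq.1 hl with h | rfl
        · rw [eJ l h]
          exact hJ l h
        · rw [Function.update_self]
          exact Finset.mem_range.1 hj
      · intro l hl
        rw [ec l (by omega)]
        rcases Nat.lt_succ_iff_lt_or_eq.1 hl with h | rfl
        · rw [eI l h, eJ l h]
          exact hν l h
        · rw [Function.update_self, Function.update_self]
          exact hne
      · intro a ha c hc hac
        rcases Nat.lt_succ_iff_lt_or_eq.1 ha with h | rfl <;>
        rcases Nat.lt_succ_iff_lt_or_eq.1 hc with h' | rfl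
        · rw [eI a h, eI c h'] at hac
          exact hIinj h h' hac
        · rw [eI a h, Function.update_self] at hac
          exact absurd hac (hu.1 a h)
        · rw [eI c h', Function.update_self] at hac
          exact absurd hac.symm (hu.1 c h')
        · rfl
      · intro a ha c hc hac
        rcases Nat.lt_succ_iff_lt_or_eq.1 ha with h | rfl <;>
        rcases Nat.lt_succ_iff_lt_or_eq.1 hc with h' | rfl
        · rw [eJ a h, eJ c h'] at hac
          exact hJinj h h' hac
        · rw [eJ a h, Function.update_self] at hac
          exact absurd hac (hu.2 a h)
        · rw [eJ c h', Function.update_self] at hac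
          exact absurd hac.symm (hu.2 c h')
        · rfl

/-! ### LU-decompositions from kernel vectors -/

/-- The Horner scheme for the inverse of `1 - N`. -/
def horner (n : ℕ) (N : ℕ → ℕ → ℝ) : ℕ → ℕ → ℕ → ℝ
  | 0 => fun r c => if r = c then 1 else 0
  | t + 1 => fun r c => (if r = c then 1 else 0) + ∑ s ∈ Finset.range n, N r s * horner n N t s c

/-- The strictly lower triangular part of the negative of the normalized rows. -/
noncomputable def strictPart (X : ℕ → ℕ → ℝ) (σ : ℕ → ℕ) (k l : ℕ) : ℝ :=
  if l < k then -(X k (σ l) * (X k (σ k))⁻¹) else 0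

theorem horner_lower {n : ℕ} {N : ℕ → ℕ → ℝ} (hN : ∀ r c, r ≤ c → N r c = 0) (t : ℕ) {r c : ℕ} :
    (r < c → horner n N t r c = 0) ∧ (r = c → horner n N t r c = 1) := by
  induction t generalizing r c with
  | zero => exact ⟨fun h => by simp [horner, h.ne], fun h => by simp [horner, h]⟩
  | succ t ih =>
    have hs : r ≤ c → ∑ s ∈ Finset.range n, N r s * horner n N t s c = 0 := fun hrc =>
      Finset.sum_eq_zero fun s _ => by
        rcases le_or_gt r s with h | h
        · rw [hN r s h, zero_mul]
        · rw [ih.1 (h.trans_le hrc), mul_zero]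
    exact ⟨fun h => by simp [horner, h.ne, hs h.le], fun h => by
      simp only [horner]
      rw [hs h.le]
      simp [h]⟩

theorem permMatrix_mul_apply {n m : ℕ} (σ : Equiv.Perm (Fin n)) (A : Matrix (Fin n) (Fin m) ℝ)
    (k : Fin n) (j : Fin m) : (σ.permMatrix ℝ * A) k j = A (σ k) j := by
  rw [Matrix.mul_apply, Finset.sum_eq_single (σ k)]
  · simp [Equiv.Perm.permMatrix, PEquiv.toMatrix_apply]
  · intro i _ hi
    simp [Equiv.Perm.permMatrix, PEquiv.toMatrix_apply, hi.symm]
  · simp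

/-- Kernel vectors `X k` of the first `k` columns, which are triangular with respect to the order
`σ` of the rows, give an LU-decomposition. -/
theorem isLUDecomp_of_kernel {n m : ℕ} (A : Matrix (Fin n) (Fin m) ℝ) (σ : Equiv.Perm (Fin n))
    (s : ℕ → ℕ) (hs : ∀ k : Fin n, s k = σ k) (X : ℕ → ℕ → ℝ)
    (hdiag : ∀ k : Fin n, X k (s k) ≠ 0) (htri : ∀ k l : Fin n, k < l → X k (s l) = 0)
    (hker : ∀ (k : Fin n) (j : Fin m), (j : ℕ) < k → ∑ i : Fin n, X k i * A i j = 0) :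
    IsLUDecomp A (σ.permMatrix ℝ) 1
      (Matrix.of fun k j => (∑ i : Fin n, X k i * A i j) * (X k (s k))⁻¹)
      (Matrix.of fun r c : Fin n => horner n (strictPart X s) n r c) := by
  set N : Matrix (Fin n) (Fin n) ℝ := Matrix.of fun r c => strictPart X s r c with hN
  have hN0 : ∀ r c, r ≤ c → strictPart X s r c = 0 := fun r c h => if_neg (not_lt.2 h)
  set T : ℕ → Matrix (Fin n) (Fin n) ℝ :=
    fun t => Matrix.of fun r c => horner n (strictPart X s) t r c with hT
  have hT0 : T 0 = 1 := by
    ext r c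
    simp [hT, horner, Matrix.one_apply, Fin.ext_iff]
  have hT1 : ∀ t, T (t + 1) = 1 + N * T t := by
    intro t
    ext r c
    simp [hT, hN, horner, Matrix.one_apply, Fin.ext_iff, Matrix.mul_apply, Finset.sum_range]
  have hpow : ∀ t, ∀ r c : Fin n, (r : ℕ) < c + t → (N ^ t) r c = 0 := by
    intro t
    induction t with
    | zero =>
      intro r c h
      rw [pow_zero, Matrix.one_apply_ne]
      rintro rfl
      omega
    | succ t ih =>
      intro r c h
      rw [pow_succ, Matrix.mul_apply]
      refine Finset.sum_eq_zero fun a _ => ?_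
      rcases lt_or_ge (r : ℕ) (a + t) with h1 | h1
      · rw [ih r a h1, zero_mul]
      · rw [hN, Matrix.of_apply, hN0 a c (by omega), mul_zero]
  have htel : ∀ t, (1 - N) * T t = 1 - N ^ (t + 1) := by
    intro t
    induction t with
    | zero => rw [hT0]; simp
    | succ t ih =>
      calc (1 - N) * T (t + 1) = (1 - N) + N * ((1 - N) * T t) := by
            rw [hT1]
            noncomm_ring
        _ = 1 - N ^ (t + 1 + 1) := by
            rw [ih, pow_succ' N (t + 1)]
            noncomm_ring
  have hinv : (1 - N) * T n = 1 := by
    rw [htel, sub_eq_self]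
    ext r c
    rw [hpow _ r c (by omega)]
    rfl
  have hinv' : T n * (1 - N) = 1 := mul_eq_one_comm.1 hinv
  have hU : (Matrix.of fun (k : Fin n) (j : Fin m) =>
      (∑ i : Fin n, X k i * A i j) * (X k (s k))⁻¹) = (1 - N) * (σ.permMatrix ℝ * A) := by
    ext k j
    rw [Matrix.mul_apply, Matrix.of_apply, Finset.sum_mul]
    rw [← Equiv.sum_comp σ]
    refine Finset.sum_congr rfl fun l _ => ?_
    rw [permMatrix_mul_apply, ← hs l, Matrix.sub_apply, hN, Matrix.of_apply, strictPart]
    rcases lt_trichotomy l k with h | rfl | h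
    · rw [if_pos (Fin.lt_def.1 h), Matrix.one_apply_ne h.ne']
      ring
    · rw [if_neg (lt_irrefl _), Matrix.one_apply_eq, mul_right_comm, mul_inv_cancel₀ (hdiag l)]
      ring
    · rw [if_neg (not_lt.2 (Fin.le_def.1 h.le)), Matrix.one_apply_ne h.ne, htri k l h]
      ring
  refine ⟨⟨σ, rfl⟩, ⟨1, by simp⟩, ?_, ?_, ?_, ?_⟩
  · intro i j hij
    rw [Matrix.of_apply, hker i j hij, zero_mul]
  · intro i j hij
    exact (horner_lower hN0 n).1 hij
  · intro i
    exact (horner_lower hN0 n).2 rfl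
  · rw [Matrix.mul_one, hU]
    have : T n * ((1 - N) * (σ.permMatrix ℝ * A)) = σ.permMatrix ℝ * A := by
      rw [← Matrix.mul_assoc, hinv', Matrix.one_mul]
    exact this.symm

/-! ### Names of tuples and matrices -/

/-- The place at which the name of the entry `(i, j)` of an `n × m` matrix begins; the name of the
matrix consists of the places `s, s + t, s + 2 t, …`. -/
def entryStart (s t n m i j : ℕ) : ℕ := s + t * (n + m + 2 + n * j + i)

/-- The layout of the name of an `n × m` matrix whose entries are the numbers with the indices
`Nat.pair tag (Nat.pair i j)`. -/
def matLay (tag n m pos : ℕ) : ℕ :=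
  if pos < n then 0 else if pos = n then 1 else if pos < n + 1 + m then 0
  else if pos = n + 1 + m then 1
  else 2 + Nat.pair (Nat.pair tag (Nat.pair ((pos - (n + m + 2)) % n)
    ((pos - (n + m + 2)) / n % m))) ((pos - (n + m + 2)) / n / m)

/-- The layout of the name of a tuple of `n` numbers. -/
def tupleLay (n pos : ℕ) : ℕ :=
  if pos < n then 0 else if pos = n then 1
  else 2 + Nat.pair ((pos - (n + 1)) % n) ((pos - (n + 1)) / n)

/-- The layout of the name of a tuple of `n` pairs of numbers. -/
def pairsLay (n pos : ℕ) : ℕ :=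
  if pos < n then 0 else if pos = n then 1
  else 2 + Nat.pair (Nat.pair ((pos - (n + 1)) % n) ((pos - (n + 1)) / n % 2))
    ((pos - (n + 1)) / n / 2)

section Primitive

variable {α : Type} [Primcodable α]

@[fun_prop] theorem primrec_entryStart {s t n m i j : α → ℕ} (hs : Primrec s) (ht : Primrec t)
    (hn : Primrec n) (hm : Primrec m) (hi : Primrec i) (hj : Primrec j) :
    Primrec (fun x => entryStart (s x) (t x) (n x) (m x) (i x) (j x)) := by
  unfold entryStart
  fun_prop

@[fun_prop] theorem primrec_matLay {t n m k : α → ℕ} (ht : Primrec t) (hn : Primrec n)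
    (hm : Primrec m) (hk : Primrec k) : Primrec (fun x => matLay (t x) (n x) (m x) (k x)) := by
  unfold matLay
  fun_prop

@[fun_prop] theorem primrec_tupleLay {n k : α → ℕ} (hn : Primrec n) (hk : Primrec k) :
    Primrec (fun x => tupleLay (n x) (k x)) := by
  unfold tupleLay
  fun_prop

@[fun_prop] theorem primrec_pairsLay {n k : α → ℕ} (hn : Primrec n) (hk : Primrec k) :
    Primrec (fun x => pairsLay (n x) (k x)) := by
  unfold pairsLay
  fun_prop

end Primitive

theorem outBit_zero (r : ℕ → Cantor) : outBit 0 r = false := by simp [outBit]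

theorem outBit_one (r : ℕ → Cantor) : outBit 1 r = true := by simp [outBit]

theorem outBit_add_two (j k : ℕ) (r : ℕ → Cantor) : outBit (2 + Nat.pair j k) r = r j k := by
  rw [outBit, if_neg (by omega), Nat.add_sub_cancel_left, Nat.unpair_pair]

/-- Reading a matrix along the places `s, s + t, …`. -/
theorem RealMatrix.name_entry {p : Cantor} {s t n m : ℕ} {M : Matrix (Fin n) (Fin m) ℝ}
    (h : Represented.IsName (fun k => p (s + t * k)) (⟨n, m, M⟩ : RealMatrix)) :
    StartsWith p s t n ∧ StartsWith p (s + t * (n + 1)) t m ∧ ∀ (i : Fin n) (j : Fin m),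
      Represented.IsName (fun k => p (entryStart s t n m i j + t * (n * m) * k)) (M i j) := by
  obtain ⟨h1, h2, h3, h4, h5⟩ := h
  refine ⟨⟨h1, h2⟩, ⟨fun k hk => ?_, ?_⟩, fun i j => ?_⟩
  · rw [← h3 k hk]
    congr 1
    ring
  · rw [← h4]
    congr 1
    ring
  · convert h5 i j using 1
    funext k
    simp only [component, entryStart]
    congr 1
    ring

/-- Writing a matrix. -/
theorem RealMatrix.isName_of_layout {q : Cantor} {tag n m : ℕ} {r : ℕ → Cantor}
    {M : Matrix (Fin n) (Fin m) ℝ} (hq : ∀ pos, q pos = outBit (matLay tag n m pos) r)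
    (hr : ∀ (i : Fin n) (j : Fin m),
      Represented.IsName (r (Nat.pair tag (Nat.pair i j))) (M i j)) :
    Represented.IsName q (⟨n, m, M⟩ : RealMatrix) := by
  refine ⟨fun k hk => ?_, ?_, fun k hk => ?_, ?_, fun i j => ?_⟩
  · have hk : k < n := hk
    rw [hq, matLay, if_pos hk, outBit_zero]
  · change q n = true
    rw [hq, matLay, if_neg (lt_irrefl _), if_pos rfl, outBit_one]
  · have hk : k < m := hk
    change q (n + 1 + k) = false
    rw [hq, matLay, if_neg (by omega), if_neg (by omega), if_pos (by omega), outBit_zero]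
  · change q (n + 1 + m) = true
    rw [hq, matLay, if_neg (by omega), if_neg (by omega), if_neg (by omega), if_pos rfl,
      outBit_one]
  · convert hr i j using 1
    funext k
    change q (n + 1 + (m + 1 + (n * (m * k + j) + i))) = _
    have e : n + 1 + (m + 1 + (n * (m * k + j) + i)) - (n + m + 2) = n * (m * k + j) + i := by
      omega
    have hn : 0 < n := i.pos
    have hm : 0 < m := j.pos
    have e1 : (n * (m * k + j) + i) % n = i := by
      rw [Nat.mul_add_mod, Nat.mod_eq_of_lt i.2]
    have e2 : (n * (m * k + j) + i) / n = m * k + j := by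
      rw [Nat.mul_add_div hn, Nat.div_eq_of_lt i.2, add_zero]
    have e3 : (m * k + j) % m = j := by
      rw [Nat.mul_add_mod, Nat.mod_eq_of_lt j.2]
    have e4 : (m * k + j) / m = k := by
      rw [Nat.mul_add_div hm, Nat.div_eq_of_lt j.2, add_zero]
    rw [hq, matLay, if_neg (by omega), if_neg (by omega), if_neg (by omega), if_neg (by omega),
      e, e1, e2, e3, e4, outBit_add_two]

theorem tuple_name_entry {p : Cantor} {s t n : ℕ} {z : Fin n → Set.Icc (0 : ℝ) 1}
    (h : Represented.IsName (fun k => p (s + t * k))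
      (⟨n, z⟩ : Σ n : ℕ, (Fin n → Set.Icc (0 : ℝ) 1))) :
    StartsWith p s t n ∧ ∀ i : Fin n,
      Represented.IsName (fun k => p (s + t * (n + 1 + i) + t * n * k)) (z i : ℝ) := by
  obtain ⟨h1, h2, h3⟩ := h
  refine ⟨⟨h1, h2⟩, fun i => ?_⟩
  change Represented.IsName _ (z i)
  convert h3 i using 1
  funext k
  simp only [component]
  congr 1
  ring

theorem tuple_isName_of_layout {q : Cantor} {n : ℕ} {r : ℕ → Cantor}
    {z : Fin n → Set.Icc (0 : ℝ) 1} (hq : ∀ pos, q pos = outBit (tupleLay n pos) r)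
    (hr : ∀ i : Fin n, Represented.IsName (r i) (z i : ℝ)) :
    Represented.IsName q (⟨n, z⟩ : Σ n : ℕ, (Fin n → Set.Icc (0 : ℝ) 1)) := by
  refine ⟨fun k hk => ?_, ?_, fun i => ?_⟩
  · have hk : k < n := hk
    rw [hq, tupleLay, if_pos hk, outBit_zero]
  · change q n = true
    rw [hq, tupleLay, if_neg (lt_irrefl _), if_pos rfl, outBit_one]
  · change Represented.IsName _ (z i : ℝ)
    convert hr i using 1
    funext k
    change q (n + 1 + (n * k + i)) = _
    have hn : 0 < n := i.pos
    have e : n + 1 + (n * k + i) - (n + 1) = n * k + i := by omega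
    have e1 : (n * k + i) % n = i := by
      rw [Nat.mul_add_mod, Nat.mod_eq_of_lt i.2]
    have e2 : (n * k + i) / n = k := by
      rw [Nat.mul_add_div hn, Nat.div_eq_of_lt i.2, add_zero]
    rw [hq, tupleLay, if_neg (by omega), if_neg (by omega), e, e1, e2, outBit_add_two]

theorem pairs_name_entry {p : Cantor} {n : ℕ} {x : Fin n → ℝ × ℝ}
    (h : Represented.IsName p (⟨n, x⟩ : Σ n : ℕ, (Fin n → ℝ × ℝ))) :
    StartsWith p 0 1 n ∧ ∀ i : Fin n,
      Represented.IsName (fun k => p (n + 1 + i + 2 * n * k)) (x i).1 ∧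
      Represented.IsName (fun k => p (n + 1 + n + i + 2 * n * k)) (x i).2 := by
  obtain ⟨h1, h2, h3⟩ := h
  refine ⟨⟨fun k hk => ?_, ?_⟩, fun i => ⟨?_, ?_⟩⟩
  · rw [← h1 k hk]
    congr 1
    ring
  · rw [← h2]
    congr 1
    simp
  · convert (h3 i).1 using 1
    funext k
    simp only [component]
    congr 1
    ring
  · convert (h3 i).2 using 1
    funext k
    simp only [component]
    congr 1
    ring

theorem pairs_isName_of_layout {q : Cantor} {n : ℕ} {r : ℕ → Cantor} {x : Fin n → ℝ × ℝ}
    (hq : ∀ pos, q pos = outBit (pairsLay n pos) r)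
    (hr : ∀ i : Fin n, Represented.IsName (r (Nat.pair i 0)) (x i).1 ∧
      Represented.IsName (r (Nat.pair i 1)) (x i).2) :
    Represented.IsName q (⟨n, x⟩ : Σ n : ℕ, (Fin n → ℝ × ℝ)) := by
  have key : ∀ (i : Fin n) (b k : ℕ), b < 2 → q (n + 1 + (n * (2 * k + b) + i))
      = r (Nat.pair i b) k := by
    intro i b k hb
    have hn : 0 < n := i.pos
    have e : n + 1 + (n * (2 * k + b) + i) - (n + 1) = n * (2 * k + b) + i := by omega
    have e1 : (n * (2 * k + b) + i) % n = i := by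
      rw [Nat.mul_add_mod, Nat.mod_eq_of_lt i.2]
    have e2 : (n * (2 * k + b) + i) / n = 2 * k + b := by
      rw [Nat.mul_add_div hn, Nat.div_eq_of_lt i.2, add_zero]
    have e3 : (2 * k + b) % 2 = b := by omega
    have e4 : (2 * k + b) / 2 = k := by omega
    rw [hq, pairsLay, if_neg (by omega), if_neg (by omega), e, e1, e2, e3, e4, outBit_add_two]
  refine ⟨fun k hk => ?_, ?_, fun i => ⟨?_, ?_⟩⟩
  · have hk : k < n := hk
    rw [hq, pairsLay, if_pos hk, outBit_zero]
  · change q n = true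
    rw [hq, pairsLay, if_neg (lt_irrefl _), if_pos rfl, outBit_one]
  · convert (hr i).1 using 1
    funext k
    exact key i 0 k (by omega)
  · convert (hr i).2 using 1
    funext k
    exact key i 1 k (by omega)

/-- The ball read from the places `s, s + t, …` with precision `κ`. -/
def readBall (u : List Bool) (s t κ : ℕ) : ℕ := Nat.pair (readVal u s t κ) (qhalf κ)

@[fun_prop] theorem primrec_readBall {α : Type} [Primcodable α] {u : α → List Bool}
    {s t κ : α → ℕ} (hu : Primrec u) (hs : Primrec s) (ht : Primrec t) (hκ : Primrec κ) :
    Primrec (fun x => readBall (u x) (s x) (t x) (κ x)) := by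
  unfold readBall
  fun_prop

theorem exists_readBall {p : Cantor} {s t : ℕ} {x : ℝ}
    (h : Represented.IsName (fun k => p (s + t * k)) x) : ∃ ball : ℕ → ℕ, Approx ball x ∧
      (∀ T κ, readOk (prefixOf p T) s t κ = true → readBall (prefixOf p T) s t κ = ball κ) ∧
      (∀ κ, rad (ball κ) = (1 / 2 : ℝ) ^ κ) ∧
      ∀ κ, ∃ T₀, ∀ T ≥ T₀, readOk (prefixOf p T) s t κ = true := by
  obtain ⟨a, ha, hx⟩ := h
  refine ⟨termBall a, Approx.termBall hx, fun T κ hok => ?_, fun κ => ?_, fun κ => exists_readOk ha κ⟩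
  · rw [readBall, readVal_eq ha hok]
    rfl
  · rw [rad, termBall, Nat.unpair_pair, cast_qhalf]

/-- Finitely many eventual properties hold simultaneously. -/
theorem exists_forall_lt {P : ℕ → ℕ → Prop} {n : ℕ}
    (h : ∀ i < n, ∃ T₀, ∀ T ≥ T₀, P i T) : ∃ T₀, ∀ T ≥ T₀, ∀ i < n, P i T := by
  have : ∀ᶠ T in atTop, ∀ i ∈ Finset.range n, P i T := by
    rw [Finset.eventually_all]
    intro i hi
    exact eventually_atTop.2 (h i (Finset.mem_range.1 hi))
  obtain ⟨T₀, hT₀⟩ := eventually_atTop.1 this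
  exact ⟨T₀, fun T hT i hi => hT₀ T hT i (Finset.mem_range.2 hi)⟩

/-! ### Reading families of real numbers -/

theorem exists_readBalls {ι : Type} [DecidableEq ι] {p : Cantor} (D : Finset ι) (s t : ι → ℕ)
    (x : ι → ℝ) (h : ∀ i ∈ D, Represented.IsName (fun k => p (s i + t i * k)) (x i)) :
    ∃ ball : ℕ → ι → ℕ, (∀ i, Approx (fun κ => ball κ i) (if i ∈ D then x i else 0)) ∧
      (∀ T κ, (∀ i ∈ D, readOk (prefixOf p T) (s i) (t i) κ = true) → ∀ i,
        (if i ∈ D then readBall (prefixOf p T) (s i) (t i) κ else 0) = ball κ i) ∧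
      (∀ κ, ∀ i ∈ D, rad (ball κ i) = (1 / 2 : ℝ) ^ κ) ∧
      ∀ κ, ∃ T₀, ∀ T ≥ T₀, ∀ i ∈ D, readOk (prefixOf p T) (s i) (t i) κ = true := by
  have h' : ∀ i, ∃ ball : ℕ → ℕ, i ∈ D → Approx ball (x i) ∧
      (∀ T κ, readOk (prefixOf p T) (s i) (t i) κ = true →
        readBall (prefixOf p T) (s i) (t i) κ = ball κ) ∧
      (∀ κ, rad (ball κ) = (1 / 2 : ℝ) ^ κ) ∧
      ∀ κ, ∃ T₀, ∀ T ≥ T₀, readOk (prefixOf p T) (s i) (t i) κ = true := by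
    intro i
    by_cases hi : i ∈ D
    · obtain ⟨ball, hball⟩ := exists_readBall (h i hi)
      exact ⟨ball, fun _ => hball⟩
    · exact ⟨fun _ => 0, fun hi' => absurd hi' hi⟩
  choose ball hball using h'
  refine ⟨fun κ i => if i ∈ D then ball i κ else 0, fun i => ?_, fun T κ hT i => ?_,
    fun κ i hi => ?_, fun κ => ?_⟩
  · by_cases hi : i ∈ D
    · simpa only [if_pos hi] using (hball i hi).1
    · simpa only [if_neg hi] using Approx.zero
  · dsimp only
    split_ifs with hi
    · exact (hball i hi).2.1 T κ (hT i hi)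
    · rfl
  · dsimp only
    rw [if_pos hi]
    exact (hball i hi).2.2.1 κ
  · have : ∀ᶠ T in atTop, ∀ i ∈ D, readOk (prefixOf p T) (s i) (t i) κ = true := by
      rw [Finset.eventually_all]
      exact fun i hi => eventually_atTop.2 ((hball i hi).2.2.2 κ)
    exact eventually_atTop.1 this

/-- The ball for the entry `(i, j)` of a matrix, and zero outside of the matrix. -/
def matSrc (u : List Bool) (s t n m κ i j : ℕ) : ℕ :=
  if i < n then if j < m then readBall u (entryStart s t n m i j) (t * (n * m)) κ else 0 else 0

/-- Whether all entries of a matrix have been read with precision `κ`. -/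
def matRead (u : List Bool) (s t n m κ : ℕ) : Bool :=
  allBelow n fun i => allBelow m fun j => readOk u (entryStart s t n m i j) (t * (n * m)) κ

/-- The ball for the component `i` of a tuple. -/
def tupleSrc (u : List Bool) (s t n κ i : ℕ) : ℕ :=
  if i < n then readBall u (s + t * (n + 1 + i)) (t * n) κ else 0

def tupleRead (u : List Bool) (s t n κ : ℕ) : Bool :=
  allBelow n fun i => readOk u (s + t * (n + 1 + i)) (t * n) κ

/-- The ball for the number `e % 2` of the pair `e / 2` in a tuple of pairs. -/
def pairsSrc (u : List Bool) (n κ e : ℕ) : ℕ :=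
  if e < 2 * n then readBall u (n + 1 + n * (e % 2) + e / 2) (2 * n) κ else 0

def pairsRead (u : List Bool) (n κ : ℕ) : Bool :=
  allBelow (2 * n) fun e => readOk u (n + 1 + n * (e % 2) + e / 2) (2 * n) κ

section Primitive

variable {α : Type} [Primcodable α]

@[fun_prop] theorem primrec_matSrc {u : α → List Bool} {s t n m κ i j : α → ℕ} (hu : Primrec u)
    (hs : Primrec s) (ht : Primrec t) (hn : Primrec n) (hm : Primrec m) (hκ : Primrec κ)
    (hi : Primrec i) (hj : Primrec j) :
    Primrec (fun x => matSrc (u x) (s x) (t x) (n x) (m x) (κ x) (i x) (j x)) := by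
  unfold matSrc
  fun_prop

@[fun_prop] theorem primrec_matRead {u : α → List Bool} {s t n m κ : α → ℕ} (hu : Primrec u)
    (hs : Primrec s) (ht : Primrec t) (hn : Primrec n) (hm : Primrec m) (hκ : Primrec κ) :
    Primrec (fun x => matRead (u x) (s x) (t x) (n x) (m x) (κ x)) := by
  unfold matRead
  fun_prop

@[fun_prop] theorem primrec_tupleSrc {u : α → List Bool} {s t n κ i : α → ℕ} (hu : Primrec u)
    (hs : Primrec s) (ht : Primrec t) (hn : Primrec n) (hκ : Primrec κ) (hi : Primrec i) :
    Primrec (fun x => tupleSrc (u x) (s x) (t x) (n x) (κ x) (i x)) := by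
  unfold tupleSrc
  fun_prop

@[fun_prop] theorem primrec_tupleRead {u : α → List Bool} {s t n κ : α → ℕ} (hu : Primrec u)
    (hs : Primrec s) (ht : Primrec t) (hn : Primrec n) (hκ : Primrec κ) :
    Primrec (fun x => tupleRead (u x) (s x) (t x) (n x) (κ x)) := by
  unfold tupleRead
  fun_prop

@[fun_prop] theorem primrec_pairsSrc {u : α → List Bool} {n κ e : α → ℕ} (hu : Primrec u)
    (hn : Primrec n) (hκ : Primrec κ) (he : Primrec e) :
    Primrec (fun x => pairsSrc (u x) (n x) (κ x) (e x)) := by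
  unfold pairsSrc
  fun_prop

@[fun_prop] theorem primrec_pairsRead {u : α → List Bool} {n κ : α → ℕ} (hu : Primrec u)
    (hn : Primrec n) (hκ : Primrec κ) :
    Primrec (fun x => pairsRead (u x) (n x) (κ x)) := by
  unfold pairsRead
  fun_prop

end Primitive

/-- The extension of a matrix by zeros. -/
def zeroExt {n m : ℕ} (M : Matrix (Fin n) (Fin m) ℝ) (i j : ℕ) : ℝ :=
  if h : i < n ∧ j < m then M ⟨i, h.1⟩ ⟨j, h.2⟩ else 0

theorem zeroExt_val {n m : ℕ} (M : Matrix (Fin n) (Fin m) ℝ) (i : Fin n) (j : Fin m) :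
    zeroExt M i j = M i j := dif_pos ⟨i.2, j.2⟩

theorem exists_matSrc {p : Cantor} {s t n m : ℕ} {M : Matrix (Fin n) (Fin m) ℝ}
    (h : Represented.IsName (fun k => p (s + t * k)) (⟨n, m, M⟩ : RealMatrix)) :
    ∃ ball : ℕ → ℕ → ℕ → ℕ, (∀ i j, Approx (fun κ => ball κ i j) (zeroExt M i j)) ∧
      (∀ T κ, matRead (prefixOf p T) s t n m κ = true →
        ∀ i j, matSrc (prefixOf p T) s t n m κ i j = ball κ i j) ∧
      (∀ κ, ∀ i < n, ∀ j < m, rad (ball κ i j) = (1 / 2 : ℝ) ^ κ) ∧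
      ∀ κ, ∃ T₀, ∀ T ≥ T₀, matRead (prefixOf p T) s t n m κ = true := by
  have hM := (RealMatrix.name_entry h).2.2
  obtain ⟨ball, h1, h2, h3, h4⟩ := exists_readBalls (p := p)
    (Finset.range n ×ˢ Finset.range m) (fun z => entryStart s t n m z.1 z.2)
    (fun _ => t * (n * m)) (fun z => zeroExt M z.1 z.2) (by
      rintro ⟨i, j⟩ hz
      simp only [Finset.mem_product, Finset.mem_range] at hz
      simpa only [zeroExt, dif_pos hz] using hM ⟨i, hz.1⟩ ⟨j, hz.2⟩)
  simp only [Finset.mem_product, Finset.mem_range, Prod.forall] at h1 h2 h3 h4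
  have hread : ∀ T κ, matRead (prefixOf p T) s t n m κ = true ↔ ∀ i j, i < n ∧ j < m →
      readOk (prefixOf p T) (entryStart s t n m i j) (t * (n * m)) κ = true := by
    intro T κ
    simp only [matRead, allBelow_eq_true]
    exact ⟨fun h i j hij => h i hij.1 j hij.2, fun h i hi j hj => h i j ⟨hi, hj⟩⟩
  refine ⟨fun κ i j => ball κ (i, j), fun i j => ?_, fun T κ hT i j => ?_,
    fun κ i hi j hj => h3 κ i j ⟨hi, hj⟩, fun κ => ?_⟩
  · have := h1 i j
    split_ifs at this with hij
    · exact this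
    · rwa [zeroExt, dif_neg hij]
  · have := h2 T κ ((hread T κ).1 hT) i j
    rwa [ite_and] at this
  · obtain ⟨T₀, hT₀⟩ := h4 κ
    exact ⟨T₀, fun T hT => (hread T κ).2 (hT₀ T hT)⟩

theorem exists_tupleSrc {p : Cantor} {s t n : ℕ} {z : Fin n → Set.Icc (0 : ℝ) 1}
    (h : Represented.IsName (fun k => p (s + t * k))
      (⟨n, z⟩ : Σ n : ℕ, (Fin n → Set.Icc (0 : ℝ) 1))) :
    ∃ ball : ℕ → ℕ → ℕ,
      (∀ i, Approx (fun κ => ball κ i) (if h : i < n then (z ⟨i, h⟩ : ℝ) else 0)) ∧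
      (∀ T κ, tupleRead (prefixOf p T) s t n κ = true →
        ∀ i, tupleSrc (prefixOf p T) s t n κ i = ball κ i) ∧
      ∀ κ, ∃ T₀, ∀ T ≥ T₀, tupleRead (prefixOf p T) s t n κ = true := by
  obtain ⟨ball, h1, h2, h3, h4⟩ := exists_readBalls (p := p)
    (Finset.range n) (fun i => s + t * (n + 1 + i))
    (fun _ => t * n) (fun i => if h : i < n then (z ⟨i, h⟩ : ℝ) else 0) (by
      intro i hi
      have hi := Finset.mem_range.1 hi
      simpa only [dif_pos hi] using (tuple_name_entry h).2 ⟨i, hi⟩)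
  simp only [Finset.mem_range] at h1 h2 h3 h4
  simp only [tupleRead, allBelow_eq_true]
  refine ⟨ball, fun i => ?_, h2, h4⟩
  have := h1 i
  split_ifs at this ⊢ with hi <;> exact this

/-- The number `e % 2` of the pair `e / 2`. -/
def pairsVal {n : ℕ} (x : Fin n → ℝ × ℝ) (e : ℕ) : ℝ :=
  if h : e < 2 * n then
    if e % 2 = 0 then (x ⟨e / 2, by omega⟩).1 else (x ⟨e / 2, by omega⟩).2 else 0

theorem exists_pairsSrc {p : Cantor} {n : ℕ} {x : Fin n → ℝ × ℝ}
    (h : Represented.IsName p (⟨n, x⟩ : Σ n : ℕ, (Fin n → ℝ × ℝ))) :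
    ∃ ball : ℕ → ℕ → ℕ, (∀ e, Approx (fun κ => ball κ e) (pairsVal x e)) ∧
      (∀ T κ, pairsRead (prefixOf p T) n κ = true →
        ∀ e, pairsSrc (prefixOf p T) n κ e = ball κ e) ∧
      ∀ κ, ∃ T₀, ∀ T ≥ T₀, pairsRead (prefixOf p T) n κ = true := by
  obtain ⟨ball, h1, h2, h3, h4⟩ := exists_readBalls (p := p)
    (Finset.range (2 * n)) (fun e => n + 1 + n * (e % 2) + e / 2)
    (fun _ => 2 * n) (pairsVal x) (by
      intro e he
      have he := Finset.mem_range.1 he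
      have h0 := (pairs_name_entry h).2 ⟨e / 2, by omega⟩
      simp only [pairsVal, dif_pos he]
      split_ifs with h2
      · simpa only [h2, mul_zero, add_zero] using h0.1
      · simpa only [show e % 2 = 1 by omega, mul_one] using h0.2)
  simp only [Finset.mem_range] at h1 h2 h3 h4
  simp only [pairsRead, allBelow_eq_true]
  refine ⟨ball, fun e => ?_, h2, h4⟩
  have := h1 e
  split_ifs at this with he
  · exact this
  · rwa [pairsVal, dif_neg he]

theorem Approx.shift {b : ℕ → ℕ} {x : ℝ} (h : Approx b x) (a : ℕ) :
    Approx (fun κ => b (κ + a)) x :=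
  ⟨fun κ => h.le (κ + a), h.lim.comp (tendsto_add_atTop_nat a)⟩

/-! ### Robust divisions from one LU-decomposition -/

/-- The weight of row `r`: the rows `2 i` and `2 i + 1` carry the denominator and the numerator of
the `i`-th robust division. -/
def rowWeight (X : ℕ → ℝ) (r : ℕ) : ℝ :=
  if r % 2 = 0 then |X (2 * (r / 2) + 1)| else min |X (2 * (r / 2))| |X (2 * (r / 2) + 1)|

/-- The matrix with two multiples of each row of a Cauchy matrix. -/
noncomputable def cauchyRows (N : ℕ) (X : ℕ → ℝ) : Matrix (Fin (2 * N)) (Fin N) ℝ :=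
  Matrix.of fun r c => rowWeight X r * (((r / 2 : ℕ) : ℝ) + (c : ℕ) + 1)⁻¹

/-- The program producing the name of `cauchyRows`. -/
def cauchyProgram : Program where
  hd u d := okAt u 0 1 && decide (nxt u 0 1 = d)
  dn u d κ := pairsRead u d κ
  bl u d κ j := bmul
    (if j.unpair.2.unpair.1 % 2 = 0 then babs (pairsSrc u d κ (2 * (j.unpair.2.unpair.1 / 2) + 1))
      else bmin (babs (pairsSrc u d κ (2 * (j.unpair.2.unpair.1 / 2))))
        (babs (pairsSrc u d κ (2 * (j.unpair.2.unpair.1 / 2) + 1))))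
    (bconst (mkQ 1 0 (j.unpair.2.unpair.1 / 2 + j.unpair.2.unpair.2 + 1)))
  lay d pos := matLay 0 (2 * d) d pos
  primrec_hd := by fun_prop
  primrec_dn := by fun_prop
  primrec_bl := by fun_prop
  primrec_lay := by fun_prop

theorem exists_ok_of_startsWith {p : Cantor} {s t n : ℕ} (h : StartsWith p s t n) :
    ∃ T₀, ∀ T ≥ T₀, okAt (prefixOf p T) s t = true :=
  ⟨s + t * n + n + 1, fun T hT => okAt_of_lt h (by omega) (by omega)⟩

theorem cauchyProgram_spec {p : Cantor} {N : ℕ} {x : Fin N → ℝ × ℝ}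
    (h : Represented.IsName p (⟨N, x⟩ : Σ n : ℕ, (Fin n → ℝ × ℝ))) :
    ∃ o, Produces cauchyProgram.run p o ∧
      Represented.IsName o (⟨2 * N, N, cauchyRows N (pairsVal x)⟩ : RealMatrix) := by
  have hN := (pairs_name_entry h).1
  have hd : ∀ t d, cauchyProgram.hd (prefixOf p t) d = true → d = N := by
    intro t d htd
    simp only [cauchyProgram, Bool.and_eq_true, decide_eq_true_eq] at htd
    rw [← htd.2, nxt_eq hN htd.1]
  obtain ⟨o, t, d, htd, ho, r, hr, hor⟩ := cauchyProgram.run_spec (p := p)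
    (fun _ j => rowWeight (pairsVal x) j.unpair.2.unpair.1
      * (((j.unpair.2.unpair.1 / 2 : ℕ) : ℝ) + j.unpair.2.unpair.2 + 1)⁻¹) (by
      obtain ⟨T, hT⟩ := exists_ok_of_startsWith hN
      refine ⟨T, N, ?_⟩
      simp only [cauchyProgram, Bool.and_eq_true, decide_eq_true_eq]
      exact ⟨hT T le_rfl, nxt_eq hN (hT T le_rfl)⟩) (by
      intro t d htd
      obtain rfl := hd t d htd
      obtain ⟨ball, h1, h2, h3⟩ := exists_pairsSrc h
      refine ⟨fun κ j => bmul
        (if j.unpair.2.unpair.1 % 2 = 0 then babs (ball κ (2 * (j.unpair.2.unpair.1 / 2) + 1))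
          else bmin (babs (ball κ (2 * (j.unpair.2.unpair.1 / 2))))
            (babs (ball κ (2 * (j.unpair.2.unpair.1 / 2) + 1))))
        (bconst (mkQ 1 0 (j.unpair.2.unpair.1 / 2 + j.unpair.2.unpair.2 + 1))),
        fun T κ j hT => ?_, fun κ => ?_, fun j => ?_⟩
      · simp only [cauchyProgram, h2 T κ hT]
      · obtain ⟨T, hT⟩ := h3 κ
        exact ⟨T, hT T le_rfl⟩
      · dsimp only
        refine Approx.mul ?_ ?_
        · unfold rowWeight
          split_ifs
          · exact (h1 _).abs_ball
          · exact (h1 _).abs_ball.min_ball (h1 _).abs_ball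
        · convert Approx.const using 1
          rw [nuQ_mkQ _ _ (by omega)]
          push_cast
          ring)
  obtain rfl := hd t d htd
  refine ⟨o, ho, RealMatrix.isName_of_layout (tag := 0) hor fun i j => ?_⟩
  have := hr (Nat.pair 0 (Nat.pair i j))
  simp only [Nat.unpair_pair] at this
  exact this

/-- The position of the row `i` in a permutation matrix. -/
def rowPos (u : List Bool) (s t n κ i : ℕ) : ℕ :=
  firstIdx n fun k => qlt (qhalf 1) (matSrc u s t n n κ k i).unpair.1

@[fun_prop] theorem primrec_rowPos {α : Type} [Primcodable α] {u : α → List Bool}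
    {s t n κ i : α → ℕ} (hu : Primrec u)
    (hs : Primrec s) (ht : Primrec t) (hn : Primrec n) (hκ : Primrec κ)
    (hi : Primrec i) :
    Primrec (fun x => rowPos (u x) (s x) (t x) (n x) (κ x) (i x)) := by
  unfold rowPos
  fun_prop

/-- The program recovering the quotients from an LU-decomposition of `cauchyRows`. -/
def quotientProgram : Program where
  hd u d := okAt u 0 2 && decide (nxt u 0 2 = d)
  dn u d κ := matRead u 1 4 (2 * d) (2 * d) (κ + 2) &&
    matRead u 15 16 (2 * d) (2 * d) (κ + 2)
  bl u d κ j := if j < d then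
      if rowPos u 1 4 (2 * d) (κ + 2) (2 * j) < rowPos u 1 4 (2 * d) (κ + 2) (2 * j + 1) then
        bclamp (matSrc u 15 16 (2 * d) (2 * d) (κ + 2) (rowPos u 1 4 (2 * d) (κ + 2) (2 * j + 1))
          (rowPos u 1 4 (2 * d) (κ + 2) (2 * j)))
      else binvMax (matSrc u 15 16 (2 * d) (2 * d) (κ + 2) (rowPos u 1 4 (2 * d) (κ + 2) (2 * j))
          (rowPos u 1 4 (2 * d) (κ + 2) (2 * j + 1)))
    else 0
  lay d pos := tupleLay d pos
  primrec_hd := by fun_prop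
  primrec_dn := by fun_prop
  primrec_bl := by fun_prop
  primrec_lay := by fun_prop

theorem rowPos_eq {p : Cantor} {s t n : ℕ} {σ : Equiv.Perm (Fin n)}
    (h : Represented.IsName (fun k => p (s + t * k)) (⟨n, n, σ.permMatrix ℝ⟩ : RealMatrix))
    {T κ : ℕ} (hκ : 2 ≤ κ) (hT : matRead (prefixOf p T) s t n n κ = true) (i : Fin n) :
    rowPos (prefixOf p T) s t n κ i = σ.symm i := by
  obtain ⟨ball, h1, h2, h3, -⟩ := exists_matSrc h
  have key : ∀ k : Fin n, qlt (qhalf 1) (matSrc (prefixOf p T) s t n n κ k i).unpair.1 = true ↔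
      σ k = i := by
    intro k
    rw [qlt_iff, h2 T κ hT, ← Rat.cast_lt (K := ℝ), cast_qhalf, pow_one]
    change 1 / 2 < cen (ball κ k i) ↔ _
    have h4 := (h1 k i).le κ
    rw [h3 κ k k.2 i i.2, zeroExt_val] at h4
    have h5 : (1 / 2 : ℝ) ^ κ ≤ (1 / 2 : ℝ) ^ 2 :=
      pow_le_pow_of_le_one (by norm_num) (by norm_num) hκ
    have h6 := abs_le.1 (h4.trans h5)
    by_cases hk : σ k = i
    · simp only [Equiv.Perm.permMatrix, PEquiv.toMatrix_apply, Equiv.toPEquiv_apply, hk,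
        Option.mem_def, if_true] at h6
      simp only [hk, iff_true]
      linarith [h6.1]
    · simp only [Equiv.Perm.permMatrix, PEquiv.toMatrix_apply, Equiv.toPEquiv_apply,
        Option.mem_def, Option.some.injEq, hk, if_false] at h6
      simp only [hk, iff_false]
      linarith [h6.2]
  refine firstIdx_eq (σ.symm i).2 ?_ fun j hj => ?_
  · exact (key (σ.symm i)).2 (by simp)
  · have hjn : j < n := hj.trans (σ.symm i).2
    rw [← Bool.not_eq_true]
    intro hc
    have := (key ⟨j, hjn⟩).1 hc
    rw [← this] at hj
    simp at hj

/-- The number recovered from the lower triangular matrix. -/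
noncomputable def quotVal {n : ℕ} (σ : Equiv.Perm (Fin n)) (L : Matrix (Fin n) (Fin n) ℝ)
    (a b : Fin n) : ℝ :=
  if (σ.symm a : ℕ) < σ.symm b then min (max (L (σ.symm b) (σ.symm a)) 0) 1
  else (max (L (σ.symm a) (σ.symm b)) 1)⁻¹

theorem quotVal_mem {n : ℕ} (σ : Equiv.Perm (Fin n)) (L : Matrix (Fin n) (Fin n) ℝ)
    (a b : Fin n) : quotVal σ L a b ∈ Set.Icc (0 : ℝ) 1 := by
  unfold quotVal
  split_ifs
  · exact ⟨le_min (le_max_right _ _) zero_le_one, min_le_right _ _⟩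
  · exact ⟨by positivity, inv_le_one_of_one_le₀ (le_max_right _ _)⟩

theorem quotVal_eq {N : ℕ} {X : ℕ → ℝ} {σ : Equiv.Perm (Fin (2 * N))}
    {Q : Matrix (Fin N) (Fin N) ℝ} {U : Matrix (Fin (2 * N)) (Fin N) ℝ}
    {L : Matrix (Fin (2 * N)) (Fin (2 * N)) ℝ}
    (h : IsLUDecomp (cauchyRows N X) (σ.permMatrix ℝ) Q U L) {i : ℕ} (hi : i < N)
    (hy : X (2 * i + 1) ≠ 0) :
    quotVal σ L ⟨2 * i, by omega⟩ ⟨2 * i + 1, by omega⟩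
      = min |X (2 * i)| |X (2 * i + 1)| / |X (2 * i + 1)| := by
  obtain ⟨τ, rfl⟩ := h.perm_right
  set a : Fin (2 * N) := ⟨2 * i, by omega⟩ with ha
  set b : Fin (2 * N) := ⟨2 * i + 1, by omega⟩ with hb
  have hB : ∀ k j, (L * U) k j
      = rowWeight X (σ k) * ((((σ k : ℕ) / 2 : ℕ) : ℝ) + (τ.symm j : ℕ) + 1)⁻¹ := by
    intro k j
    rw [← h.eq, Matrix.mul_apply, Finset.sum_eq_single (τ.symm j)]
    · rw [permMatrix_mul_apply]
      simp [Equiv.Perm.permMatrix, PEquiv.toMatrix_apply, cauchyRows]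
    · intro l _ hl
      have : τ l ≠ j := fun e => hl (by rw [← e, Equiv.symm_apply_apply])
      simp [Equiv.Perm.permMatrix, PEquiv.toMatrix_apply, this]
    · simp
  have hwa : rowWeight X (σ (σ.symm a)) = |X (2 * i + 1)| := by
    rw [Equiv.apply_symm_apply, rowWeight, if_pos (by simp [ha])]
    congr 3
    simp [ha]
  have hwb : rowWeight X (σ (σ.symm b)) = min |X (2 * i)| |X (2 * i + 1)| := by
    have e : (b : ℕ) / 2 = i := by
      rw [hb]
      dsimp only
      omega
    rw [Equiv.apply_symm_apply, rowWeight, if_neg (by simp [hb, Nat.add_mod]), e]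
  have hy' : 0 < |X (2 * i + 1)| := abs_pos.2 hy
  have hna : rowWeight X (σ (σ.symm a)) ≠ 0 := by
    rw [hwa]
    exact hy'.ne'
  have hblk : ∀ k, (σ k : ℕ) / 2 = i → k = σ.symm a ∨ k = σ.symm b := by
    intro k hk
    rcases Nat.mod_two_eq_zero_or_one (σ k) with h0 | h0
    · left
      rw [Equiv.eq_symm_apply, Fin.ext_iff, ha]
      dsimp only
      omega
    · right
      rw [Equiv.eq_symm_apply, Fin.ext_iff, hb]
      dsimp only
      omega
  have hba : ((σ (σ.symm a) : Fin (2 * N)) : ℕ) / 2 = i := by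
    rw [Equiv.apply_symm_apply, ha]
    dsimp only
    omega
  have hbb : ((σ (σ.symm b) : Fin (2 * N)) : ℕ) / 2 = i := by
    rw [Equiv.apply_symm_apply, hb]
    dsimp only
    omega
  have hcinj : Function.Injective fun j : Fin N => (τ.symm j : ℕ) :=
    Fin.val_injective.comp τ.symm.injective
  have hne : σ.symm a ≠ σ.symm b := by
    rw [Ne, Equiv.apply_eq_iff_eq, ha, hb, Fin.ext_iff]
    dsimp only
    omega
  unfold quotVal
  split_ifs with hlt
  · obtain ⟨-, h2⟩ := ratio_of_LU (β := fun k => rowWeight X (σ k))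
      (blk := fun k => (σ k : ℕ) / 2) hcinj (fun k => by have := (σ k).2; omega) h.upper h.lower
      h.diag hB (Fin.lt_def.2 hlt) (by rw [hba, hbb]) (by rw [hba]; exact hblk) (Or.inl hna)
    rw [hwa, hwb] at h2
    have h3 : L (σ.symm b) (σ.symm a) = min |X (2 * i)| |X (2 * i + 1)| / |X (2 * i + 1)| := by
      rw [h2, mul_div_cancel_right₀ _ hy'.ne']
    rw [h3, max_eq_left (by positivity), min_eq_left]
    exact (div_le_one hy').2 (min_le_right _ _)
  · have hlt' : σ.symm b < σ.symm a := lt_of_le_of_ne (not_lt.1 hlt) hne.symm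
    obtain ⟨h1, h2⟩ := ratio_of_LU (β := fun k => rowWeight X (σ k))
      (blk := fun k => (σ k : ℕ) / 2) hcinj (fun k => by have := (σ k).2; omega) h.upper h.lower
      h.diag hB hlt' (by rw [hba, hbb]) (by rw [hbb]; exact fun k hk => (hblk k hk).symm)
      (Or.inr hna)
    rw [hwb] at h1
    rw [hwa, hwb] at h2
    have hpos : 0 < min |X (2 * i)| |X (2 * i + 1)| :=
      lt_of_le_of_ne (by positivity) h1.symm
    have h3 : L (σ.symm a) (σ.symm b) = |X (2 * i + 1)| / min |X (2 * i)| |X (2 * i + 1)| := by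
      rw [eq_div_iff hpos.ne', ← h2]
    rw [h3, max_eq_left, inv_div]
    exact (one_le_div hpos).2 (min_le_right _ _)

/-- Robust divisions reduce to every total problem whose solutions are LU-decompositions. -/
theorem finStar_rDiv_le
    (g : RealMatrix → Set (RealMatrix × RealMatrix × RealMatrix × RealMatrix))
    (hne : ∀ A, (g A).Nonempty) (hg : ∀ A, g A ⊆ luDecompPQ A) : WLE (finStar rDiv) g := by
  refine WLE.of_programs cauchyProgram quotientProgram ?_
  rintro p ⟨N, x⟩ hp -
  obtain ⟨o, ho, hon⟩ := cauchyProgram_spec hp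
  refine ⟨o, _, ho, hon, hne _, ?_⟩
  intro q v hv hq
  obtain ⟨P, Q, U, L, hLU, rfl⟩ : ∃ (P : Matrix (Fin (2 * N)) (Fin (2 * N)) ℝ)
      (Q : Matrix (Fin N) (Fin N) ℝ) (U : Matrix (Fin (2 * N)) (Fin N) ℝ)
      (L : Matrix (Fin (2 * N)) (Fin (2 * N)) ℝ),
      IsLUDecomp (cauchyRows N (pairsVal x)) P Q U L ∧
        v = (⟨2 * N, 2 * N, P⟩, ⟨N, N, Q⟩, ⟨2 * N, N, U⟩, ⟨2 * N, 2 * N, L⟩) := hg _ hv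
  obtain ⟨σ, rfl⟩ := hLU.perm_left
  obtain ⟨hqP, -, -, hqL⟩ := hq
  have hN : StartsWith (join p q) 0 2 N := by
    obtain ⟨h1, h2⟩ := (pairs_name_entry hp).1
    simp only [zero_add, one_mul] at h1 h2
    refine ⟨fun k hk => ?_, ?_⟩
    · rw [zero_add, join_even, h1 k hk]
    · rw [zero_add, join_even, h2]
  have hP : Represented.IsName (fun k => join p q (1 + 4 * k))
      (⟨2 * N, 2 * N, σ.permMatrix ℝ⟩ : RealMatrix) := by
    convert hqP using 1
    funext k
    rw [show 1 + 4 * k = 2 * (2 * k) + 1 by ring, join_odd]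
    rfl
  have hL : Represented.IsName (fun k => join p q (15 + 16 * k))
      (⟨2 * N, 2 * N, L⟩ : RealMatrix) := by
    convert hqL using 1
    funext k
    rw [show 15 + 16 * k = 2 * (2 * (2 * (2 * k + 1) + 1) + 1) + 1 by ring, join_odd]
    rfl
  have hd : ∀ t d, quotientProgram.hd (prefixOf (join p q) t) d = true → d = N := by
    intro t d htd
    simp only [quotientProgram, Bool.and_eq_true, decide_eq_true_eq] at htd
    rw [← htd.2, nxt_eq hN htd.1]
  obtain ⟨o', t, d, htd, ho', r, hr, hor⟩ := quotientProgram.run_spec (p := join p q)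
    (fun _ j => if h : j < N then
      quotVal σ L ⟨2 * j, by omega⟩ ⟨2 * j + 1, by omega⟩ else 0) (by
      obtain ⟨T, hT⟩ := exists_ok_of_startsWith hN
      refine ⟨T, N, ?_⟩
      simp only [quotientProgram, Bool.and_eq_true, decide_eq_true_eq]
      exact ⟨hT T le_rfl, nxt_eq hN (hT T le_rfl)⟩) (by
      intro t d htd
      obtain rfl := hd t d htd
      obtain ⟨-, -, -, -, h3⟩ := exists_matSrc hP
      obtain ⟨ball, g1, g2, -, g3⟩ := exists_matSrc hL
      refine ⟨fun κ j => if h : j < d then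
        if (σ.symm ⟨2 * j, by omega⟩ : ℕ) < σ.symm ⟨2 * j + 1, by omega⟩ then
          bclamp (ball (κ + 2) (σ.symm ⟨2 * j + 1, by omega⟩) (σ.symm ⟨2 * j, by omega⟩))
        else binvMax (ball (κ + 2) (σ.symm ⟨2 * j, by omega⟩) (σ.symm ⟨2 * j + 1, by omega⟩))
        else 0, fun T κ j hT => ?_, fun κ => ?_, fun j => ?_⟩
      · simp only [quotientProgram, Bool.and_eq_true] at hT ⊢
        obtain ⟨hT1, hT2⟩ := hT
        by_cases hj : j < d
        · rw [if_pos hj, dif_pos hj]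
          have e1 := rowPos_eq hP (by omega) hT1 ⟨2 * j, by omega⟩
          have e2 := rowPos_eq hP (by omega) hT1 ⟨2 * j + 1, by omega⟩
          dsimp only at e1 e2
          rw [e1, e2, g2 T (κ + 2) hT2, g2 T (κ + 2) hT2]
        · rw [if_neg hj, dif_neg hj]
      · obtain ⟨T₁, hT₁⟩ := h3 (κ + 2)
        obtain ⟨T₂, hT₂⟩ := g3 (κ + 2)
        refine ⟨max T₁ T₂, ?_⟩
        simp only [quotientProgram, Bool.and_eq_true]
        exact ⟨hT₁ _ (le_max_left _ _), hT₂ _ (le_max_right _ _)⟩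
      · by_cases hj : j < d
        · simp only [dif_pos hj, quotVal]
          split_ifs
          · have := g1 (σ.symm ⟨2 * j + 1, by omega⟩) (σ.symm ⟨2 * j, by omega⟩)
            rw [zeroExt_val] at this
            exact (this.shift 2).clamp
          · have := g1 (σ.symm ⟨2 * j, by omega⟩) (σ.symm ⟨2 * j + 1, by omega⟩)
            rw [zeroExt_val] at this
            exact (this.shift 2).invMax
        · simp only [dif_neg hj]
          exact Approx.zero)
  obtain rfl := hd t d htd
  refine ⟨o', ⟨d, fun i => ⟨_, quotVal_mem σ L ⟨2 * i, by omega⟩ ⟨2 * i + 1, by omega⟩⟩⟩, ho',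
    ⟨_, ?_, rfl⟩, tuple_isName_of_layout hor fun i => ?_⟩
  · intro i hy
    have hi : (i : ℕ) < d := i.2
    have e1 : pairsVal x (2 * i) = (x i).1 := by
      rw [pairsVal, dif_pos (by omega), if_pos (by omega)]
      congr 3
      omega
    have e2 : pairsVal x (2 * i + 1) = (x i).2 := by
      rw [pairsVal, dif_pos (by omega), if_neg (by omega)]
      congr 3
      omega
    have := quotVal_eq hLU i.2 (by rwa [e2])
    rwa [e1, e2] at this
  · have := hr i
    rwa [dif_pos i.2] at this

/-! ### Codes of queries -/

/-- The row of the `a`-th pivot on the path of length `l` with code `E`. -/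
def pathRow (b l E a : ℕ) : ℕ := E / b ^ (2 * (l - 1 - a) + 1) % b

/-- The column of the `a`-th pivot on the path of length `l` with code `E`. -/
def pathCol (b l E a : ℕ) : ℕ := E / b ^ (2 * (l - 1 - a)) % b

/-- The digit telling whether the row `i` is admitted. -/
def maskOf (b E₀ i : ℕ) : ℕ := E₀ / b ^ (i + 1) % b

/-- The code of the query for the entry `(i, j)` after the first `l` steps of the path `E`. -/
def queryCode (n b E l i j : ℕ) : ℕ := ((E * (n + 1) + l) * b + i) * b + j

def queryCount (n b : ℕ) : ℕ := b ^ (1 + n + 2 * n) * (n + 1) * b * b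

theorem mul_add_lt_mul {x X y Y : ℕ} (hx : x < X) (hy : y < Y) : x * Y + y < X * Y :=
  calc x * Y + y < x * Y + Y := by omega
    _ = (x + 1) * Y := by ring
    _ ≤ X * Y := Nat.mul_le_mul_right _ hx

theorem queryCode_lt {n b E l i j : ℕ} (hE : E < b ^ (1 + n + 2 * n)) (hl : l ≤ n) (hi : i < b)
    (hj : j < b) : queryCode n b E l i j < queryCount n b :=
  mul_add_lt_mul (mul_add_lt_mul (mul_add_lt_mul hE (Nat.lt_succ_of_le hl)) hi) hj

theorem mul_add_div_eq {x y Y : ℕ} (hy : y < Y) : (x * Y + y) / Y = x := by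
  rw [mul_comm, Nat.mul_add_div (by omega), Nat.div_eq_of_lt hy, add_zero]

theorem mul_add_mod_eq {x y Y : ℕ} (hy : y < Y) : (x * Y + y) % Y = y := by
  rw [mul_comm, Nat.mul_add_mod, Nat.mod_eq_of_lt hy]

/-- The matrix with the rows that are not admitted replaced by zero. -/
def maskRows (b E₀ : ℕ) (A : ℕ → ℕ → ℝ) (i j : ℕ) : ℝ := if maskOf b E₀ i = 0 then 0 else A i j

/-- The result of the elimination along a path. -/
def queryMat (A : ℕ → ℕ → ℝ) (b E l : ℕ) : ℕ → ℕ → ℝ :=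
  elim (maskRows b (E / b ^ (2 * l)) A) (pathRow b l E) (pathCol b l E) l

def queryMass (A : ℕ → ℕ → ℝ) (n b E l : ℕ) : ℝ := mass n (E / b ^ (2 * l) % b) (queryMat A b E l)

/-- The instance of robust division with the code `e`. -/
def queryPair (A : ℕ → ℕ → ℝ) (n b e : ℕ) : ℝ × ℝ :=
  (queryMat A b (e / b / b / (n + 1)) (e / b / b % (n + 1)) (e / b % b) (e % b)
      + queryMass A n b (e / b / b / (n + 1)) (e / b / b % (n + 1)),
    queryMass A n b (e / b / b / (n + 1)) (e / b / b % (n + 1))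
      + queryMass A n b (e / b / b / (n + 1)) (e / b / b % (n + 1)))

theorem queryPair_queryCode (A : ℕ → ℕ → ℝ) {n b E l i j : ℕ} (hl : l ≤ n) (hi : i < b)
    (hj : j < b) : queryPair A n b (queryCode n b E l i j)
      = (queryMat A b E l i j + queryMass A n b E l,
        queryMass A n b E l + queryMass A n b E l) := by
  have e1 : queryCode n b E l i j % b = j := mul_add_mod_eq hj
  have e2 : queryCode n b E l i j / b = (E * (n + 1) + l) * b + i := mul_add_div_eq hj
  unfold queryPair
  rw [e1, e2, mul_add_mod_eq hi, mul_add_div_eq hi, mul_add_mod_eq (Nat.lt_succ_of_le hl),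
    mul_add_div_eq (Nat.lt_succ_of_le hl)]

/-- The quotient in `[-1, 1]` given by the answer to a query. -/
def ansVal (z : ℕ → ℝ) (n b E₀ E l i j : ℕ) : ℝ :=
  if maskOf b E₀ i = 0 then 0
  else z (queryCode n b E l i j) + z (queryCode n b E l i j) - 1

/-- The answers along a path. -/
def pathAns (z : ℕ → ℝ) (n b len E l i j : ℕ) : ℝ :=
  ansVal z n b (E / b ^ (2 * len)) (E / b ^ (2 * (len - l))) l i j

/-- The vector found by back substitution along a path. -/
def pathVec (z : ℕ → ℝ) (n b len E i₀ : ℕ) : ℕ → ℝ :=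
  backSub n (pathAns z n b len E) (pathRow b len E) (pathCol b len E) len i₀ len

/-- The mass of the answers at the end of a path. -/
def pathMass (z : ℕ → ℝ) (n b k len E : ℕ) : ℝ :=
  freeMass n k (pathRow b len E) (pathCol b len E) len (pathAns z n b len E len)

/-- The combinatorial conditions on a path for the columns below `k` and the unused rows. -/
def pivotOk (n b k : ℕ) (used : ℕ → Bool) (len E i₀ : ℕ) : Bool :=
  decide (i₀ < n) && (!decide (maskOf b (E / b ^ (2 * len)) i₀ = 0) && (decide (len ≤ n) &&
    (decide (E < b ^ (1 + n + 2 * n)) && (decide (E / b ^ (2 * len) % b = k) &&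
    ((allBelow n fun i => if used i = true then decide (maskOf b (E / b ^ (2 * len)) i = 0)
      else !decide (maskOf b (E / b ^ (2 * len)) i = 0)) &&
    allBelow len fun l => !decide (maskOf b (E / b ^ (2 * len)) (pathRow b len E l) = 0) &&
      (decide (pathRow b len E l < n) && decide (pathCol b len E l < k)))))))

theorem pivotOk_iff {n b k : ℕ} {used : ℕ → Bool} {len E i₀ : ℕ} :
    pivotOk n b k used len E i₀ = true ↔ i₀ < n ∧ maskOf b (E / b ^ (2 * len)) i₀ ≠ 0 ∧ len ≤ n ∧
      E < b ^ (1 + n + 2 * n) ∧ E / b ^ (2 * len) % b = k ∧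
      (∀ i < n, used i = true ↔ maskOf b (E / b ^ (2 * len)) i = 0) ∧
      ∀ l < len, maskOf b (E / b ^ (2 * len)) (pathRow b len E l) ≠ 0 ∧
        pathRow b len E l < n ∧ pathCol b len E l < k := by
  simp only [pivotOk, Bool.and_eq_true, decide_eq_true_eq, Bool.not_eq_true',
    decide_eq_false_iff_not, allBelow_eq_true]
  refine and_congr_right fun _ => and_congr_right fun _ => and_congr_right fun _ =>
    and_congr_right fun _ => and_congr_right fun _ => and_congr_left fun _ =>
    forall₂_congr fun i _ => ?_
  split_ifs with h <;> simp [h]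

theorem elim_congr {A : ℕ → ℕ → ℝ} {I J I' J' : ℕ → ℕ} {l : ℕ} (hI : ∀ a < l, I a = I' a)
    (hJ : ∀ a < l, J a = J' a) : elim A I J l = elim A I' J' l := by
  induction l with
  | zero => rfl
  | succ l ih =>
    funext i j
    simp only [elim, ih (fun a ha => hI a (by omega)) (fun a ha => hJ a (by omega)),
      hI l (by omega), hJ l (by omega)]

theorem elim_maskRows {A : ℕ → ℕ → ℝ} {I J : ℕ → ℕ} {b E₀ i : ℕ} (h : maskOf b E₀ i = 0)
    (l j : ℕ) : elim (maskRows b E₀ A) I J l i j = 0 := by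
  induction l generalizing j with
  | zero => simp [elim, maskRows, h]
  | succ l ih => simp [elim, ih]

theorem div_pow_div_pow (b E : ℕ) {c d e : ℕ} (h : c + d = e) :
    E / b ^ c / b ^ d = E / b ^ e := by
  rw [Nat.div_div_eq_div_mul, ← pow_add, h]

theorem queryMat_prefix (A : ℕ → ℕ → ℝ) (b E : ℕ) {l len : ℕ} (hl : l ≤ len) :
    queryMat A b (E / b ^ (2 * (len - l))) l
      = elim (maskRows b (E / b ^ (2 * len)) A) (pathRow b len E) (pathCol b len E) l := by
  unfold queryMat
  rw [div_pow_div_pow b E (e := 2 * len) (by omega)]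
  refine elim_congr (fun a ha => ?_) fun a ha => ?_
  · rw [pathRow, div_pow_div_pow b E (e := 2 * (len - 1 - a) + 1) (by omega)]
    rfl
  · rw [pathCol, div_pow_div_pow b E (e := 2 * (len - 1 - a)) (by omega)]
    rfl

theorem abs_le_mass {n k : ℕ} (B : ℕ → ℕ → ℝ) {i j : ℕ} (hi : i < n) (hj : j < k) :
    |B i j| ≤ mass n k B := by
  have h1 := Finset.single_le_sum (f := fun i => ∑ j ∈ Finset.range k, |B i j|)
    (fun i _ => Finset.sum_nonneg fun j _ => abs_nonneg _) (Finset.mem_range.2 hi)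
  have h2 := Finset.single_le_sum (f := fun j => |B i j|) (fun j _ => abs_nonneg _)
    (Finset.mem_range.2 hj)
  exact h2.trans h1

theorem two_mul_rDiv_sub_one {B S z : ℝ} (hS : S ≠ 0) (hB : |B| ≤ S)
    (hz : S + S ≠ 0 → z = min |B + S| |S + S| / |S + S|) : z + z - 1 = B / S := by
  have hS' : 0 < S := lt_of_le_of_ne ((abs_nonneg B).trans hB) hS.symm
  have := abs_le.1 hB
  rw [hz (by positivity), abs_of_nonneg (by linarith), abs_of_pos (by linarith),
    min_eq_left (by linarith)]
  field_simp
  ring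

/-- The numbers `z e` solve the robust divisions with codes below `queryCount`. -/
def Answers (A : ℕ → ℕ → ℝ) (n b : ℕ) (z : ℕ → ℝ) : Prop :=
  ∀ e < queryCount n b, (queryPair A n b e).2 ≠ 0 →
    z e = min |(queryPair A n b e).1| |(queryPair A n b e).2| / |(queryPair A n b e).2|

theorem pathVec_spec {A : ℕ → ℕ → ℝ} {n b k : ℕ} {used : ℕ → Bool} {len E i₀ : ℕ} {z : ℕ → ℝ}
    (hnb : n < b) (hkn : k < n) (hok : pivotOk n b k used len E i₀ = true)
    (hz : Answers A n b z) (hmass : pathMass z n b k len E ≠ 1) :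
    (∀ j < k, ∑ i ∈ Finset.range n, pathVec z n b len E i₀ i * A i j = 0) ∧
      ∀ i < n, used i = true → pathVec z n b len E i₀ i = 0 := by
  obtain ⟨h1, h2, h3, h4, h5, h6, h7⟩ := pivotOk_iff.1 hok
  have hsupp : ∀ i, maskOf b (E / b ^ (2 * len)) i = 0 → pathVec z n b len E i₀ i = 0 := by
    intro i hi
    refine backSub_support ?_ fun l hl => ?_
    · rintro rfl
      exact h2 hi
    · rintro rfl
      exact (h7 l hl).1 hi
  refine ⟨fun j hj => ?_, fun i hi hu => hsupp i ((h6 i hi).1 hu)⟩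
  have hker := backSub_kernel (n := n) (k := k) (len := len) (i₀ := i₀)
    (A := maskRows b (E / b ^ (2 * len)) A) (I := pathRow b len E) (J := pathCol b len E)
    (ν := pathAns z n b len E) (fun l hl => (h7 l hl).2.1) (fun l hl => (h7 l hl).2.2) (by
      intro l hl hm i hi j hj
      unfold pathAns ansVal
      split_ifs with hmask
      · rw [elim_maskRows hmask, zero_div]
      · have hE : E / b ^ (2 * (len - l)) < b ^ (1 + n + 2 * n) :=
          (Nat.div_le_self _ _).trans_lt h4
        have hq := hz _ (queryCode_lt (i := i) (j := j) hE (hl.trans h3) (by omega) (by omega))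
        rw [queryPair_queryCode A (hl.trans h3) (by omega) (by omega)] at hq
        have hS : queryMass A n b (E / b ^ (2 * (len - l))) l
            = mass n k (elim (maskRows b (E / b ^ (2 * len)) A) (pathRow b len E)
              (pathCol b len E) l) := by
          unfold queryMass
          rw [queryMat_prefix A b E hl, div_pow_div_pow b E (e := 2 * len) (by omega), h5]
        rw [queryMat_prefix A b E hl, hS] at hq
        exact two_mul_rDiv_sub_one hm (abs_le_mass _ hi hj) hq) hmass hj
  rw [← hker]
  refine Finset.sum_congr rfl fun i _ => ?_
  unfold maskRows
  split_ifs with hm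
  · have : pathVec z n b len E i₀ i = 0 := hsupp i hm
    rw [this, zero_mul, mul_zero]
  · rfl

/-! ### Existence of certificates -/

theorem exists_digits (b N : ℕ) (g : ℕ → ℕ) (hg : ∀ i, g i < b) :
    ∃ E < b ^ N, ∀ i < N, E / b ^ i % b = g i := by
  induction N generalizing g with
  | zero => exact ⟨0, by simp, by simp⟩
  | succ N ih =>
    obtain ⟨E, hE, h⟩ := ih (fun i => g (i + 1)) fun i => hg _
    refine ⟨E * b + g 0, ?_, fun i hi => ?_⟩
    · rw [pow_succ]
      exact mul_add_lt_mul hE (hg 0)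
    · cases i with
      | zero => simpa using mul_add_mod_eq (x := E) (hg 0)
      | succ i =>
        rw [pow_succ', ← Nat.div_div_eq_div_mul, mul_add_div_eq (hg 0)]
        exact h i (by omega)

section PathCode

variable {b E₀ : ℕ} {I J : ℕ → ℕ} {len : ℕ}

theorem pathCode_div (hI : ∀ l < len, I l < b) (hJ : ∀ l < len, J l < b) {l : ℕ} (hl : l ≤ len) :
    pathCode b E₀ I J len / b ^ (2 * (len - l)) = pathCode b E₀ I J l := by
  induction len with
  | zero =>
    obtain rfl : l = 0 := by omega
    simp
  | succ len ih =>
    rcases Nat.le_succ_iff.1 hl with h | rfl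
    · rw [← ih (fun l hl => hI l (by omega)) (fun l hl => hJ l (by omega)) h,
        ← div_pow_div_pow b _ (c := 2) (d := 2 * (len - l)) (by omega)]
      congr 1
      rw [pow_two, ← Nat.div_div_eq_div_mul, pathCode, mul_add_div_eq (hJ len (by omega)),
        mul_add_div_eq (hI len (by omega))]
    · simp

theorem pathRow_pathCode (hI : ∀ l < len, I l < b) (hJ : ∀ l < len, J l < b) {l : ℕ}
    (hl : l < len) : pathRow b len (pathCode b E₀ I J len) l = I l := by
  rw [pathRow, ← div_pow_div_pow b _ (c := 2 * (len - (l + 1))) (d := 1) (by omega),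
    pathCode_div hI hJ hl, pow_one, pathCode, mul_add_div_eq (hJ l hl), mul_add_mod_eq (hI l hl)]

theorem pathCol_pathCode (hI : ∀ l < len, I l < b) (hJ : ∀ l < len, J l < b) {l : ℕ}
    (hl : l < len) : pathCol b len (pathCode b E₀ I J len) l = J l := by
  rw [pathCol, ← div_pow_div_pow b _ (c := 2 * (len - (l + 1))) (d := 0) (by omega),
    pathCode_div hI hJ hl, pow_zero, Nat.div_one, pathCode, mul_add_mod_eq (hJ l hl)]

theorem pathCode_lt {N : ℕ} (hE : E₀ < b ^ N) (hI : ∀ l < len, I l < b) (hJ : ∀ l < len, J l < b) :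
    pathCode b E₀ I J len < b ^ (N + 2 * len) := by
  induction len with
  | zero => simpa [pathCode] using hE
  | succ len ih =>
    rw [show N + 2 * (len + 1) = N + 2 * len + 1 + 1 by ring, pow_succ, pow_succ]
    exact mul_add_lt_mul (mul_add_lt_mul (ih (fun l hl => hI l (by omega))
      fun l hl => hJ l (by omega)) (hI len (by omega))) (hJ len (by omega))

end PathCode

theorem usedBelow_congr {I I' : ℕ → ℕ} {len : ℕ} (h : ∀ l < len, I l = I' l) (i : ℕ) :
    usedBelow I len i = usedBelow I' len i := by
  rw [Bool.eq_iff_iff, usedBelow_iff, usedBelow_iff]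
  exact exists_congr fun l => and_congr_right fun hl => by rw [h l hl]

theorem exists_pivot {n b k : ℕ} (z : ℕ → ℝ) (hnb : n < b) (hb : 2 ≤ b) (hkn : k < n)
    (used : ℕ → Bool) (hcard : k < ((Finset.range n).filter fun i => used i = false).card) :
    ∃ len E i₀, pivotOk n b k used len E i₀ = true ∧ pathMass z n b k len E = 0 ∧
      pathVec z n b len E i₀ i₀ ≠ 0 := by
  obtain ⟨E₀, hE₀, hdig⟩ := exists_digits b (n + 1)
    (fun i => if i = 0 then k else if used (i - 1) = true then 0 else 1) (by
      intro i
      split_ifs <;> omega)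
  have hk : E₀ % b = k := by simpa using hdig 0 (by omega)
  have hmask : ∀ i < n, maskOf b E₀ i = if used i = true then 0 else 1 := fun i hi => by
    simpa [maskOf] using hdig (i + 1) (by omega)
  set S := (Finset.range n).filter fun i => used i = false with hS
  have hSmem : ∀ i, i ∈ S ↔ i < n ∧ used i = false := fun i => by simp [hS]
  have hmS : ∀ i < n, maskOf b E₀ i ≠ 0 ↔ i ∈ S := fun i hi => by
    rw [hmask i hi, hSmem]
    cases used i <;> simp [hi]
  obtain ⟨len, I, J, i₀, hlen, hI, hJ, hne, hi₀, hi₀', hfree⟩ :=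
    exists_path b E₀ n k S (ansVal z n b E₀) (fun i hi E l j h => by
      rw [← hmS i hi]
      intro hm
      exact h (if_pos hm)) hcard
  have hIb : ∀ l < len, I l < b := fun l hl => ((hSmem _).1 (hI l hl)).1.trans hnb
  have hJb : ∀ l < len, J l < b := fun l hl => (hJ l hl).trans (by omega)
  have hbase : pathCode b E₀ I J len / b ^ (2 * len) = E₀ := pathCode_div hIb hJb (Nat.zero_le _)
  have hans : ∀ l ≤ len, pathAns z n b len (pathCode b E₀ I J len) l
      = ansVal z n b E₀ (pathCode b E₀ I J l) l := by
    intro l hl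
    funext i j
    rw [pathAns, hbase, pathCode_div hIb hJb hl]
  have hrow : ∀ l < len, pathRow b len (pathCode b E₀ I J len) l = I l := fun l hl =>
    pathRow_pathCode hIb hJb hl
  have hcol : ∀ l < len, pathCol b len (pathCode b E₀ I J len) l = J l := fun l hl =>
    pathCol_pathCode hIb hJb hl
  refine ⟨len, pathCode b E₀ I J len, i₀, ?_, ?_, ?_⟩
  · rw [pivotOk_iff, hbase]
    refine ⟨((hSmem _).1 hi₀).1, (hmS _ ((hSmem _).1 hi₀).1).2 hi₀, by omega, ?_, hk,
      fun i hi => ?_, fun l hl => ?_⟩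
    · refine (pathCode_lt hE₀ hIb hJb).trans_le (Nat.pow_le_pow_right (by omega) (by omega))
    · rw [hmask i hi]
      cases used i <;> simp
    · rw [hrow l hl, hcol l hl]
      have := (hSmem _).1 (hI l hl)
      exact ⟨(hmS _ this.1).2 (hI l hl), this.1, hJ l hl⟩
  · rw [← hfree]
    unfold pathMass freeMass
    simp only [hans len le_rfl, usedBelow_congr hrow, usedBelow_congr hcol]
  · refine backSub_ne_zero (fun l hl => ?_) fun l hl => ?_
    · rw [hrow l hl]
      exact hi₀' l hl
    · rw [hrow l hl, hcol l hl, hans l hl.le]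
      exact hne l hl

/-- Whether the row `i` is the pivot row of a column after `k`. -/
def usedAfter (n : ℕ) (s : ℕ → ℕ) (k i : ℕ) : Bool :=
  !allBelow n fun k' => !(decide (k < k') && decide (s k' = i))

theorem usedAfter_iff {n : ℕ} {s : ℕ → ℕ} {k i : ℕ} :
    usedAfter n s k i = true ↔ ∃ k' < n, k < k' ∧ s k' = i := by
  rw [usedAfter, Bool.not_eq_true', ← Bool.not_eq_true, allBelow_eq_true]
  push Not
  simp

theorem usedAfter_congr {n : ℕ} {s s' : ℕ → ℕ} {k : ℕ} (h : ∀ k', k < k' → s k' = s' k') :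
    usedAfter n s k = usedAfter n s' k := by
  funext i
  rw [Bool.eq_iff_iff, usedAfter_iff, usedAfter_iff]
  exact exists_congr fun k' => and_congr_right fun _ => and_congr_right fun hk => by rw [h k' hk]

theorem card_not_usedAfter (n : ℕ) (s : ℕ → ℕ) {k : ℕ} (hk : k < n) :
    k < ((Finset.range n).filter fun i => usedAfter n s k i = false).card := by
  have h1 := Finset.card_filter_add_card_filter_not (s := Finset.range n)
    (fun i => usedAfter n s k i = false)
  have h2 : ((Finset.range n).filter fun i => ¬ usedAfter n s k i = false)
      ⊆ (Finset.Ioo k n).image s := by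
    intro i hi
    rw [Finset.mem_filter, Bool.not_eq_false, usedAfter_iff] at hi
    obtain ⟨-, k', h1, h2, rfl⟩ := hi
    exact Finset.mem_image_of_mem _ (Finset.mem_Ioo.2 ⟨h2, h1⟩)
  have h3 := (Finset.card_le_card h2).trans Finset.card_image_le
  rw [Nat.card_Ioo] at h3
  rw [Finset.card_range] at h1
  omega

theorem exists_pivots {n b : ℕ} (z : ℕ → ℝ) (hnb : n < b) (hb : 2 ≤ b) :
    ∃ s len E : ℕ → ℕ, ∀ k < n, pivotOk n b k (usedAfter n s k) (len k) (E k) (s k) = true ∧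
      pathMass z n b k (len k) (E k) = 0 ∧ pathVec z n b (len k) (E k) (s k) (s k) ≠ 0 := by
  have : ∀ t ≤ n, ∃ s len E : ℕ → ℕ, ∀ k < n, n - t ≤ k →
      pivotOk n b k (usedAfter n s k) (len k) (E k) (s k) = true ∧
      pathMass z n b k (len k) (E k) = 0 ∧ pathVec z n b (len k) (E k) (s k) (s k) ≠ 0 := by
    intro t
    induction t with
    | zero => exact fun _ => ⟨id, id, id, fun k hk hk' => by omega⟩
    | succ t ih =>
      intro ht
      obtain ⟨s, len, E, h⟩ := ih (by omega)
      obtain ⟨k₀, hk₀⟩ : ∃ k₀, k₀ = n - (t + 1) := ⟨_, rfl⟩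
      have hk₀n : k₀ < n := by omega
      obtain ⟨len₀, E', i₀, h₀⟩ := exists_pivot z hnb hb hk₀n (usedAfter n s k₀)
        (card_not_usedAfter n s hk₀n)
      refine ⟨Function.update s k₀ i₀, Function.update len k₀ len₀, Function.update E k₀ E',
        fun k hk hk' => ?_⟩
      have hu : usedAfter n (Function.update s k₀ i₀) k = usedAfter n s k :=
        usedAfter_congr fun k' hkk' => Function.update_of_ne (by omega) _ _
      rw [hu]
      rcases eq_or_ne k k₀ with rfl | hne
      · simpa only [Function.update_self] using h₀
      · simpa only [Function.update_of_ne hne] using h k hk (by omega)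
  obtain ⟨s, len, E, h⟩ := this n le_rfl
  exact ⟨s, len, E, fun k hk => h k hk (by omega)⟩

/-- The combinatorial conditions on a certificate. -/
def certOk (n b ds dl dE : ℕ) : Bool :=
  allBelow n fun k => pivotOk n b k (usedAfter n (tbl ds) k) (tbl dl k) (tbl dE k) (tbl ds k)

/-- The kernel vectors of a certificate. -/
def certVec (z : ℕ → ℝ) (n b ds dl dE k : ℕ) : ℕ → ℝ :=
  pathVec z n b (tbl dl k) (tbl dE k) (tbl ds k)

theorem exists_cert {n b : ℕ} (z : ℕ → ℝ) (hnb : n < b) (hb : 2 ≤ b) :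
    ∃ ds dl dE, certOk n b ds dl dE = true ∧
      ∀ k < n, pathMass z n b k (tbl dl k) (tbl dE k) = 0 ∧
        certVec z n b ds dl dE k (tbl ds k) ≠ 0 := by
  obtain ⟨s, len, E, h⟩ := exists_pivots z hnb hb
  obtain ⟨ds, hds⟩ := exists_tbl s n
  obtain ⟨dl, hdl⟩ := exists_tbl len n
  obtain ⟨dE, hdE⟩ := exists_tbl E n
  have hu : ∀ k, usedAfter n (tbl ds) k = usedAfter n s k := fun k => by
    funext i
    rw [Bool.eq_iff_iff, usedAfter_iff, usedAfter_iff]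
    exact exists_congr fun k' => and_congr_right fun hk' => by rw [hds k' hk']
  refine ⟨ds, dl, dE, ?_, fun k hk => ?_⟩
  · rw [certOk, allBelow_eq_true]
    intro k hk
    rw [hu, hds k hk, hdl k hk, hdE k hk]
    exact (h k hk).1
  · rw [certVec, hds k hk, hdl k hk, hdE k hk]
    exact (h k hk).2

/-- A certificate yields an LU-decomposition. -/
theorem isLUDecomp_of_cert {n m : ℕ} (A : Matrix (Fin n) (Fin m) ℝ) {z : ℕ → ℝ} {ds dl dE : ℕ}
    (hz : Answers (zeroExt A) n (n + m + 2) z) (hok : certOk n (n + m + 2) ds dl dE = true)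
    (hmass : ∀ k < n, pathMass z n (n + m + 2) k (tbl dl k) (tbl dE k) ≠ 1)
    (hne : ∀ k < n, certVec z n (n + m + 2) ds dl dE k (tbl ds k) ≠ 0) :
    ∃ σ : Equiv.Perm (Fin n), (∀ k : Fin n, (σ k : ℕ) = tbl ds k) ∧
      IsLUDecomp A (σ.permMatrix ℝ) 1
      (Matrix.of fun k j => (∑ i ∈ Finset.range n, certVec z n (n + m + 2) ds dl dE k i *
        zeroExt A i j) * (certVec z n (n + m + 2) ds dl dE k (tbl ds k))⁻¹)
      (Matrix.of fun r c : Fin n =>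
        horner n (strictPart (certVec z n (n + m + 2) ds dl dE) (tbl ds)) n r c) := by
  rw [certOk, allBelow_eq_true] at hok
  have hlt : ∀ k < n, tbl ds k < n := fun k hk => (pivotOk_iff.1 (hok k hk)).1
  have hunused : ∀ k < n, ∀ l < n, k < l → tbl ds l ≠ tbl ds k := by
    intro k hk l hl hkl e
    obtain ⟨h1, h2, -, -, -, h6, -⟩ := pivotOk_iff.1 (hok k hk)
    exact h2 ((h6 _ h1).1 (usedAfter_iff.2 ⟨l, hl, hkl, e⟩))
  have hinj : Function.Injective fun k : Fin n => (⟨tbl ds k, hlt k k.2⟩ : Fin n) := by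
    intro k l hkl
    have e : tbl ds k = tbl ds l := by simpa using hkl
    rcases lt_trichotomy k l with h | h | h
    · exact absurd e.symm (hunused k k.2 l l.2 h)
    · exact h
    · exact absurd e (hunused l l.2 k k.2 h)
  refine ⟨Equiv.ofBijective _ (Finite.injective_iff_bijective.1 hinj), fun k => rfl, ?_⟩
  have key : ∀ k < n, _ := fun k hk =>
    pathVec_spec (A := zeroExt A) (by omega) hk (hok k hk) hz (hmass k hk)
  have hsum : ∀ (k : Fin n) (j : Fin m),
      ∑ i : Fin n, certVec z n (n + m + 2) ds dl dE k i * A i j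
        = ∑ i ∈ Finset.range n, certVec z n (n + m + 2) ds dl dE k i * zeroExt A i j := by
    intro k j
    rw [Finset.sum_range]
    exact Finset.sum_congr rfl fun i _ => by rw [zeroExt_val]
  have := isLUDecomp_of_kernel A (Equiv.ofBijective _ (Finite.injective_iff_bijective.1 hinj))
    (tbl ds) (fun k => rfl) (certVec z n (n + m + 2) ds dl dE) (fun k => hne k k.2)
    (fun k l hkl => (key k k.2).2 _ (hlt l l.2) (usedAfter_iff.2 ⟨l, l.2, hkl, rfl⟩))
    (fun k j hj => by rw [hsum]; exact (key k k.2).1 j hj)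
  simpa only [hsum] using this

/-! ### Ball versions of the elimination, of back substitution and of the Horner scheme -/

def bElim (b : ℕ) (src : ℕ → ℕ → ℕ) (I J : ℕ → ℕ) (l i j : ℕ) : ℕ :=
  itab (b * b) (fun r => src (r / b) (r % b))
    (fun l T r => bsub (bmul (T (I l * b + J l)) (T r))
      (bmul (T (r / b * b + J l)) (T (I l * b + r % b)))) l (i * b + j)

def bFreeMass (n k : ℕ) (I J : ℕ → ℕ) (len : ℕ) (ν : ℕ → ℕ → ℕ) : ℕ :=
  bsum n fun i => bsum k fun j =>
    if (usedBelow I len i || usedBelow J len j) = true then 0 else babs (ν i j)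

def bBackSub (n : ℕ) (ν : ℕ → ℕ → ℕ → ℕ) (I J : ℕ → ℕ) (len i₀ t i : ℕ) : ℕ :=
  itab n (fun i => if i = i₀ then bconst (qnat 1) else 0)
    (fun t T i => bsub (bmul (ν (len - 1 - t) (I (len - 1 - t)) (J (len - 1 - t))) (T i))
      (if i = I (len - 1 - t) then
        bsum n fun a => bmul (T a) (ν (len - 1 - t) a (J (len - 1 - t))) else 0)) t i

def bHorner (n : ℕ) (N : ℕ → ℕ → ℕ) (t r c : ℕ) : ℕ :=
  itab (n * n) (fun x => if x / n = x % n then bconst (qnat 1) else 0)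
    (fun _ T x => badd (if x / n = x % n then bconst (qnat 1) else 0)
      (bsum n fun s => bmul (N (x / n) s) (T (s * n + x % n)))) t (r * n + c)

theorem Approx.one : Approx (fun _ => bconst (qnat 1)) 1 := by
  simpa using Approx.nat 1

theorem Approx.ite {a b : ℕ → ℕ} {x y : ℝ} (c : Prop) [Decidable c] (ha : c → Approx a x)
    (hb : ¬c → Approx b y) : Approx (fun κ => if c then a κ else b κ) (if c then x else y) := by
  by_cases h : c
  · simpa only [if_pos h] using ha h
  · simpa only [if_neg h] using hb h

theorem Approx.elim {b : ℕ} {src : ℕ → ℕ → ℕ → ℕ} {A : ℕ → ℕ → ℝ} {I J : ℕ → ℕ}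
    (h : ∀ i j, Approx (fun κ => src κ i j) (A i j)) (hI : ∀ l, I l < b) (hJ : ∀ l, J l < b)
    (l : ℕ) {i j : ℕ} (hi : i < b) (hj : j < b) :
    Approx (fun κ => bElim b (src κ) I J l i j) (elim A I J l i j) := by
  unfold bElim
  induction l generalizing i j with
  | zero =>
    simp only [itab_zero (mul_add_lt_mul hi hj), mul_add_div_eq hj, mul_add_mod_eq hj]
    exact h i j
  | succ l ih =>
    simp only [itab_succ (mul_add_lt_mul hi hj), mul_add_div_eq hj, mul_add_mod_eq hj]
    exact ((ih (hI l) (hJ l)).mul (ih hi hj)).sub ((ih hi (hJ l)).mul (ih (hI l) hj))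

theorem Approx.mass {n k : ℕ} {src : ℕ → ℕ → ℕ → ℕ} {B : ℕ → ℕ → ℝ}
    (h : ∀ i < n, ∀ j < k, Approx (fun κ => src κ i j) (B i j)) :
    Approx (fun κ => bsum n fun i => bsum k fun j => babs (src κ i j)) (mass n k B) :=
  Approx.sum fun i hi => Approx.sum fun j hj => (h i hi j hj).abs_ball

theorem Approx.freeMass {n k len : ℕ} {I J : ℕ → ℕ} {ν : ℕ → ℕ → ℕ → ℕ} {x : ℕ → ℕ → ℝ}
    (h : ∀ i j, Approx (fun κ => ν κ i j) (x i j)) :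
    Approx (fun κ => bFreeMass n k I J len (ν κ)) (freeMass n k I J len x) :=
  Approx.sum fun i _ => Approx.sum fun j _ =>
    Approx.ite _ (fun _ => Approx.zero) fun _ => (h i j).abs_ball

theorem Approx.backSub {n len i₀ : ℕ} {I J : ℕ → ℕ} {ν : ℕ → ℕ → ℕ → ℕ → ℕ}
    {x : ℕ → ℕ → ℕ → ℝ} (h : ∀ l i j, Approx (fun κ => ν κ l i j) (x l i j)) (t : ℕ) {i : ℕ}
    (hi : i < n) :
    Approx (fun κ => bBackSub n (ν κ) I J len i₀ t i) (backSub n x I J len i₀ t i) := by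
  unfold bBackSub
  induction t generalizing i with
  | zero =>
    simp only [itab_zero hi, backSub.eq_1]
    exact Approx.ite _ (fun _ => Approx.one) fun _ => Approx.zero
  | succ t ih =>
    simp only [itab_succ hi, backSub.eq_2]
    exact ((h _ _ _).mul (ih hi)).sub (Approx.ite _
      (fun _ => Approx.sum fun a ha => (ih ha).mul (h _ _ _)) fun _ => Approx.zero)

theorem Approx.horner {n : ℕ} {N : ℕ → ℕ → ℕ → ℕ} {x : ℕ → ℕ → ℝ}
    (h : ∀ r < n, ∀ s < n, Approx (fun κ => N κ r s) (x r s)) (t : ℕ) {r c : ℕ}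
    (hr : r < n) (hc : c < n) :
    Approx (fun κ => bHorner n (N κ) t r c) (horner n x t r c) := by
  unfold bHorner
  induction t generalizing r c with
  | zero =>
    simp only [itab_zero (mul_add_lt_mul hr hc), mul_add_div_eq hc, mul_add_mod_eq hc,
      horner.eq_1]
    exact Approx.ite _ (fun _ => Approx.one) fun _ => Approx.zero
  | succ t ih =>
    simp only [itab_succ (mul_add_lt_mul hr hc), mul_add_div_eq hc, mul_add_mod_eq hc,
      horner.eq_2]
    exact (Approx.ite _ (fun _ => Approx.one) fun _ => Approx.zero).add
      (Approx.sum fun s hs => (h r hr s hs).mul (ih hs hc))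

/-- Whether a ball shows that the absolute value is larger than the number with the code `q`. -/
def farFrom (q a : ℕ) : Bool := qlt (qadd (babs a).unpair.2 q) (babs a).unpair.1

theorem Approx.lt_abs {a : ℕ → ℕ} {x : ℝ} (h : Approx a x) {q κ : ℕ}
    (hf : farFrom q (a κ) = true) : (nuQ q : ℝ) < |x| := by
  rw [farFrom, qlt_iff, nuQ_qadd, ← Rat.cast_lt (K := ℝ), Rat.cast_add] at hf
  have := (abs_le.1 (h.abs_ball.le κ)).2
  unfold cen rad at this
  linarith

theorem Approx.eventually_farFrom {a : ℕ → ℕ} {x : ℝ} (h : Approx a x) {q : ℕ}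
    (hx : (nuQ q : ℝ) < |x|) : ∃ κ₀, ∀ κ ≥ κ₀, farFrom q (a κ) = true := by
  have h1 : Tendsto (fun κ => cen (babs (a κ)) - rad (babs (a κ))) atTop (𝓝 (|x| - 0)) :=
    h.abs_ball.tendsto.sub h.abs_ball.lim
  rw [sub_zero] at h1
  obtain ⟨κ₀, hκ₀⟩ := eventually_atTop.1 (h1.eventually (lt_mem_nhds hx))
  refine ⟨κ₀, fun κ hκ => ?_⟩
  have := hκ₀ κ hκ
  rw [farFrom, qlt_iff, nuQ_qadd, ← Rat.cast_lt (K := ℝ), Rat.cast_add]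
  unfold cen rad at this
  linarith

/-! ### The program asking for robust divisions -/

/-- Whether the format of a matrix has been read and is `n × m`. -/
def headOk (u : List Bool) (s t n m : ℕ) : Bool :=
  okAt u s t && (decide (nxt u s t = n) &&
    (okAt u (s + t * (n + 1)) t && decide (nxt u (s + t * (n + 1)) t = m)))

theorem headOk_eq {p : Cantor} {s t n m n' m' T : ℕ} (h1 : StartsWith p s t n)
    (h2 : StartsWith p (s + t * (n + 1)) t m) (h : headOk (prefixOf p T) s t n' m' = true) :
    n' = n ∧ m' = m := by
  simp only [headOk, Bool.and_eq_true, decide_eq_true_eq] at h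
  obtain ⟨g1, g2, g3, g4⟩ := h
  obtain rfl : n' = n := by rw [← g2, nxt_eq h1 g1]
  exact ⟨rfl, by rw [← g4, nxt_eq h2 g3]⟩

theorem exists_headOk {p : Cantor} {s t n m : ℕ} (h1 : StartsWith p s t n)
    (h2 : StartsWith p (s + t * (n + 1)) t m) :
    ∃ T₀, ∀ T ≥ T₀, headOk (prefixOf p T) s t n m = true := by
  obtain ⟨T₁, g1⟩ := exists_ok_of_startsWith h1
  obtain ⟨T₂, g2⟩ := exists_ok_of_startsWith h2
  refine ⟨max T₁ T₂, fun T hT => ?_⟩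
  have g1 := g1 T (le_trans (le_max_left _ _) hT)
  have g2 := g2 T (le_trans (le_max_right _ _) hT)
  simp only [headOk, Bool.and_eq_true, decide_eq_true_eq]
  exact ⟨g1, nxt_eq h1 g1, g2, nxt_eq h2 g2⟩

/-- The ball for the entry `(i, j)` of the matrix at the end of a path. -/
def queryMatBall (u : List Bool) (n m κ E l i j : ℕ) : ℕ :=
  bElim (n + m + 2) (fun i j => if maskOf (n + m + 2) (E / (n + m + 2) ^ (2 * l)) i = 0 then 0
    else matSrc u 0 1 n m κ i j) (pathRow (n + m + 2) l E) (pathCol (n + m + 2) l E) l i j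

def queryMassBall (u : List Bool) (n m κ E l : ℕ) : ℕ :=
  bsum n fun i => bsum (E / (n + m + 2) ^ (2 * l) % (n + m + 2)) fun j =>
    babs (queryMatBall u n m κ E l i j)

/-- The balls for the two numbers of the query with code `e`. -/
def queryBall (u : List Bool) (n m κ e c : ℕ) : ℕ :=
  badd (if c = 0 then queryMatBall u n m κ (e / (n + m + 2) / (n + m + 2) / (n + 1))
      (e / (n + m + 2) / (n + m + 2) % (n + 1)) (e / (n + m + 2) % (n + m + 2)) (e % (n + m + 2))
    else queryMassBall u n m κ (e / (n + m + 2) / (n + m + 2) / (n + 1))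
      (e / (n + m + 2) / (n + m + 2) % (n + 1)))
    (queryMassBall u n m κ (e / (n + m + 2) / (n + m + 2) / (n + 1))
      (e / (n + m + 2) / (n + m + 2) % (n + 1)))

section Primitive

variable {α : Type} [Primcodable α]

@[fun_prop] theorem primrec_farFrom {q a : α → ℕ} (hq : Primrec q) (ha : Primrec a) :
    Primrec (fun x => farFrom (q x) (a x)) := by
  unfold farFrom
  fun_prop

@[fun_prop] theorem primrec_headOk {u : α → List Bool} {s t n m : α → ℕ} (hu : Primrec u)
    (hs : Primrec s) (ht : Primrec t) (hn : Primrec n) (hm : Primrec m) :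
    Primrec (fun x => headOk (u x) (s x) (t x) (n x) (m x)) := by
  unfold headOk
  fun_prop

@[fun_prop] theorem primrec_pathRow {b l E a : α → ℕ} (hb : Primrec b) (hl : Primrec l)
    (hE : Primrec E) (ha : Primrec a) :
    Primrec (fun x => pathRow (b x) (l x) (E x) (a x)) := by
  unfold pathRow
  fun_prop

@[fun_prop] theorem primrec_pathCol {b l E a : α → ℕ} (hb : Primrec b) (hl : Primrec l)
    (hE : Primrec E) (ha : Primrec a) :
    Primrec (fun x => pathCol (b x) (l x) (E x) (a x)) := by
  unfold pathCol
  fun_prop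

@[fun_prop] theorem primrec_maskOf {b E i : α → ℕ} (hb : Primrec b) (hE : Primrec E)
    (hi : Primrec i) : Primrec (fun x => maskOf (b x) (E x) (i x)) := by
  unfold maskOf
  fun_prop

@[fun_prop] theorem primrec_queryCode {n b E l i j : α → ℕ} (hn : Primrec n) (hb : Primrec b)
    (hE : Primrec E) (hl : Primrec l) (hi : Primrec i) (hj : Primrec j) :
    Primrec (fun x => queryCode (n x) (b x) (E x) (l x) (i x) (j x)) := by
  unfold queryCode
  fun_prop

@[fun_prop] theorem primrec_queryCount {n b : α → ℕ} (hn : Primrec n) (hb : Primrec b) :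
    Primrec (fun x => queryCount (n x) (b x)) := by
  unfold queryCount
  fun_prop

@[fun_prop] theorem primrec_queryMatBall {u : α → List Bool} {n m κ E l i j : α → ℕ}
    (hu : Primrec u) (hn : Primrec n) (hm : Primrec m) (hκ : Primrec κ) (hE : Primrec E)
    (hl : Primrec l) (hi : Primrec i) (hj : Primrec j) :
    Primrec (fun x => queryMatBall (u x) (n x) (m x) (κ x) (E x) (l x) (i x) (j x)) := by
  unfold queryMatBall bElim
  fun_prop

@[fun_prop] theorem primrec_queryMassBall {u : α → List Bool} {n m κ E l : α → ℕ}
    (hu : Primrec u) (hn : Primrec n) (hm : Primrec m) (hκ : Primrec κ) (hE : Primrec E)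
    (hl : Primrec l) :
    Primrec (fun x => queryMassBall (u x) (n x) (m x) (κ x) (E x) (l x)) := by
  unfold queryMassBall
  fun_prop

@[fun_prop] theorem primrec_queryBall {u : α → List Bool} {n m κ e c : α → ℕ}
    (hu : Primrec u) (hn : Primrec n) (hm : Primrec m) (hκ : Primrec κ) (he : Primrec e)
    (hc : Primrec c) :
    Primrec (fun x => queryBall (u x) (n x) (m x) (κ x) (e x) (c x)) := by
  unfold queryBall
  fun_prop

end Primitive

/-- The program asking for robust divisions. -/
def queryProgram : Program where
  hd u d := headOk u 0 1 d.unpair.1 d.unpair.2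
  dn u d κ := matRead u 0 1 d.unpair.1 d.unpair.2 κ
  bl u d κ j := queryBall u d.unpair.1 d.unpair.2 κ j.unpair.1 j.unpair.2
  lay d pos := pairsLay (queryCount d.unpair.1 (d.unpair.1 + d.unpair.2 + 2)) pos
  primrec_hd := by fun_prop
  primrec_dn := by fun_prop
  primrec_bl := by fun_prop
  primrec_lay := by fun_prop

theorem queryProgram_spec {p : Cantor} {n m : ℕ} {A : Matrix (Fin n) (Fin m) ℝ}
    (h : Represented.IsName p (⟨n, m, A⟩ : RealMatrix)) :
    ∃ o, Produces queryProgram.run p o ∧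
      Represented.IsName o (⟨queryCount n (n + m + 2), fun e =>
        queryPair (zeroExt A) n (n + m + 2) e⟩ : Σ n : ℕ, (Fin n → ℝ × ℝ)) := by
  have h' : Represented.IsName (fun k => p (0 + 1 * k)) (⟨n, m, A⟩ : RealMatrix) := by
    simpa only [zero_add, one_mul] using h
  obtain ⟨hs1, hs2, -⟩ := RealMatrix.name_entry h'
  have hd : ∀ t d, queryProgram.hd (prefixOf p t) d = true → d.unpair = (n, m) := by
    intro t d htd
    have := headOk_eq hs1 hs2 htd
    exact Prod.ext this.1 this.2
  obtain ⟨o, t, d, htd, ho, r, hr, hor⟩ := queryProgram.run_spec (p := p)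
    (fun _ j => if j.unpair.2 = 0 then (queryPair (zeroExt A) n (n + m + 2) j.unpair.1).1
      else (queryPair (zeroExt A) n (n + m + 2) j.unpair.1).2) (by
      obtain ⟨T, hT⟩ := exists_headOk hs1 hs2
      refine ⟨T, Nat.pair n m, ?_⟩
      simp only [queryProgram, Nat.unpair_pair]
      exact hT T le_rfl) (by
      intro t d htd
      have hnm := hd t d htd
      obtain ⟨ball, h1, h2, -, h3⟩ := exists_matSrc h'
      let M : ℕ → ℕ → ℕ → ℕ → ℕ → ℕ := fun κ E l => bElim (n + m + 2) (fun i j =>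
        if maskOf (n + m + 2) (E / (n + m + 2) ^ (2 * l)) i = 0 then 0 else ball κ i j)
        (pathRow (n + m + 2) l E) (pathCol (n + m + 2) l E) l
      let S : ℕ → ℕ → ℕ → ℕ := fun κ E l =>
        bsum n fun i => bsum (E / (n + m + 2) ^ (2 * l) % (n + m + 2)) fun j =>
          babs (M κ E l i j)
      have hM : ∀ E l, ∀ i < n + m + 2, ∀ j < n + m + 2,
          Approx (fun κ => M κ E l i j) (queryMat (zeroExt A) (n + m + 2) E l i j) := by
        intro E l i hi j hj
        refine Approx.elim (fun i j => ?_) (fun l => Nat.mod_lt _ (by omega))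
          (fun l => Nat.mod_lt _ (by omega)) l hi hj
        exact Approx.ite _ (fun _ => Approx.zero) fun _ => h1 i j
      have hS : ∀ E l, Approx (fun κ => S κ E l) (queryMass (zeroExt A) n (n + m + 2) E l) := by
        intro E l
        have hlt : E / (n + m + 2) ^ (2 * l) % (n + m + 2) < n + m + 2 :=
          Nat.mod_lt _ (by omega)
        exact Approx.mass fun i hi j hj => hM E l i (by omega) j (hj.trans hlt)
      refine ⟨fun κ j => badd
        (if j.unpair.2 = 0 then M κ (j.unpair.1 / (n + m + 2) / (n + m + 2) / (n + 1))
          (j.unpair.1 / (n + m + 2) / (n + m + 2) % (n + 1))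
          (j.unpair.1 / (n + m + 2) % (n + m + 2)) (j.unpair.1 % (n + m + 2))
        else S κ (j.unpair.1 / (n + m + 2) / (n + m + 2) / (n + 1))
          (j.unpair.1 / (n + m + 2) / (n + m + 2) % (n + 1)))
        (S κ (j.unpair.1 / (n + m + 2) / (n + m + 2) / (n + 1))
          (j.unpair.1 / (n + m + 2) / (n + m + 2) % (n + 1))),
        fun T κ j hT => ?_, fun κ => ?_, fun j => ?_⟩
      · simp only [queryProgram, hnm] at hT ⊢
        simp only [queryBall, queryMassBall, queryMatBall, h2 T κ hT, M, S]
      · obtain ⟨T, hT⟩ := h3 κ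
        refine ⟨T, ?_⟩
        simp only [queryProgram, hnm]
        exact hT T le_rfl
      · by_cases hj : j.unpair.2 = 0
        · simp only [if_pos hj]
          exact (hM _ _ _ (Nat.mod_lt _ (by omega)) _ (Nat.mod_lt _ (by omega))).add (hS _ _)
        · simp only [if_neg hj]
          exact (hS _ _).add (hS _ _))
  refine ⟨o, ho, pairs_isName_of_layout (r := r) (fun pos => ?_) fun e => ⟨?_, ?_⟩⟩
  · rw [hor]
    simp only [queryProgram, hd t d htd]
  · simpa only [Nat.unpair_pair, if_true] using hr (Nat.pair e 0)
  · simpa only [Nat.unpair_pair, if_neg one_ne_zero] using hr (Nat.pair e 1)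

/-! ### The program computing an LU-decomposition from the answers -/

def ansBall (u : List Bool) (n m κ E₀ E l i j : ℕ) : ℕ :=
  if maskOf (n + m + 2) E₀ i = 0 then 0
  else bsub (badd
    (tupleSrc u 1 2 (queryCount n (n + m + 2)) κ (queryCode n (n + m + 2) E l i j))
    (tupleSrc u 1 2 (queryCount n (n + m + 2)) κ (queryCode n (n + m + 2) E l i j)))
    (bconst (qnat 1))

def pathAnsBall (u : List Bool) (n m κ len E l i j : ℕ) : ℕ :=
  ansBall u n m κ (E / (n + m + 2) ^ (2 * len)) (E / (n + m + 2) ^ (2 * (len - l))) l i j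

def pathVecBall (u : List Bool) (n m κ len E i₀ i : ℕ) : ℕ :=
  bBackSub n (fun l i j => pathAnsBall u n m κ len E l i j) (fun a => pathRow (n + m + 2) len E a)
    (fun a => pathCol (n + m + 2) len E a) len i₀ len i

def pathMassBall (u : List Bool) (n m κ k len E : ℕ) : ℕ :=
  bFreeMass n k (fun a => pathRow (n + m + 2) len E a) (fun a => pathCol (n + m + 2) len E a) len
    fun i j => pathAnsBall u n m κ len E len i j

/-- The ball for the component `i` of the `k`-th kernel vector of the certificate `d`. -/
def certVecBall (u : List Bool) (d κ k i : ℕ) : ℕ :=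
  pathVecBall u (tbl d 0) (tbl d 1) κ (tbl (tbl d 5) k) (tbl (tbl d 6) k) (tbl (tbl d 4) k) i

def certMassBall (u : List Bool) (d κ k : ℕ) : ℕ :=
  pathMassBall u (tbl d 0) (tbl d 1) κ k (tbl (tbl d 5) k) (tbl (tbl d 6) k)

def certInvBall (u : List Bool) (d κ k : ℕ) : ℕ :=
  binv (tbl d 2) (certVecBall u d κ k (tbl (tbl d 4) k))

def upperBall (u : List Bool) (d κ k j : ℕ) : ℕ :=
  bmul (bsum (tbl d 0) fun i => bmul (certVecBall u d κ k i)
    (matSrc u 0 2 (tbl d 0) (tbl d 1) κ i j)) (certInvBall u d κ k)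

def strictBall (u : List Bool) (d κ k l : ℕ) : ℕ :=
  if l < k then bneg (bmul (certVecBall u d κ k (tbl (tbl d 4) l)) (certInvBall u d κ k)) else 0

def lowerBall (u : List Bool) (d κ r c : ℕ) : ℕ :=
  bHorner (tbl d 0) (fun r c => strictBall u d κ r c) (tbl d 0) r c

/-- The balls for the entries of the four matrices of the LU-decomposition. -/
def luBall (u : List Bool) (d κ tag r c : ℕ) : ℕ :=
  if tag = 0 then if tbl (tbl d 4) r = c then bconst (qnat 1) else 0
  else if tag = 1 then if r = c then bconst (qnat 1) else 0
  else if tag = 2 then if r < tbl d 0 then upperBall u d κ r c else 0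
  else if r < tbl d 0 then if c < tbl d 0 then lowerBall u d κ r c else 0 else 0

/-- The layout of the name of a quadruple of matrices. -/
def luLay (n m pos : ℕ) : ℕ :=
  if pos % 2 = 0 then matLay 0 n n (pos / 2)
  else if pos / 2 % 2 = 0 then matLay 1 m m (pos / 2 / 2)
  else if pos / 2 / 2 % 2 = 0 then matLay 2 n m (pos / 2 / 2 / 2)
  else matLay 3 n n (pos / 2 / 2 / 2)

/-- Whether the answers read so far confirm the certificate `d`. -/
def certCheck (u : List Bool) (d : ℕ) : Bool :=
  headOk u 0 2 (tbl d 0) (tbl d 1) &&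
    (certOk (tbl d 0) (tbl d 0 + tbl d 1 + 2) (tbl d 4) (tbl d 5) (tbl d 6) &&
    (tupleRead u 1 2 (queryCount (tbl d 0) (tbl d 0 + tbl d 1 + 2)) (tbl d 3) &&
    allBelow (tbl d 0) fun k =>
      farFrom 0 (bsub (certMassBall u d (tbl d 3) k) (bconst (qnat 1))) &&
      farFrom (qhalf (tbl d 2)) (certVecBall u d (tbl d 3) k (tbl (tbl d 4) k))))

section Primitive

variable {α : Type} [Primcodable α]

@[fun_prop] theorem primrec_certOk {n b ds dl dE : α → ℕ} (hn : Primrec n) (hb : Primrec b)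
    (hs : Primrec ds) (hl : Primrec dl) (hE : Primrec dE) :
    Primrec (fun x => certOk (n x) (b x) (ds x) (dl x) (dE x)) := by
  unfold certOk pivotOk usedAfter
  fun_prop

@[fun_prop] theorem primrec_pathAnsBall {u : α → List Bool} {n m κ len E l i j : α → ℕ}
    (hu : Primrec u) (hn : Primrec n) (hm : Primrec m) (hκ : Primrec κ) (hlen : Primrec len)
    (hE : Primrec E) (hl : Primrec l) (hi : Primrec i) (hj : Primrec j) :
    Primrec (fun x =>
      pathAnsBall (u x) (n x) (m x) (κ x) (len x) (E x) (l x) (i x) (j x)) := by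
  unfold pathAnsBall ansBall
  fun_prop

@[fun_prop] theorem primrec_pathVecBall {u : α → List Bool} {n m κ len E i₀ i : α → ℕ}
    (hu : Primrec u) (hn : Primrec n) (hm : Primrec m) (hκ : Primrec κ) (hlen : Primrec len)
    (hE : Primrec E) (h₀ : Primrec i₀) (hi : Primrec i) :
    Primrec (fun x => pathVecBall (u x) (n x) (m x) (κ x) (len x) (E x) (i₀ x) (i x)) := by
  unfold pathVecBall bBackSub
  fun_prop

@[fun_prop] theorem primrec_pathMassBall {u : α → List Bool} {n m κ k len E : α → ℕ}
    (hu : Primrec u) (hn : Primrec n) (hm : Primrec m) (hκ : Primrec κ) (hk : Primrec k)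
    (hlen : Primrec len) (hE : Primrec E) :
    Primrec (fun x => pathMassBall (u x) (n x) (m x) (κ x) (k x) (len x) (E x)) := by
  unfold pathMassBall bFreeMass usedBelow
  fun_prop

variable {u : α → List Bool} {d κ : α → ℕ}

@[fun_prop] theorem primrec_certVecBall {k i : α → ℕ} (hu : Primrec u) (hd : Primrec d)
    (hκ : Primrec κ) (hk : Primrec k) (hi : Primrec i) :
    Primrec (fun x => certVecBall (u x) (d x) (κ x) (k x) (i x)) := by
  unfold certVecBall
  fun_prop

@[fun_prop] theorem primrec_certMassBall {k : α → ℕ} (hu : Primrec u) (hd : Primrec d)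
    (hκ : Primrec κ) (hk : Primrec k) :
    Primrec (fun x => certMassBall (u x) (d x) (κ x) (k x)) := by
  unfold certMassBall
  fun_prop

@[fun_prop] theorem primrec_certInvBall {k : α → ℕ} (hu : Primrec u) (hd : Primrec d)
    (hκ : Primrec κ) (hk : Primrec k) :
    Primrec (fun x => certInvBall (u x) (d x) (κ x) (k x)) := by
  unfold certInvBall
  fun_prop

@[fun_prop] theorem primrec_upperBall {k j : α → ℕ} (hu : Primrec u) (hd : Primrec d)
    (hκ : Primrec κ) (hk : Primrec k) (hj : Primrec j) :
    Primrec (fun x => upperBall (u x) (d x) (κ x) (k x) (j x)) := by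
  unfold upperBall
  fun_prop

@[fun_prop] theorem primrec_strictBall {k l : α → ℕ} (hu : Primrec u) (hd : Primrec d)
    (hκ : Primrec κ) (hk : Primrec k) (hl : Primrec l) :
    Primrec (fun x => strictBall (u x) (d x) (κ x) (k x) (l x)) := by
  unfold strictBall
  fun_prop

@[fun_prop] theorem primrec_lowerBall {r c : α → ℕ} (hu : Primrec u) (hd : Primrec d)
    (hκ : Primrec κ) (hr : Primrec r) (hc : Primrec c) :
    Primrec (fun x => lowerBall (u x) (d x) (κ x) (r x) (c x)) := by
  unfold lowerBall bHorner
  fun_prop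

@[fun_prop] theorem primrec_luBall {tag r c : α → ℕ} (hu : Primrec u) (hd : Primrec d)
    (hκ : Primrec κ) (ht : Primrec tag) (hr : Primrec r) (hc : Primrec c) :
    Primrec (fun x => luBall (u x) (d x) (κ x) (tag x) (r x) (c x)) := by
  unfold luBall
  fun_prop

@[fun_prop] theorem primrec_luLay {n m pos : α → ℕ} (hn : Primrec n) (hm : Primrec m)
    (hp : Primrec pos) : Primrec (fun x => luLay (n x) (m x) (pos x)) := by
  unfold luLay
  fun_prop

@[fun_prop] theorem primrec_certCheck (hu : Primrec u) (hd : Primrec d) :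
    Primrec (fun x => certCheck (u x) (d x)) := by
  unfold certCheck
  fun_prop

end Primitive

def luProgram : Program where
  hd u d := certCheck u d
  dn u d κ := matRead u 0 2 (tbl d 0) (tbl d 1) κ &&
    tupleRead u 1 2 (queryCount (tbl d 0) (tbl d 0 + tbl d 1 + 2)) κ
  bl u d κ j := luBall u d κ j.unpair.1 j.unpair.2.unpair.1 j.unpair.2.unpair.2
  lay d pos := luLay (tbl d 0) (tbl d 1) pos
  primrec_hd := by fun_prop
  primrec_dn := by fun_prop
  primrec_bl := by fun_prop
  primrec_lay := by fun_prop

section Correctness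

variable {U : ℕ → List Bool} {d n m : ℕ} {A : Matrix (Fin n) (Fin m) ℝ} {z : ℕ → ℝ}

/-- The kernel vectors belonging to `d`. -/
def decVec (z : ℕ → ℝ) (n m d k : ℕ) : ℕ → ℝ :=
  certVec z n (n + m + 2) (tbl d 4) (tbl d 5) (tbl d 6) k

/-- The entries of the matrices of the LU-decomposition. -/
noncomputable def luVal (A : Matrix (Fin n) (Fin m) ℝ) (z : ℕ → ℝ) (d tag r c : ℕ) : ℝ :=
  if tag = 0 then if tbl (tbl d 4) r = c then 1 else 0
  else if tag = 1 then if r = c then 1 else 0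
  else if tag = 2 then
    if r < n then (∑ i ∈ Finset.range n, decVec z n m d r i * zeroExt A i c)
      * (decVec z n m d r (tbl (tbl d 4) r))⁻¹ else 0
  else if r < n then
    if c < n then horner n (strictPart (decVec z n m d) (tbl (tbl d 4))) n r c else 0 else 0

theorem Approx.pathAnsBall
    (hZ : ∀ e, Approx (fun κ => tupleSrc (U κ) 1 2 (queryCount n (n + m + 2)) κ e) (z e))
    (len E l i j : ℕ) :
    Approx (fun κ => pathAnsBall (U κ) n m κ len E l i j) (pathAns z n (n + m + 2) len E l i j) :=
  Approx.ite _ (fun _ => Approx.zero) fun _ => ((hZ _).add (hZ _)).sub Approx.one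

theorem Approx.certVecBall (h0 : tbl d 0 = n) (h1 : tbl d 1 = m)
    (hZ : ∀ e, Approx (fun κ => tupleSrc (U κ) 1 2 (queryCount n (n + m + 2)) κ e) (z e))
    (k : ℕ) {i : ℕ} (hi : i < n) :
    Approx (fun κ => certVecBall (U κ) d κ k i) (decVec z n m d k i) := by
  subst h0 h1
  exact Approx.backSub (fun l i j => Approx.pathAnsBall hZ _ _ l i j) _ hi

theorem Approx.certMassBall (h0 : tbl d 0 = n) (h1 : tbl d 1 = m)
    (hZ : ∀ e, Approx (fun κ => tupleSrc (U κ) 1 2 (queryCount n (n + m + 2)) κ e) (z e))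
    (k : ℕ) : Approx (fun κ => certMassBall (U κ) d κ k)
      (pathMass z n (n + m + 2) k (tbl (tbl d 5) k) (tbl (tbl d 6) k)) := by
  subst h0 h1
  exact Approx.freeMass fun i j => Approx.pathAnsBall hZ _ _ _ i j

theorem Approx.luBall (h0 : tbl d 0 = n) (h1 : tbl d 1 = m)
    (hZ : ∀ e, Approx (fun κ => tupleSrc (U κ) 1 2 (queryCount n (n + m + 2)) κ e) (z e))
    (hA : ∀ i j, Approx (fun κ => matSrc (U κ) 0 2 n m κ i j) (zeroExt A i j))
    (hs : ∀ k < n, tbl (tbl d 4) k < n)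
    (hx : ∀ k < n, (1 / 2 : ℝ) ^ tbl d 2 ≤ |decVec z n m d k (tbl (tbl d 4) k)|)
    (tag r c : ℕ) : Approx (fun κ => luBall (U κ) d κ tag r c) (luVal A z d tag r c) := by
  subst h0 h1
  have hinv : ∀ k < tbl d 0, Approx (fun κ => certInvBall (U κ) d κ k)
      (decVec z (tbl d 0) (tbl d 1) d k (tbl (tbl d 4) k))⁻¹ := fun k hk =>
    (Approx.certVecBall rfl rfl hZ k (hs k hk)).inv (hx k hk)
  refine Approx.ite _ (fun _ => Approx.ite _ (fun _ => Approx.one) fun _ => Approx.zero) fun _ =>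
    Approx.ite _ (fun _ => Approx.ite _ (fun _ => Approx.one) fun _ => Approx.zero) fun _ =>
    Approx.ite _ (fun _ => Approx.ite _ (fun hr => ?_) fun _ => Approx.zero) fun _ =>
    Approx.ite _ (fun hr => Approx.ite _ (fun hc => ?_) fun _ => Approx.zero) fun _ => Approx.zero
  · exact (Approx.sum fun i hi => (Approx.certVecBall rfl rfl hZ r hi).mul (hA i c)).mul
      (hinv r hr)
  · refine Approx.horner (fun k hk l hl => ?_) _ hr hc
    exact Approx.ite _ (fun _ =>
      ((Approx.certVecBall rfl rfl hZ k (hs l hl)).mul (hinv k hk)).neg) fun _ => Approx.zero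

end Correctness

section Congruence

variable {u u' : List Bool} {d κ : ℕ}

theorem certVecBall_congr
    (h : ∀ e, tupleSrc u 1 2 (queryCount (tbl d 0) (tbl d 0 + tbl d 1 + 2)) κ e
      = tupleSrc u' 1 2 (queryCount (tbl d 0) (tbl d 0 + tbl d 1 + 2)) κ e) (k i : ℕ) :
    certVecBall u d κ k i = certVecBall u' d κ k i := by
  simp only [certVecBall, pathVecBall, pathAnsBall, ansBall, h]

theorem certMassBall_congr
    (h : ∀ e, tupleSrc u 1 2 (queryCount (tbl d 0) (tbl d 0 + tbl d 1 + 2)) κ e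
      = tupleSrc u' 1 2 (queryCount (tbl d 0) (tbl d 0 + tbl d 1 + 2)) κ e) (k : ℕ) :
    certMassBall u d κ k = certMassBall u' d κ k := by
  simp only [certMassBall, pathMassBall, pathAnsBall, ansBall, h]

theorem luBall_congr
    (h : ∀ e, tupleSrc u 1 2 (queryCount (tbl d 0) (tbl d 0 + tbl d 1 + 2)) κ e
      = tupleSrc u' 1 2 (queryCount (tbl d 0) (tbl d 0 + tbl d 1 + 2)) κ e)
    (hA : ∀ i j, matSrc u 0 2 (tbl d 0) (tbl d 1) κ i j = matSrc u' 0 2 (tbl d 0) (tbl d 1) κ i j)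
    (tag r c : ℕ) : luBall u d κ tag r c = luBall u' d κ tag r c := by
  simp only [luBall, upperBall, lowerBall, strictBall, certInvBall, certVecBall_congr h, hA]

end Congruence

theorem lu_isName_of_layout {q : Cantor} {n m : ℕ} {r : ℕ → Cantor} {x : ℕ → ℕ → ℕ → ℝ}
    {P L : Matrix (Fin n) (Fin n) ℝ} {Q : Matrix (Fin m) (Fin m) ℝ}
    {U : Matrix (Fin n) (Fin m) ℝ} (hq : ∀ pos, q pos = outBit (luLay n m pos) r)
    (hr : ∀ tag i j, Represented.IsName (r (Nat.pair tag (Nat.pair i j))) (x tag i j))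
    (hP : ∀ i j, P i j = x 0 i j) (hQ : ∀ i j, Q i j = x 1 i j) (hU : ∀ i j, U i j = x 2 i j)
    (hL : ∀ i j, L i j = x 3 i j) :
    Represented.IsName q ((⟨n, n, P⟩, ⟨m, m, Q⟩, ⟨n, m, U⟩, ⟨n, n, L⟩) :
      RealMatrix × RealMatrix × RealMatrix × RealMatrix) := by
  refine ⟨RealMatrix.isName_of_layout (tag := 0) (r := r) (fun pos => ?_) fun i j => ?_,
    RealMatrix.isName_of_layout (tag := 1) (r := r) (fun pos => ?_) fun i j => ?_,
    RealMatrix.isName_of_layout (tag := 2) (r := r) (fun pos => ?_) fun i j => ?_,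
    RealMatrix.isName_of_layout (tag := 3) (r := r) (fun pos => ?_) fun i j => ?_⟩
  · change q (2 * pos + 0) = _
    rw [hq, luLay, if_pos (by omega)]
    congr 2
    omega
  · rw [hP]
    exact hr 0 i j
  · change q (2 * (2 * pos + 0) + 1) = _
    rw [hq, luLay, if_neg (by omega), if_pos (by omega)]
    congr 2
    omega
  · rw [hQ]
    exact hr 1 i j
  · change q (2 * (2 * (2 * pos + 0) + 1) + 1) = _
    rw [hq, luLay, if_neg (by omega), if_neg (by omega), if_pos (by omega)]
    congr 2
    omega
  · rw [hU]
    exact hr 2 i j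
  · change q (2 * (2 * (2 * pos + 1) + 1) + 1) = _
    rw [hq, luLay, if_neg (by omega), if_neg (by omega), if_neg (by omega)]
    congr 2
    omega
  · rw [hL]
    exact hr 3 i j

theorem luProgram_spec {p : Cantor} {n m : ℕ} {A : Matrix (Fin n) (Fin m) ℝ}
    {z : Fin (queryCount n (n + m + 2)) → Set.Icc (0 : ℝ) 1}
    (hA : Represented.IsName (fun k => p (0 + 2 * k)) (⟨n, m, A⟩ : RealMatrix))
    (hz : Represented.IsName (fun k => p (1 + 2 * k))
      (⟨_, z⟩ : Σ n : ℕ, (Fin n → Set.Icc (0 : ℝ) 1)))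
    (hans : ∀ e : Fin (queryCount n (n + m + 2)), z e ∈ rDiv (queryPair (zeroExt A) n (n + m + 2) e)) :
    ∃ o, Produces luProgram.run p o ∧ ∃ y ∈ luDecompRow ⟨n, m, A⟩, Represented.IsName o y := by
  obtain ⟨hs1, hs2, -⟩ := RealMatrix.name_entry hA
  obtain ⟨aball, a1, a2, -, a3⟩ := exists_matSrc hA
  obtain ⟨zball, z1, z2, z3⟩ := exists_tupleSrc hz
  set Z : ℕ → ℝ := fun e => if h : e < queryCount n (n + m + 2) then (z ⟨e, h⟩ : ℝ) else 0 with hZ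
  have hAns : Answers (zeroExt A) n (n + m + 2) Z := by
    intro e he hne
    simp only [hZ, dif_pos he]
    exact hans ⟨e, he⟩ hne
  have hT : ∀ κ, ∃ T, matRead (prefixOf p T) 0 2 n m κ = true ∧
      tupleRead (prefixOf p T) 1 2 (queryCount n (n + m + 2)) κ = true := fun κ => by
    obtain ⟨T₁, g1⟩ := a3 κ
    obtain ⟨T₂, g2⟩ := z3 κ
    exact ⟨max T₁ T₂, g1 _ (le_max_left _ _), g2 _ (le_max_right _ _)⟩
  choose T hTa hTz using hT
  have hAa : ∀ i j, Approx (fun κ => matSrc (prefixOf p (T κ)) 0 2 n m κ i j)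
      (zeroExt A i j) := fun i j => by
    simpa only [a2 _ _ (hTa _)] using a1 i j
  have hZa : ∀ e, Approx (fun κ => tupleSrc (prefixOf p (T κ)) 1 2
      (queryCount n (n + m + 2)) κ e) (Z e) := fun e => by
    simpa only [z2 _ _ (hTz _)] using z1 e
  have hsame : ∀ t κ, tupleRead (prefixOf p t) 1 2 (queryCount n (n + m + 2)) κ = true →
      ∀ e, tupleSrc (prefixOf p t) 1 2 (queryCount n (n + m + 2)) κ e
        = tupleSrc (prefixOf p (T κ)) 1 2 (queryCount n (n + m + 2)) κ e := fun t κ ht e => by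
    rw [z2 t κ ht, z2 _ κ (hTz κ)]
  have hd : ∀ t d, luProgram.hd (prefixOf p t) d = true → tbl d 0 = n ∧ tbl d 1 = m ∧
      certOk n (n + m + 2) (tbl d 4) (tbl d 5) (tbl d 6) = true ∧
      (∀ k < n, pathMass Z n (n + m + 2) k (tbl (tbl d 5) k) (tbl (tbl d 6) k) ≠ 1) ∧
      ∀ k < n, (1 / 2 : ℝ) ^ tbl d 2 < |decVec Z n m d k (tbl (tbl d 4) k)| := by
    intro t d htd
    simp only [luProgram, certCheck, Bool.and_eq_true, allBelow_eq_true] at htd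
    obtain ⟨g1, g2, g3, g4⟩ := htd
    obtain ⟨h0, h1⟩ := headOk_eq hs1 hs2 g1
    subst h0 h1
    have hc := hsame t _ g3
    have hslt : ∀ k < tbl d 0, tbl (tbl d 4) k < tbl d 0 := fun k hk => by
      rw [certOk, allBelow_eq_true] at g2
      exact (pivotOk_iff.1 (g2 k hk)).1
    refine ⟨rfl, rfl, g2, fun k hk h => ?_, fun k hk => ?_⟩
    · have h2 := (g4 k hk).1
      rw [certMassBall_congr hc] at h2
      have h3 := ((Approx.certMassBall rfl rfl hZa k).sub Approx.one).lt_abs h2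
      rw [h] at h3
      simp at h3
    · have h2 := (g4 k hk).2
      rw [certVecBall_congr hc] at h2
      have h3 := (Approx.certVecBall rfl rfl hZa k (hslt k hk)).lt_abs h2
      rwa [cast_qhalf] at h3
  obtain ⟨o, t, d, htd, ho, r, hr, hor⟩ := luProgram.run_spec (p := p)
    (fun d j => luVal A Z d j.unpair.1 j.unpair.2.unpair.1 j.unpair.2.unpair.2) (by
      obtain ⟨ds, dl, dE, hok, hcert⟩ := exists_cert (n := n) (b := n + m + 2) Z (by omega)
        (by omega)
      have hslt : ∀ k < n, tbl ds k < n := fun k hk => by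
        rw [certOk, allBelow_eq_true] at hok
        exact (pivotOk_iff.1 (hok k hk)).1
      obtain ⟨h, hh⟩ := exists_forall_lt (n := n)
        (P := fun k h => (1 / 2 : ℝ) ^ h
          < |certVec Z n (n + m + 2) ds dl dE k (tbl ds k)|) (fun k hk => by
        have h1 : Tendsto (fun h : ℕ => (1 / 2 : ℝ) ^ h) atTop (𝓝 0) :=
          tendsto_pow_atTop_nhds_zero_of_lt_one (by norm_num) (by norm_num)
        exact eventually_atTop.1 (h1.eventually (gt_mem_nhds (abs_pos.2 (hcert k hk).2))))
      have hh := hh h le_rfl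
      have hdec : ∀ κ₀, ∃ d, tbl d 0 = n ∧ tbl d 1 = m ∧ tbl d 2 = h ∧ tbl d 3 = κ₀ ∧
          tbl d 4 = ds ∧ tbl d 5 = dl ∧ tbl d 6 = dE := fun κ₀ => by
        obtain ⟨d, hd⟩ := exists_tbl (fun i => [n, m, h, κ₀, ds, dl, dE].getD i 0) 7
        exact ⟨d, hd 0 (by omega), hd 1 (by omega), hd 2 (by omega), hd 3 (by omega),
          hd 4 (by omega), hd 5 (by omega), hd 6 (by omega)⟩
      choose D e0 e1 e2 e3 e4 e5 e6 using hdec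
      obtain ⟨κ₀, hκ₀⟩ := exists_forall_lt (n := n)
        (P := fun k κ => farFrom 0 (bsub (pathMassBall (prefixOf p (T κ)) n m κ k (tbl dl k)
            (tbl dE k)) (bconst (qnat 1))) = true ∧
          farFrom (qhalf h) (pathVecBall (prefixOf p (T κ)) n m κ (tbl dl k) (tbl dE k)
            (tbl ds k) (tbl ds k)) = true) (fun k hk => by
        have h1 := (Approx.certMassBall (e0 0) (e1 0) hZa k).sub Approx.one
        have h2 := Approx.certVecBall (e0 0) (e1 0) hZa k (hslt k hk)
        simp only [certMassBall, certVecBall, decVec, e0, e1, e4, e5, e6] at h1 h2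
        obtain ⟨κ₁, g1⟩ := h1.eventually_farFrom (q := 0) (by
          rw [(hcert k hk).1]
          simp)
        obtain ⟨κ₂, g2⟩ := h2.eventually_farFrom (q := qhalf h) (by
          rw [cast_qhalf]
          exact hh k hk)
        exact ⟨max κ₁ κ₂, fun κ hκ => ⟨g1 κ (le_trans (le_max_left _ _) hκ),
          g2 κ (le_trans (le_max_right _ _) hκ)⟩⟩)
      have hκ₀ := hκ₀ κ₀ le_rfl
      obtain ⟨T₁, g1⟩ := exists_headOk hs1 hs2
      obtain ⟨T₂, g2⟩ := z3 κ₀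
      refine ⟨max T₁ T₂, D κ₀, ?_⟩
      have hread := g2 _ (le_max_right T₁ T₂)
      simp only [luProgram, certCheck, Bool.and_eq_true, allBelow_eq_true, e0, e1, e3, e4]
      refine ⟨g1 _ (le_max_left _ _), by rwa [e5, e6], hread, fun k hk => ?_⟩
      have hc : ∀ e, tupleSrc (prefixOf p (max T₁ T₂)) 1 2 (queryCount (tbl (D κ₀) 0)
          (tbl (D κ₀) 0 + tbl (D κ₀) 1 + 2)) κ₀ e = tupleSrc (prefixOf p (T κ₀)) 1 2
          (queryCount (tbl (D κ₀) 0) (tbl (D κ₀) 0 + tbl (D κ₀) 1 + 2)) κ₀ e := by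
        rw [e0, e1]
        exact hsame _ _ hread
      rw [certMassBall_congr hc, certVecBall_congr hc]
      simp only [certMassBall, certVecBall, e0, e1, e2, e4, e5, e6]
      exact hκ₀ k hk) (by
      intro t d htd
      obtain ⟨h0, h1, hok, hmass, hx⟩ := hd t d htd
      subst h0 h1
      refine ⟨fun κ j => luBall (prefixOf p (T κ)) d κ j.unpair.1 j.unpair.2.unpair.1
        j.unpair.2.unpair.2, fun t κ j ht => ?_, fun κ => ⟨T κ, ?_⟩, fun j => ?_⟩
      · simp only [luProgram, Bool.and_eq_true] at ht
        refine luBall_congr (hsame t κ ht.2) (fun i j => ?_) _ _ _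
        rw [a2 t κ ht.1, a2 _ κ (hTa κ)]
      · simp only [luProgram, Bool.and_eq_true]
        exact ⟨hTa κ, hTz κ⟩
      · refine Approx.luBall rfl rfl hZa hAa (fun k hk => ?_) (fun k hk => (hx k hk).le) _ _ _
        rw [certOk, allBelow_eq_true] at hok
        exact (pivotOk_iff.1 (hok k hk)).1)
  obtain ⟨h0, h1, hok, hmass, hx⟩ := hd t d htd
  obtain ⟨σ, hσ, hLU⟩ := isLUDecomp_of_cert A hAns hok hmass fun k hk h => by
    have := hx k hk
    rw [decVec, h, abs_zero] at this
    exact absurd this (not_lt.2 (by positivity))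
  refine ⟨o, ho, _, ⟨_, _, _, hLU, rfl⟩, ?_⟩
  refine lu_isName_of_layout (x := fun tag i j => luVal A Z d tag i j) (r := r) (fun pos => ?_)
    (fun tag i j => ?_) (fun i j => ?_) (fun i j => ?_) (fun i j => ?_) fun i j => ?_
  · rw [hor]
    simp only [luProgram, h0, h1]
  · simpa only [Nat.unpair_pair] using hr (Nat.pair tag (Nat.pair i j))
  · simp [luVal, Equiv.Perm.permMatrix, PEquiv.toMatrix_apply, ← hσ, Fin.ext_iff]
  · simp [luVal, Matrix.one_apply, Fin.ext_iff]
  · have hi : (i : ℕ) < n := i.2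
    simp [luVal, hi, decVec]
  · have hi : (i : ℕ) < n := i.2
    have hj : (j : ℕ) < n := j.2
    simp only [luVal, hi, hj, if_true, Matrix.of_apply]
    rfl

theorem rDiv_nonempty (x : ℝ × ℝ) : (rDiv x).Nonempty := by
  by_cases h : x.2 = 0
  · exact ⟨⟨0, by simp⟩, fun h' => absurd h h'⟩
  · exact ⟨⟨min |x.1| |x.2| / |x.2|, by positivity,
      (div_le_one (abs_pos.2 h)).2 (min_le_right _ _)⟩, fun _ => rfl⟩

theorem finStar_rDiv_nonempty (x : Σ n : ℕ, (Fin n → ℝ × ℝ)) : (finStar rDiv x).Nonempty := by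
  choose y hy using fun i => rDiv_nonempty (x.2 i)
  exact ⟨_, y, hy, rfl⟩

/-- Row-permuting LU-decompositions can be computed from robust divisions. -/
theorem le_finStar_rDiv
    (g : RealMatrix → Set (RealMatrix × RealMatrix × RealMatrix × RealMatrix))
    (hg : ∀ A, luDecompRow A ⊆ g A) : WLE g (finStar rDiv) := by
  refine WLE.of_programs queryProgram luProgram ?_
  rintro p ⟨n, m, A⟩ hp -
  obtain ⟨o, ho, hon⟩ := queryProgram_spec hp
  refine ⟨o, _, ho, hon, finStar_rDiv_nonempty _, ?_⟩
  rintro q _ ⟨z, hz, rfl⟩ hq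
  obtain ⟨o', ho', y, hy, hoy⟩ := luProgram_spec (p := join p q) (A := A) (z := z) (by
    convert hp using 1
    funext k
    rw [zero_add, join_even]) (by
    convert hq using 1
    funext k
    rw [add_comm, join_odd]) hz
  exact ⟨o', y, ho', hg _ hy, hoy⟩

theorem luDecompRow_nonempty (A : RealMatrix) : (luDecompRow A).Nonempty := by
  obtain ⟨n, m, A⟩ := A
  obtain ⟨p, hp⟩ := Represented.exists_name (⟨n, m, A⟩ : RealMatrix)
  choose z hz using fun e : Fin (queryCount n (n + m + 2)) =>
    rDiv_nonempty (queryPair (zeroExt A) n (n + m + 2) e)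
  obtain ⟨q, hq⟩ := Represented.exists_name
    (⟨_, z⟩ : Σ n : ℕ, (Fin n → Set.Icc (0 : ℝ) 1))
  obtain ⟨_, -, y, hy, -⟩ := luProgram_spec (p := join p q) (A := A) (z := z) (by
    convert hp using 1
    funext k
    rw [zero_add, join_even]) (by
    convert hq using 1
    funext k
    rw [add_comm, join_odd]) hz
  exact ⟨y, hy⟩

theorem luDecompRow_subset (A : RealMatrix) : luDecompRow A ⊆ luDecompPQ A := by
  rintro _ ⟨P, U, L, h, rfl⟩
  exact ⟨P, 1, U, L, h, rfl⟩

/-! ### Identities and constants -/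

/-- The symbols at the places `c, c + 2, c + 4, …`. -/
def sampleWord (c : ℕ) (u : List Bool) : List Bool :=
  (List.range (u.length / 2)).map fun k => u.getD (2 * k + c) false

theorem computable_sampleWord (c : ℕ) : Computable (sampleWord c) :=
  Primrec.to_comp (by unfold sampleWord; fun_prop)

theorem sampleWord_mono {c : ℕ} (hc : c ≤ 1) {u v : List Bool} (h : u <+: v) :
    sampleWord c u <+: sampleWord c v := by
  have hle : u.length / 2 ≤ v.length / 2 := Nat.div_le_div_right h.length_le
  have e : sampleWord c u
      = (List.range (u.length / 2)).map fun k => v.getD (2 * k + c) false := by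
    refine List.map_congr_left fun k hk => ?_
    have hk := List.mem_range.1 hk
    obtain ⟨w, rfl⟩ := h
    rw [List.getD_append _ _ _ _ (by omega)]
  rw [e, sampleWord]
  refine List.IsPrefix.map _ ?_
  rw [← Nat.add_sub_cancel' hle, List.range_add]
  exact List.prefix_append _ _

theorem produces_sampleWord {c : ℕ} (hc : c ≤ 1) (r : Cantor) :
    Produces (sampleWord c) r fun k => r (2 * k + c) := by
  intro n
  refine ⟨2 * n, ?_⟩
  have : sampleWord c (prefixOf r (2 * n)) = prefixOf (fun k => r (2 * k + c)) n := by
    rw [sampleWord, length_prefixOf, Nat.mul_div_cancel_left _ two_pos]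
    refine List.map_congr_left fun k hk => ?_
    have hk := List.mem_range.1 hk
    rw [getD_prefixOf, if_pos (by omega)]
  rw [this]

theorem WLE.refl {X Y : Type} [Represented X] [Represented Y] (f : X → Set Y) : WLE f f := by
  refine WLE.of_wordFunctions id (sampleWord 1) Computable.id (fun _ _ h => h)
    (computable_sampleWord 1) (fun _ _ => sampleWord_mono le_rfl) fun p x hp hx =>
    ⟨p, x, fun k => ⟨k, List.prefix_rfl⟩, hp, hx, fun q y hy hq => ⟨q, y, ?_, hy, hq⟩⟩
  simpa only [join_odd] using produces_sampleWord le_rfl (join p q)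

/-- The identity reduces to every finite parallelization. -/
theorem identity_le_finStar {X Y Z : Type} [Represented X] [Represented Y] [Represented Z]
    (f : Y → Set Z) : WLE (fun x : X => {x}) (finStar f) := by
  refine WLE.of_wordFunctions (fun u => (List.range u.length).map fun k => decide (k = 0))
    (sampleWord 0) (Primrec.to_comp (by fun_prop)) (fun u v h => ?_)
    (computable_sampleWord 0) (fun _ _ => sampleWord_mono zero_le_one) fun p x hp _ =>
    ⟨fun k => decide (k = 0), ⟨0, fun i => i.elim0⟩, fun n => ⟨n, ?_⟩,
      ⟨fun k hk => absurd hk (Nat.not_lt_zero k), by simp, fun i => i.elim0⟩,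
      ⟨_, fun i => i.elim0, fun i => i.elim0, rfl⟩,
      fun q _ _ _ => ⟨p, x, ?_, rfl, hp⟩⟩
  · refine List.IsPrefix.map _ ?_
    rw [← Nat.add_sub_cancel' h.length_le, List.range_add]
    exact List.prefix_append _ _
  · simp only [length_prefixOf]
    exact List.prefix_rfl
  · simpa only [add_zero, join_even] using produces_sampleWord zero_le_one (join p q)

theorem mcomp_identity {X Y : Type} (g : X → Set Y) : mcomp (fun y : Y => {y}) g = g := by
  funext x
  ext z
  simp [mcomp]

end WeihrauchLU


theorem mainTheorem6 :
    WEquiv luDecompPQ (finStar rDiv) ∧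
      WLE (finStar rDiv) luDecompRow ∧
      WLECompProduct luDecompRow (finStar rDiv) (finStar rDiv) := by
  have hPQ : ∀ A, (luDecompPQ A).Nonempty := fun A =>
    (luDecompRow_nonempty A).mono (luDecompRow_subset A)
  refine ⟨⟨le_finStar_rDiv _ luDecompRow_subset, finStar_rDiv_le _ hPQ fun _ => subset_rfl⟩,
    finStar_rDiv_le _ luDecompRow_nonempty luDecompRow_subset, ?_⟩
  refine ⟨RealMatrix, RealMatrix × RealMatrix × RealMatrix × RealMatrix, _, inferInstance,
    inferInstance, inferInstance, fun y => {y}, luDecompRow, identity_le_finStar rDiv,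
    le_finStar_rDiv _ fun _ => subset_rfl, ?_⟩
  rw [mcomp_identity]
  exact WLE.refl _
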